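/- **Setting.** Let $N\ge 2$ and let $\Omega\subset\mathbb R^N$ be a bounded smooth domain (nonempty, open, connected) with outer unit normal $N_{\partial\Omega}$. Let $\Sigma\subset\mathbb R^N$ be a smooth, orientable, compact, connected hypersurface with boundary $\partial\Sigma$, let $\Sigma_0\subset\mathbb R^N$ be a smooth, orientable, connected hypersurface without boundary, and let $\tilde\Sigma$ be a smooth, orientable, compact, connected hypersurface with boundary such that $\Sigma\subsetneq\tilde\Sigma^\circ=\tilde\Sigma\setminus\partial\tilde\Sigma$ and $\tilde\Sigma\subsetneq\Sigma_0$. Let $T,\tau_0>0$ and let $X_0:\Sigma_0\times(-\tau_0,T+\tau_0)\to\mathbb R^N$ be smooth such that each $X_0(\cdot,t)$ is an injective immersion. For $t\in[0,T]$ put $\Gamma_t:=X_0(\Sigma,t)$, and let $\Gamma:=\bigcup_{t\in[0,T]}\Gamma_t\times\{t\}$ and $\overline X_0(s,t):=(X_0(s,t),t)$. Assume that for all $t\in[0,T]$ we have $X_0(s,t)\in\Omega$ for $s\in\Sigma\setminus\partial\Sigma$ and $X_0(\sigma,t)\in\partial\Omega$ for $\sigma\in\partial\Sigma$. Let $\vec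 n:\Sigma\times[0,T]\to\mathbb R^N$ be smooth such that $\vec n(\cdot,t)$ is a unit normal field of $\Gamma_t$, and assume that the angle between $N_{\partial\Omega}|_{X_0(\sigma,t)}$ and $\vec n(\sigma,t)$ is $\frac\pi2$ for all $(\sigma,t)\in\partial\Sigma\times[0,T]$. For $(s,t)\in\Sigma\times[0,T]$ let $V(s,t):=\vec n(s,t)\cdot\partial_tX_0(s,t)$ be the normal velocity, and let $H(s,t)$ be the mean curvature of $\Gamma_t$ at $X_0(s,t)$ with respect to $\vec n$, i.e. the sum of the principal curvatures, which are the eigenvalues of the shape operator $v\mapsto -D_v\vec n$. Let $\vec n_{\partial\Sigma}$ be the outer unit conormal of $\partial\Sigma$ in $\Sigma$. Finally, let $\mu_1>0$ be so small that the normal exponential map $\tilde Y:\partial\Sigma\times[-2\mu_1,2\mu_1]\to\tilde\Sigma$ (for which $\tilde Y(\sigma,\cdot)$ is the geodesic of $\tilde\Sigma$ with $\tilde Y(\sigma,0)=\sigma$ and $\partial_b\tilde Y(\sigma,0)=-\vec n_{\partial\Sigma}(\sigma)$) is a smooth diffeomorphism onto a neighbourhood of $\partial\Sigma$ in $\tilde\Sigma$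 and $Y:=\tilde Y|_{\partial\Sigma\times[0,2\mu_1]}$ maps onto a neighbourhood $R(Y)$ of $\partial\Sigma$ in $\Sigma$. **Theorem.** There are $\delta>0$ and a smooth map $X:[-\delta,\delta]\times\Sigma\times[0,T]\to\overline\Omega$, $(r,s,t)\mapsto X(r,s,t)$, with the following properties. 1. $\overline X:=(X,\mathrm{pr}_t)$ is a homeomorphism onto a neighbourhood of $\Gamma$ in $\overline\Omega\times[0,T]$. It can be extended to a smooth diffeomorphism from an open neighbourhood of $[-\delta,\delta]\times\Sigma\times[0,T]$ in $\mathbb R\times\tilde\Sigma\times\mathbb R$ onto an open subset of $\mathbb R^{N+1}$. For every $\tilde\delta\in(0,\delta]$ the set $\Gamma(\tilde\delta):=\overline X((-\tilde\delta,\tilde\delta)\times\Sigma\times[0,T])$ is an open neighbourhood of $\Gamma$ in $\overline\Omega\times[0,T]$. 2. $X(0,s,t)=X_0(s,t)$ for all $(s,t)\in\Sigma\times[0,T]$, and there is $\mu_0\in(0,\mu_1]$ such that $X(r,s,t)=X_0(s,t)+r\,\vec n(s,t)$ for all $r\in[-\delta,\delta]$, $s\in\Sigma\setminus Y(\partial\Sigma\times[0,\mu_0])$,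 $t\in[0,T]$. Moreover, for all $(r,s,t)\in[-\delta,\delta]\times\Sigma\times[0,T]$, $X(r,s,t)\in\partial\Omega$ if and only if $s\in\partial\Sigma$. 3. Let $(r,s,\mathrm{pr}_t)$ be the inverse of $\overline X$, defined on $\overline{\Gamma(\delta)}=\overline X([-\delta,\delta]\times\Sigma\times[0,T])$; here and below $\nabla$, $\Delta$, $D_x$ are taken with respect to $x$, up to the boundary. For all $(x,t)\in\overline{\Gamma(\delta)}$ the vectors $\partial_{x_j}s|_{(x,t)}$, $j=1,\dots,N$, span the tangent space $T_{s(x,t)}\Sigma$; there is $c>0$ with $|\nabla r|_{(x,t)}|\ge c$ for all $(x,t)\in\overline{\Gamma(\delta)}$; and $D_xs(D_xs)^\top|_{(x,t)}$ is positive definite as a linear map of $T_{s(x,t)}\Sigma$ into itself, uniformly in $(x,t)\in\overline{\Gamma(\delta)}$. Furthermore, $$|\nabla r|^2|_\Gamma=1,\qquad \partial_r\big(|\nabla r|^2\circ\overline X\big)\big|_{r=0}=0,\qquad D_xs\,\nabla r|_\Gamma=0,$$ and for all $r\in[-\delta,\delta]$, $s\in\Sigma\setminus Y(\partial\Sigma\times[0,\mu_0])$,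 $t\in[0,T]$, $$\nabla r|_{\overline X(r,s,t)}=\vec n(s,t),\qquad D_xs|_{\overline X(r,s,t)}\,\vec n(s,t)=0.$$ Moreover, on all of $\Sigma\times[0,T]$, $$\nabla r\circ\overline X_0=\vec n,\qquad V=-\partial_tr\circ\overline X_0,\qquad H=-\Delta r\circ\overline X_0 .$$ 4. Let $(\sigma,b):=Y^{-1}\circ s:\overline X([-\delta,\delta]\times R(Y)\times[0,T])\to\partial\Sigma\times[0,2\mu_1]$. Then there is $c>0$ such that for all $(\sigma,t)\in\partial\Sigma\times[0,T]$ $$N_{\partial\Omega}\cdot\nabla b|_{\overline X_0(\sigma,t)}=-\big(D_xs\,N_{\partial\Omega}\big)|_{\overline X_0(\sigma,t)}\cdot\vec n_{\partial\Sigma}|_\sigma,\qquad \big|N_{\partial\Omega}\cdot\nabla b|_{\overline X_0(\sigma,t)}\big|\ge c,$$ $$\nabla b\cdot\nabla r|_{\overline X_0(\sigma,t)}=0,\qquad \big|\nabla b|_{\overline X_0(\sigma,t)}\big|\ge c .$$ -/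

import Mathlib

open Set Topology
open scoped ContDiff

noncomputable section

namespace CurvCoord

/-- Euclidean space `ℝ^N`. -/
abbrev Euc (N : ℕ) : Type := EuclideanSpace ℝ (Fin N)

/-! ### Smooth domains, hypersurfaces, tangent spaces, normals

Smoothness of a map on a (possibly lower-dimensional) set `A` is always `ContDiffOn ℝ ∞ f A`. When
`A` is a submanifold (with boundary or corners) this is smoothness in charts, i.e. `f` is locally the
restriction of a smooth map of the ambient space. -/

/-- A bounded smooth domain: nonempty, open, connected, bounded, and near each boundary point it is
the sublevel set `{φ < 0}` of a smooth function with non-vanishing gradient. -/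
structure IsBoundedSmoothDomain {N : ℕ} (Ω : Set (Euc N)) : Prop where
  isOpen : IsOpen Ω
  isConnected : IsConnected Ω
  isBounded : Bornology.IsBounded Ω
  smooth_boundary : ∀ p ∈ frontier Ω, ∃ (U : Set (Euc N)) (φ : Euc N → ℝ),
    IsOpen U ∧ p ∈ U ∧ ContDiffOn ℝ ∞ φ U ∧ (∀ x ∈ U, gradient φ x ≠ 0) ∧
    Ω ∩ U = {x ∈ U | φ x < 0}

/-- Near `p` the set `S` is a smooth hypersurface without boundary: a regular level set. -/
def IsInteriorPoint {N : ℕ} (S : Set (Euc N)) (p : Euc N) : Prop :=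
  ∃ (U : Set (Euc N)) (φ : Euc N → ℝ),
    IsOpen U ∧ p ∈ U ∧ ContDiffOn ℝ ∞ φ U ∧ (∀ x ∈ U, gradient φ x ≠ 0) ∧
    S ∩ U = {x ∈ U | φ x = 0}

/-- Near `p` the set `S` is a smooth hypersurface with boundary and `p` lies on the boundary:
`S` is `{φ = 0, ψ ≤ 0}` with `∇φ, ∇ψ` linearly independent, and `φ p = ψ p = 0`. -/
def IsBoundaryPoint {N : ℕ} (S : Set (Euc N)) (p : Euc N) : Prop :=
  ∃ (U : Set (Euc N)) (φ ψ : Euc N → ℝ),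
    IsOpen U ∧ p ∈ U ∧ ContDiffOn ℝ ∞ φ U ∧ ContDiffOn ℝ ∞ ψ U ∧
    (∀ x ∈ U, LinearIndependent ℝ ![gradient φ x, gradient ψ x]) ∧
    φ p = 0 ∧ ψ p = 0 ∧ S ∩ U = {x ∈ U | φ x = 0 ∧ ψ x ≤ 0}

/-- A smooth (embedded) hypersurface of `ℝ^N` without boundary. -/
def IsHypersurface {N : ℕ} (S : Set (Euc N)) : Prop :=
  ∀ p ∈ S, IsInteriorPoint S p

/-- A smooth (embedded) hypersurface of `ℝ^N` with boundary. -/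
def IsHypersurfaceWithBoundary {N : ℕ} (S : Set (Euc N)) : Prop :=
  ∀ p ∈ S, IsInteriorPoint S p ∨ IsBoundaryPoint S p

/-- The manifold boundary `∂S` of a hypersurface with boundary. -/
def bdry {N : ℕ} (S : Set (Euc N)) : Set (Euc N) := {p ∈ S | IsBoundaryPoint S p}

/-- The tangent space `T_p S`: the linear span of all tangent directions to `S` at `p`. At a boundary
point of a hypersurface this is the full `(N-1)`-dimensional tangent space. -/
def tangentSpace {N : ℕ} (S : Set (Euc N)) (p : Euc N) : Submodule ℝ (Euc N) :=
  Submodule.span ℝ (tangentConeAt ℝ S p)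

/-- Orientability of a hypersurface in `ℝ^N`: there is a continuous unit normal field. -/
def IsOrientable {N : ℕ} (S : Set (Euc N)) : Prop :=
  ∃ ν : Euc N → Euc N, ContinuousOn ν S ∧ ∀ p ∈ S, ‖ν p‖ = 1 ∧ ν p ∈ (tangentSpace S p)ᗮ

/-- `ν` is the outer unit normal of the smooth domain `Ω` at `x ∈ ∂Ω`: a unit vector orthogonal to
`T_x ∂Ω` such that `-ν` points into `Ω`. -/
def IsOuterUnitNormal {N : ℕ} (Ω : Set (Euc N)) (x ν : Euc N) : Prop :=
  ‖ν‖ = 1 ∧ ν ∈ (tangentSpace (frontier Ω) x)ᗮ ∧ -ν ∈ posTangentConeAt Ω x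

/-- `m` is the outer unit conormal of the hypersurface `S` at `p ∈ ∂S`: a unit vector in `T_p S`
orthogonal to `T_p ∂S` such that `-m` points into `S`. -/
def IsOuterUnitConormal {N : ℕ} (S : Set (Euc N)) (p m : Euc N) : Prop :=
  ‖m‖ = 1 ∧ m ∈ tangentSpace S p ∧ m ∈ (tangentSpace (bdry S) p)ᗮ ∧ -m ∈ posTangentConeAt S p

/-- The shape operator (Weingarten map) `v ↦ -D_v ν` of a hypersurface `M` with unit normal field `ν`
at `p`, as an endomorphism of `T_p M`. (`D_v ν` is tangential as `|ν| = 1`, so that the projection is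
only there to make the codomain `T_p M`; the derivative within `M` is only evaluated at tangent
vectors, where it is uniquely determined.) -/
def shapeOperator {N : ℕ} (M : Set (Euc N)) (ν : Euc N → Euc N) (p : Euc N) :
    tangentSpace M p →ₗ[ℝ] tangentSpace M p :=
  -((tangentSpace M p).orthogonalProjectionOnto.toLinearMap ∘ₗ
      (fderivWithin ℝ ν M p).toLinearMap ∘ₗ (tangentSpace M p).subtype)

/-- Mean curvature: the sum of the principal curvatures, i.e. the sum of the eigenvalues (the trace)
of the shape operator. -/
def meanCurvature {N : ℕ} (M : Set (Euc N)) (ν : Euc N → Euc N) (p : Euc N) : ℝ :=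
  LinearMap.trace ℝ (tangentSpace M p) (shapeOperator M ν p)

/-! ### Evolving hypersurfaces `Γ_t = X₀(S, t)` -/

/-- The hypersurface `Γ_t = X₀(S, t)` at time `t`. -/
def slice {N : ℕ} (X₀ : Euc N × ℝ → Euc N) (S : Set (Euc N)) (t : ℝ) : Set (Euc N) :=
  (fun s => X₀ (s, t)) '' S

/-- `n(·, t)` viewed as a field on `Γ_t`: at `x = X₀(s, t)`, `s ∈ S`, its value is `n(s, t)`. -/
def sliceNormal {N : ℕ} (X₀ n : Euc N × ℝ → Euc N) (S : Set (Euc N)) (t : ℝ) (x : Euc N) : Euc N :=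
  n (Function.invFunOn (fun s => X₀ (s, t)) S x, t)

/-- The mean curvature `H(s, t)` of `Γ_t` at `X₀(s, t)` with respect to `n(·, t)`. -/
def evolvingMeanCurvature {N : ℕ} (X₀ n : Euc N × ℝ → Euc N) (S : Set (Euc N)) (s : Euc N) (t : ℝ) :
    ℝ :=
  meanCurvature (slice X₀ S t) (sliceNormal X₀ n S t) (X₀ (s, t))

/-- The normal velocity `V(s, t) = n(s, t) · ∂_t X₀(s, t)` for `t ∈ [0, T]`. -/
def evolvingNormalVelocity {N : ℕ} (X₀ n : Euc N × ℝ → Euc N) (T : ℝ) (s : Euc N) (t : ℝ) : ℝ :=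
  inner ℝ (n (s, t)) (derivWithin (fun t' => X₀ (s, t')) (Icc 0 T) t)

/-! ### Diffeomorphisms, relative neighbourhoods, normal tubular coordinates -/

/-- `f` restricts to a smooth diffeomorphism of `A` onto `B`, with inverse `g`. -/
structure IsDiffeo {E F : Type*} [NormedAddCommGroup E] [NormedSpace ℝ E]
    [NormedAddCommGroup F] [NormedSpace ℝ F] (f : E → F) (g : F → E) (A : Set E) (B : Set F) :
    Prop where
  image_eq : f '' A = B
  leftInv : LeftInvOn g f A
  smooth : ContDiffOn ℝ ∞ f A
  smooth_inv : ContDiffOn ℝ ∞ g B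

/-- `A` is a neighbourhood of `B` in the subspace `C`. -/
def IsNhdIn {α : Type*} [TopologicalSpace α] (A B C : Set α) : Prop :=
  A ⊆ C ∧ ∃ U, IsOpen U ∧ B ⊆ U ∧ U ∩ C ⊆ A

/-- `A` is an open subset of the subspace `C`. -/
def IsOpenIn {α : Type*} [TopologicalSpace α] (A C : Set α) : Prop :=
  ∃ U, IsOpen U ∧ A = U ∩ C

/-- `Y : ∂S × [-2μ, 2μ] → S'` is the tubular neighbourhood coordinate system of `∂S` in the
hypersurface `S' ⊇ S` given by the exponential map on the normal bundle: `Y(σ, ·)` is the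
geodesic of `S'` (acceleration normal to `S'`) starting in `σ` with velocity `-m σ`, where `m` is
the outer unit conormal of `S`; and `μ` is so small that `Y` is a diffeomorphism onto a neighbourhood
of `∂S` in `S'` and maps `∂S × [0, 2μ]` onto a neighbourhood of `∂S` in `S`.
`Yinv = (σ̃, b̃)` is the inverse of `Y`. -/
structure IsNormalTube {N : ℕ} (S S' : Set (Euc N)) (m : Euc N → Euc N) (μ : ℝ)
    (Y : Euc N × ℝ → Euc N) (Yinv : Euc N → Euc N × ℝ) : Prop where
  pos : 0 < μ
  start : ∀ σ ∈ bdry S, Y (σ, 0) = σ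
  velocity : ∀ σ ∈ bdry S, deriv (fun b => Y (σ, b)) 0 = -m σ
  geodesic : ∀ σ ∈ bdry S, ∀ b ∈ Ioo (-(2 * μ)) (2 * μ),
    deriv (deriv fun b' => Y (σ, b')) b ∈ (tangentSpace S' (Y (σ, b)))ᗮ
  diffeo : IsDiffeo Y Yinv (bdry S ×ˢ Icc (-(2 * μ)) (2 * μ))
    (Y '' (bdry S ×ˢ Icc (-(2 * μ)) (2 * μ)))
  nhd : IsNhdIn (Y '' (bdry S ×ˢ Icc (-(2 * μ)) (2 * μ))) (bdry S) S'
  nhd_half : IsNhdIn (Y '' (bdry S ×ˢ Icc 0 (2 * μ))) (bdry S) S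

/-! ### Coordinates in space-time and spatial derivatives -/

/-- `[-δ, δ] × S × [0, T]`, the domain of `(r, s, t) ↦ X(r, s, t)`. -/
def box {N : ℕ} (δ : ℝ) (S : Set (Euc N)) (T : ℝ) : Set (ℝ × Euc N × ℝ) :=
  Icc (-δ) δ ×ˢ S ×ˢ Icc 0 T

/-- `(X, pr_t)`. -/
def withTime {N : ℕ} (X : ℝ × Euc N × ℝ → Euc N) (q : ℝ × Euc N × ℝ) : Euc N × ℝ :=
  (X q, q.2.2)

/-- The space-time track `Γ = ⋃_{t ∈ [0, T]} Γ_t × {t}`. -/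
def track {N : ℕ} (X₀ : Euc N × ℝ → Euc N) (S : Set (Euc N)) (T : ℝ) : Set (Euc N × ℝ) :=
  {q | q.2 ∈ Icc 0 T ∧ q.1 ∈ slice X₀ S q.2}

/-- The spatial gradient `∇ f` at `(x, t)`. -/
def gradX {N : ℕ} (f : Euc N × ℝ → ℝ) (q : Euc N × ℝ) : Euc N :=
  gradient (fun x => f (x, q.2)) q.1

/-- The spatial Laplacian `Δ f` at `(x, t)`. -/
def lapX {N : ℕ} (f : Euc N × ℝ → ℝ) (q : Euc N × ℝ) : ℝ :=
  Laplacian.laplacian (fun x => f (x, q.2)) q.1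

/-- The time derivative `∂_t f` at `(x, t)`. -/
def dT {N : ℕ} (f : Euc N × ℝ → ℝ) (q : Euc N × ℝ) : ℝ :=
  deriv (fun t => f (q.1, t)) q.2

/-- The spatial differential `D_x f` at `(x, t)`. -/
def DX {N : ℕ} (f : Euc N × ℝ → Euc N) (q : Euc N × ℝ) : Euc N →L[ℝ] Euc N :=
  fderiv ℝ (fun x => f (x, q.2)) q.1

end CurvCoord

end

open CurvCoord

namespace CurvCoord

open Filter Module

/-! ### Inverse and implicit functions along a compact set. -/

section InverseNearCompact

variable {E F : Type*} [NormedAddCommGroup E] [NormedSpace ℝ E] [FiniteDimensional ℝ E]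
  [NormedAddCommGroup F] [NormedSpace ℝ F] [FiniteDimensional ℝ F]

/-! The straight tube `X₀ + r n` need not respect `∂Ω` near `∂S`. It is corrected there without
spoiling its first-order behaviour on `Γ`. Write `Ω = {φ < 0}`; the contact angle says that `∇φ ⟂ n`
at the contact points. Let `w` be the part of `∇φ` orthogonal to `n`, and near `∂S` put `X = X₀ + r
n + β w`, where `β` solves `φ(X) = φ(X₀) + r ∇φ·n`. A cutoff removes the correction away from `∂S`
(`exists_coordinate_map`). Three facts follow. On `∂S` the right-hand side is zero, so the curves
stay in `∂Ω`. It is also the first-order Taylor polynomial, so `β` has zero derivative in `r` at `r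
= 0`, and `∂_r X = n` there. Finally `w ⟂ n` gives `n·(X - X₀) = r` for every `r`.

These facts yield the formulas on `Γ`. The velocity `∂_r X = n` is a unit vector orthogonal to
`Γ_t`, so `∇r = n` and `D_x s n = 0`. From `n·∂_r X = 1` for all `r` comes `n·∂_r² X = 0`, and
differentiating `∇r·∂_r X = 1` then gives `n·D²r n = 0` (`inner_fderiv_gradX_normal`). This is the
claim on `∂_r |∇r|²`; it also shows that the trace of `D²r` over the tangent space is all of `Δr`,
whence `H = -Δr`. Differentiating `r(X₀(s, t), t) = 0` in `t` gives `V = -∂_t r`.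

To have open domains for the calculus, `X₀` and `n` are extended to `χ` and `ν` on a neighbourhood
of `S × [0, T]` in space-time, and `S'` is written near `S` as the zero set of a global function `ψ`
(`exists_ambient_extension`). The map `(X, t, ψ)` is then a diffeomorphism near the compact set `{0}
× S × [0, T]`; restricting its inverse to the value `0` of the last component yields `r` and `s`
(`exists_inverse_coord`).

That the image is a full neighbourhood of `Γ` in the closure of `Ω` comes from
`eventually_level_sign`: near `∂S` the function `φ ∘ X` vanishes on `∂S` and increases strictly
across it, so on `{ψ = 0}` the condition `φ(X) ≤ 0` singles out `S`.

For the last part, the differential of `b` at `∂S` is `v ↦ -v·m` on tangent vectors. A vector `k`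
for which `D_x s k` has no conormal component is a sum of a multiple of `n` and an image of a vector
tangent to `∂S`, hence tangent to `∂Ω`. The outer normal of `Ω` is not, and compactness makes the
bound uniform. -/

theorem exists_equiv_of_injective (hdim : finrank ℝ E = finrank ℝ F) {A : E →L[ℝ] F}
    (hA : Function.Injective A) : ∃ e : E ≃L[ℝ] F, (e : E →L[ℝ] F) = A := by
  let e := (LinearEquiv.ofInjectiveOfFinrankEq (A : E →ₗ[ℝ] F) hA hdim).toContinuousLinearEquiv
  exact ⟨e, by ext x; rfl⟩

/-- The inverse function theorem along a compact set. -/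
theorem exists_inverse_near_compact {f : E → F} {U K : Set E} (hU : IsOpen U)
    (hf : ContDiffOn ℝ ∞ f U) (hK : IsCompact K) (hKU : K ⊆ U) (hinj : InjOn f K)
    (hdim : finrank ℝ E = finrank ℝ F) (hd : ∀ x ∈ K, Function.Injective (fderiv ℝ f x)) :
    ∃ (V : Set E) (g : F → E), IsOpen V ∧ K ⊆ V ∧ V ⊆ U ∧ LeftInvOn g f V ∧ IsOpen (f '' V) ∧
      ContDiffOn ℝ ∞ g (f '' V) ∧ ∀ x ∈ V, Function.Injective (fderiv ℝ f x) := by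
  have hne : (∞ : WithTop ℕ∞) ≠ 0 := by simp
  have hfd : ∀ x ∈ U, HasFDerivAt f (fderiv ℝ f x) x := fun x hx =>
    ((hf.contDiffAt (hU.mem_nhds hx)).differentiableAt hne).hasFDerivAt
  -- Injectivity on the compact set, together with injectivity near each of its points, gives
  -- injectivity on a neighbourhood of it.
  obtain ⟨t, htK, hti⟩ := hinj.exists_mem_nhdsSet hK
    (fun x hx => (hfd x (hKU hx)).continuousAt) (fun x hx => by
      obtain ⟨e, he⟩ := exists_equiv_of_injective hdim (hd x hx)
      have hfx := hf.contDiffAt (hU.mem_nhds (hKU hx))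
      have h' : HasFDerivAt f (e : E →L[ℝ] F) x := by rw [he]; exact hfd x (hKU hx)
      exact ⟨_, (hfx.toOpenPartialHomeomorph f h' hne).open_source.mem_nhds
        (hfx.mem_toOpenPartialHomeomorph_source h' hne),
        (hfx.toOpenPartialHomeomorph f h' hne).injOn⟩)
  set R : Set (E →L[ℝ] F) := range ((↑) : (E ≃L[ℝ] F) → E →L[ℝ] F) with hR
  have hRo : IsOpen R := ContinuousLinearEquiv.isOpen
  set V : Set E := interior t ∩ (U ∩ fderiv ℝ f ⁻¹' R) with hV
  have hVo : IsOpen V := isOpen_interior.inter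
    ((hf.continuousOn_fderiv_of_isOpen hU (by simp)).isOpen_inter_preimage hU hRo)
  have hinjV : InjOn f V := hti.mono fun x hx => interior_subset hx.1
  have key : ∀ x ∈ V, f '' V ∈ 𝓝 (f x) ∧ ContDiffAt ℝ ∞ (Function.invFunOn f V) (f x) := by
    intro x hx
    obtain ⟨e, he⟩ := hx.2.2
    have hfx := hf.contDiffAt (hU.mem_nhds hx.2.1)
    have h' : HasFDerivAt f (e : E →L[ℝ] F) x := by rw [he]; exact hfd x hx.2.1
    have hs := hfx.hasStrictFDerivAt' h' hne
    refine ⟨by rw [← hs.map_nhds_eq_of_equiv]; exact image_mem_map (hVo.mem_nhds hx), ?_⟩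
    -- Smoothness of the global inverse is local: near `f x` it agrees with the inverse from the
    -- inverse function theorem.
    refine (hfx.to_localInverse h' hne).congr_of_eventuallyEq ?_
    have h1 := hs.eventually_right_inverse
    have h2 := hs.localInverse_tendsto.eventually (hVo.mem_nhds hx)
    filter_upwards [h1, h2] with y hy1 hy2
    have := hinjV.leftInvOn_invFunOn hy2
    rw [hy1] at this
    exact this
  refine ⟨V, Function.invFunOn f V, hVo, fun x hx => ⟨subset_interior_iff_mem_nhdsSet.2 htK hx,
    hKU hx, ?_⟩, fun x hx => hx.2.1, hinjV.leftInvOn_invFunOn, ?_, ?_, ?_⟩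
  · obtain ⟨e, he⟩ := exists_equiv_of_injective hdim (hd x hx)
    exact ⟨e, he⟩
  · rw [isOpen_iff_mem_nhds]
    rintro _ ⟨x, hx, rfl⟩
    exact (key x hx).1
  · rintro _ ⟨x, hx, rfl⟩
    exact (key x hx).2.contDiffWithinAt
  · rintro x hx
    obtain ⟨e, he⟩ := hx.2.2
    rw [← he]
    exact e.injective

/-- The implicit function theorem along a compact set. -/
theorem exists_implicit_near_compact {f : E × F → F} {u : E → F} {O : Set (E × F)} {K : Set E}
    (hO : IsOpen O) (hf : ContDiffOn ℝ ∞ f O) (hK : IsCompact K) (hu : ContinuousOn u K)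
    (hKO : ∀ p ∈ K, (p, u p) ∈ O) (h0 : ∀ p ∈ K, f (p, u p) = 0)
    (hd : ∀ p ∈ K, ∀ e, fderiv ℝ f (p, u p) (0, e) = 0 → e = 0) :
    ∃ (V : Set E) (w : E → F) (O' : Set (E × F)), IsOpen V ∧ K ⊆ V ∧ ContDiffOn ℝ ∞ w V ∧
      EqOn w u K ∧ (∀ p ∈ V, (p, w p) ∈ O ∧ f (p, w p) = 0) ∧
      IsOpen O' ∧ (∀ p ∈ K, (p, u p) ∈ O') ∧
      ∀ p e, (p, e) ∈ O' → f (p, e) = 0 → p ∈ V ∧ w p = e := by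
  -- The solutions of `f = 0` are the points which `Θ` sends to `E × {0}`; the domain `V'` of its
  -- inverse serves as the region of uniqueness.
  set Θ : E × F → E × F := fun q => (q.1, f q) with hΘ
  have hΘs : ContDiffOn ℝ ∞ Θ O := contDiffOn_fst.prodMk hf
  have hK' : IsCompact ((fun p => (p, u p)) '' K) :=
    hK.image_of_continuousOn (continuousOn_id.prodMk hu)
  obtain ⟨V', g, hV'o, hKV', hV'O, hg, hio, hgs, -⟩ := exists_inverse_near_compact hO hΘs hK'
    (by rintro _ ⟨p, hp, rfl⟩; exact hKO p hp)
    (by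
      rintro _ ⟨p, hp, rfl⟩ _ ⟨p', hp', rfl⟩ h
      have : p = p' := congrArg Prod.fst h
      rw [this]) rfl
    (by
      rintro _ ⟨p, hp, rfl⟩
      have hfd : HasFDerivAt f (fderiv ℝ f (p, u p)) (p, u p) :=
        ((hf.contDiffAt (hO.mem_nhds (hKO p hp))).differentiableAt (by simp)).hasFDerivAt
      have hΘd : HasFDerivAt Θ _ (p, u p) := hasFDerivAt_fst.prodMk hfd
      rw [hΘd.fderiv, injective_iff_map_eq_zero]
      rintro ⟨a, e⟩ hae
      simp only [ContinuousLinearMap.prod_apply, ContinuousLinearMap.coe_fst', Prod.mk_eq_zero]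
        at hae
      obtain ⟨rfl, h2⟩ := hae
      rw [hd p hp e h2]; rfl)
  have hgθ : ∀ p, (p, (0 : F)) ∈ Θ '' V' → (p, (g (p, 0)).2) ∈ V' ∧ f (p, (g (p, 0)).2) = 0 := by
    rintro p ⟨q, hq, hqe⟩
    have h1 := hg hq
    rw [hqe] at h1
    have h2 : q.1 = p := congrArg Prod.fst hqe
    have h3 : f q = 0 := congrArg Prod.snd hqe
    rw [h1, ← h2]
    exact ⟨hq, h3⟩
  have huni : ∀ p e, (p, e) ∈ V' → f (p, e) = 0 → (p, (0 : F)) ∈ Θ '' V' ∧ (g (p, 0)).2 = e := by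
    intro p e hpe hfe
    have h1 : Θ (p, e) = (p, 0) := by simp [hΘ, hfe]
    have h2 := hg hpe
    rw [h1] at h2
    exact ⟨⟨_, hpe, h1⟩, by rw [h2]⟩
  refine ⟨(fun p => (p, (0 : F))) ⁻¹' (Θ '' V'), fun p => (g (p, 0)).2, V',
    hio.preimage (by fun_prop), ?_, ?_, ?_, fun p hp => ⟨hV'O (hgθ p hp).1, (hgθ p hp).2⟩, hV'o, ?_,
    huni⟩
  · intro p hp
    exact (huni p (u p) (hKV' ⟨p, hp, rfl⟩) (h0 p hp)).1
  · exact contDiff_snd.comp_contDiffOn (hgs.comp (by fun_prop) (mapsTo_preimage _ _))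
  · intro p hp
    exact (huni p (u p) (hKV' ⟨p, hp, rfl⟩) (h0 p hp)).2
  · intro p hp
    exact hKV' ⟨p, hp, rfl⟩

end InverseNearCompact

/-! ### Gluing local functions. -/

section Glue

variable {E : Type*} [NormedAddCommGroup E] [NormedSpace ℝ E] [FiniteDimensional ℝ E]

open scoped Manifold in
/-- Gluing of local functions by a partition of unity; convex constraints on the values and, at
common zeros, positivity of a directional derivative are inherited. -/
theorem exists_smooth_glue {U : E → Set E} {f : E → E → ℝ} (hU : ∀ x, IsOpen (U x))
    (hx : ∀ x, x ∈ U x) (hf : ∀ x, ContDiffOn ℝ ∞ (f x) (U x)) :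
    ∃ ψ : E → ℝ, ContDiff ℝ ∞ ψ ∧
      (∀ y (C : Set ℝ), Convex ℝ C → (∀ x, y ∈ U x → f x y ∈ C) → ψ y ∈ C) ∧
      ∀ y v, (∀ x, y ∈ U x → f x y = 0 ∧ 0 < fderiv ℝ (f x) y v) → 0 < fderiv ℝ ψ y v := by
  obtain ⟨ρ, hρ⟩ := SmoothPartitionOfUnity.exists_isSubordinate 𝓘(ℝ, E) (s := (univ : Set E))
    isClosed_univ U hU (fun x _ => mem_iUnion_of_mem x (hx x))
  have hsub : ∀ i y, ρ i y ≠ 0 → y ∈ U i := fun i y hy => hρ i (subset_tsupport _ hy)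
  have hρs : ∀ i, ContDiff ℝ ∞ (ρ i) := fun i => (ρ i).contMDiff.contDiff
  refine ⟨fun y => ∑ᶠ i, ρ i y • f i y, ?_, ?_, ?_⟩
  · exact (hρ.contMDiff_finsum_smul (n := (⊤ : ℕ∞)) hU
      fun i => (hf i).contMDiffOn).contDiff
  · intro y C hC h
    exact ρ.finsum_smul_mem_convex (mem_univ y) (fun i hi => h i (hsub i y hi)) hC
  · intro y v h
    have hJ : ∀ i ∈ ρ.fintsupport y, y ∈ U i := fun i hi =>
      hρ i ((ρ.mem_fintsupport_iff y i).1 hi)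
    have hev : (fun z => ∑ᶠ i, ρ i z • f i z) =ᶠ[𝓝 y]
        fun z => ∑ i ∈ ρ.fintsupport y, ρ i z • f i z := by
      filter_upwards [ρ.eventually_finsupport_subset (x₀ := y)] with z hz
      refine finsum_eq_sum_of_support_subset _ fun i hi => hz ?_
      simp only [SmoothPartitionOfUnity.mem_finsupport]
      exact fun h0 => hi (by simp [h0])
    have hd : HasFDerivAt (fun z => ∑ i ∈ ρ.fintsupport y, ρ i z • f i z)
        (∑ i ∈ ρ.fintsupport y, (ρ i y • fderiv ℝ (f i) y +
          (fderiv ℝ (ρ i) y).smulRight (f i y))) y := by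
      refine HasFDerivAt.fun_sum fun i hi => ?_
      exact (((hρs i).differentiable (by simp)).differentiableAt.hasFDerivAt).smul
        (((hf i).contDiffAt ((hU i).mem_nhds (hJ i hi))).differentiableAt (by simp)).hasFDerivAt
    rw [hev.fderiv_eq, hd.fderiv, sum_apply]
    have hone : ∑ i ∈ ρ.fintsupport y, ρ i y = 1 :=
      ρ.sum_finsupport' y (mem_univ y) (ρ.finsupport_subset_fintsupport y)
    -- At a common zero of the `f i` the derivatives of the partition functions are multiplied by
    -- zero, so a convex combination of the derivatives remains.
    have hterm : ∀ i ∈ ρ.fintsupport y, (ρ i y • fderiv ℝ (f i) y +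
        (fderiv ℝ (ρ i) y).smulRight (f i y)) v = ρ i y * fderiv ℝ (f i) y v := by
      intro i hi
      simp [(h i (hJ i hi)).1]
    rw [Finset.sum_congr rfl hterm]
    obtain ⟨i, hi, hpos⟩ : ∃ i ∈ ρ.fintsupport y, 0 < ρ i y := by
      by_contra! hcon
      have := Finset.sum_nonpos hcon
      linarith
    exact Finset.sum_pos' (fun i hi => mul_nonneg (ρ.nonneg i y) (h i (hJ i hi)).2.le)
      ⟨i, hi, mul_pos hpos (h i (hJ i hi)).2⟩

end Glue

/-! ### Tangent cones of level sets. -/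

section TangentCone

variable {E F : Type*} [NormedAddCommGroup E] [NormedSpace ℝ E]
  [NormedAddCommGroup F] [NormedSpace ℝ F]

/-- The implicit function parametrises the level set over the kernel of `f'`, with the inclusion as
derivative at the origin; the curve is the image of the line through `v`. -/
theorem exists_curve_in_level [CompleteSpace E] [FiniteDimensional ℝ F] {f : E → F} {f' : E →L[ℝ] F}
    {p : E}
    (hf : HasStrictFDerivAt f f' p) (hs : Function.Surjective f') {v : E} (hv : f' v = 0) :
    ∃ c : ℝ → E, c 0 = p ∧ HasDerivAt c v 0 ∧ ∀ᶠ τ in 𝓝 0, f (c τ) = f p := by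
  have hs' : f'.range = ⊤ := LinearMap.range_eq_top.2 hs
  let w : f'.ker := ⟨v, by simpa using hv⟩
  have hl : HasDerivAt (fun τ : ℝ => τ • w) w 0 := by
    simpa using (hasDerivAt_id (0 : ℝ)).smul_const w
  have hl0 : (fun τ : ℝ => τ • w) 0 = 0 := by simp
  refine ⟨fun τ => hf.implicitFunction f f' hs' (f p) (τ • w), ?_, ?_, ?_⟩
  · simp
  · have h1 := (hf.to_implicitFunction hs').hasFDerivAt
    rw [← hl0] at h1
    exact h1.comp_hasDerivAt 0 hl
  · have h2 : Tendsto (fun τ : ℝ => (f p, τ • w)) (𝓝 0) (𝓝 (f p, 0)) := by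
      have := hl.continuousAt.tendsto
      rw [zero_smul] at this
      exact tendsto_const_nhds.prodMk_nhds this
    exact h2.eventually (hf.map_implicitFunction_eq hs')

theorem mem_tangentConeAt_of_curve {c : ℝ → E} {s : Set E} {p v : E} (h0 : c 0 = p)
    (hc : HasDerivAt c v 0) (hs : ∀ᶠ τ in 𝓝[>] (0 : ℝ), c τ ∈ s) : v ∈ tangentConeAt ℝ s p := by
  refine mem_tangentConeAt_of_seq (𝓝[>] (0 : ℝ)) (fun τ => τ⁻¹) (fun τ => c τ - p) ?_ ?_ ?_
  · have := hc.continuousAt.tendsto.mono_left (nhdsWithin_le_nhds (s := Ioi (0 : ℝ)))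
    rw [h0] at this
    simpa using this.sub_const p
  · simpa using hs
  · have := hc.tendsto_slope_zero_right
    simpa [h0] using this

/-- Derivatives within a hypersurface are not unique as linear maps on the whole space. They agree
on the tangent cone, hence by linearity on its span, which is all that is ever evaluated. -/
theorem fderiv_eq_of_mem_span_tangentConeAt {f : E → F} {f₁ f₂ : E →L[ℝ] F} {s : Set E} {p v : E}
    (h₁ : HasFDerivWithinAt f f₁ s p) (h₂ : HasFDerivWithinAt f f₂ s p)
    (hv : v ∈ Submodule.span ℝ (tangentConeAt ℝ s p)) : f₁ v = f₂ v := by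
  have : EqOn f₁ f₂ (Submodule.span ℝ (tangentConeAt ℝ s p)) :=
    LinearMap.eqOn_span (f := (f₁ : E →ₗ[ℝ] F)) (g := (f₂ : E →ₗ[ℝ] F)) (h₁.unique_on h₂)
  exact this hv

theorem fderiv_eq_zero_of_mem_span_tangentConeAt {f : E → F} {f' : E →L[ℝ] F} {s : Set E} {p v : E}
    (h : HasFDerivAt f f' p) (hc : ∀ᶠ y in 𝓝[s] p, f y = f p)
    (hv : v ∈ Submodule.span ℝ (tangentConeAt ℝ s p)) : f' v = 0 := by
  have h2 : HasFDerivWithinAt f (0 : E →L[ℝ] F) s p :=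
    (hasFDerivWithinAt_const (f p) p s).congr_of_eventuallyEq hc rfl
  simpa using fderiv_eq_of_mem_span_tangentConeAt h.hasFDerivWithinAt h2 hv

theorem ker_le_span_tangentConeAt [CompleteSpace E] [FiniteDimensional ℝ F] {f : E → F}
    {f' : E →L[ℝ] F} {p : E} {s : Set E} (hf : HasStrictFDerivAt f f' p)
    (hs : Function.Surjective f') (hsub : ∀ᶠ y in 𝓝 p, f y = f p → y ∈ s) {v : E} (hv : f' v = 0) :
    v ∈ tangentConeAt ℝ s p := by
  obtain ⟨c, hc0, hc, hcl⟩ := exists_curve_in_level hf hs hv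
  refine mem_tangentConeAt_of_curve hc0 hc (nhdsWithin_le_nhds ?_)
  have := hc.continuousAt.tendsto
  rw [hc0] at this
  filter_upwards [hcl, this.eventually hsub] with τ h1 h2 using h2 h1

/-- Curves into `{f = 0, g ≤ 0}` starting at a point with `f = g = 0`. -/
theorem exists_curve_of_neg [CompleteSpace E] {f g : E → ℝ}
    {f' g' : E →L[ℝ] ℝ} {p : E} {s : Set E} (hf : HasStrictFDerivAt f f' p) (hf0 : f p = 0)
    (hs : f' ≠ 0) (hg : HasFDerivAt g g' p) (hg0 : g p = 0)
    (hsub : ∀ᶠ y in 𝓝 p, f y = 0 → g y ≤ 0 → y ∈ s) {v : E} (hv : f' v = 0) (hgv : g' v < 0) :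
    ∃ c : ℝ → E, c 0 = p ∧ HasDerivAt c v 0 ∧ ∀ᶠ τ in 𝓝[>] (0 : ℝ), c τ ∈ s := by
  have hs' : Function.Surjective f' := LinearMap.surjective (f := (f' : E →ₗ[ℝ] ℝ))
    (fun h => hs (by ext x; simpa using LinearMap.congr_fun h x))
  obtain ⟨c, hc0, hc, hcl⟩ := exists_curve_in_level hf hs' hv
  refine ⟨c, hc0, hc, ?_⟩
  have hcont := hc.continuousAt.tendsto
  rw [hc0] at hcont
  rw [← hc0] at hg
  have hgc : HasDerivAt (g ∘ c) (g' v) 0 := hg.comp_hasDerivAt 0 hc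
  have hsl := hgc.tendsto_slope_zero_right
  -- The right difference quotients of `g ∘ c` are eventually negative and `g p = 0`, so the curve
  -- enters `{g ≤ 0}`.
  have hneg := hsl.eventually (gt_mem_nhds hgv)
  filter_upwards [hneg, nhdsWithin_le_nhds hcl, nhdsWithin_le_nhds (hcont.eventually hsub),
    self_mem_nhdsWithin] with τ h1 h2 h3 h4
  refine h3 (by rw [h2, hf0]) ?_
  simp only [zero_add, Function.comp_apply, hc0, hg0, sub_zero, smul_eq_mul] at h1
  have h5 : (0 : ℝ) < τ⁻¹ := inv_pos.2 h4
  nlinarith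

/-- The tangent directions of `{f = 0, g ≤ 0}` at a point with `f = g = 0`. -/
theorem mem_tangentConeAt_of_neg [CompleteSpace E] {f g : E → ℝ}
    {f' g' : E →L[ℝ] ℝ} {p : E} {s : Set E} (hf : HasStrictFDerivAt f f' p) (hf0 : f p = 0)
    (hs : f' ≠ 0) (hg : HasFDerivAt g g' p) (hg0 : g p = 0)
    (hsub : ∀ᶠ y in 𝓝 p, f y = 0 → g y ≤ 0 → y ∈ s) {v : E} (hv : f' v = 0) (hgv : g' v < 0) :
    v ∈ tangentConeAt ℝ s p := by
  obtain ⟨c, hc0, hc, hcs⟩ := exists_curve_of_neg hf hf0 hs hg hg0 hsub hv hgv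
  exact mem_tangentConeAt_of_curve hc0 hc hcs

end TangentCone

section Shift

variable {E W : Type*} [NormedAddCommGroup E] [NormedSpace ℝ E] [FiniteDimensional ℝ E]
  [NormedAddCommGroup W] [NormedSpace ℝ W] [FiniteDimensional ℝ W]

/-- Nearby points can be moved in given transversal directions to attain given values. -/
theorem exists_shift {F : E → W} {U : Set E} {p : E} (hU : IsOpen U) (hp : p ∈ U)
    (hF : ContDiffOn ℝ ∞ F U) {R : W →L[ℝ] E} (hR : ∀ a, fderiv ℝ F p (R a) = 0 → a = 0) :
    ∃ a : E × W → W, Tendsto a (𝓝 (p, F p)) (𝓝 0) ∧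
      ∀ᶠ z in 𝓝 (p, F p), F (z.1 + R (a z)) = z.2 := by
  let L : (E × W) × W → E := fun q => q.1.1 + R q.2
  have hL : ContDiff ℝ ∞ L := by fun_prop
  -- The equation `F (y + R a) = w` is solved for `a` at the single point `(p, F p)`; `hR` says that
  -- its derivative in `a` is injective.
  let f : (E × W) × W → W := fun q => F (L q) - q.1.2
  have hO : IsOpen (L ⁻¹' U) := hU.preimage hL.continuous
  have hf : ContDiffOn ℝ ∞ f (L ⁻¹' U) :=
    (hF.comp hL.contDiffOn (mapsTo_preimage _ _)).sub (by fun_prop)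
  have hL0 : L ((p, F p), 0) = p := by simp [L]
  have hLd : HasFDerivAt L ((ContinuousLinearMap.fst ℝ E W ∘L ContinuousLinearMap.fst ℝ (E × W) W) +
      R ∘L ContinuousLinearMap.snd ℝ (E × W) W) ((p, F p), 0) :=
    (((ContinuousLinearMap.fst ℝ E W ∘L ContinuousLinearMap.fst ℝ (E × W) W) +
      R ∘L ContinuousLinearMap.snd ℝ (E × W) W)).hasFDerivAt
  have hFd : HasFDerivAt F (fderiv ℝ F p) (L ((p, F p), 0)) := by
    rw [hL0]
    exact ((hF.contDiffAt (hU.mem_nhds hp)).differentiableAt (by simp)).hasFDerivAt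
  have hfd : HasFDerivAt f _ ((p, F p), 0) := (hFd.comp _ hLd).sub
    (ContinuousLinearMap.snd ℝ E W ∘L ContinuousLinearMap.fst ℝ (E × W) W).hasFDerivAt
  obtain ⟨V, w, -, hV, hKV, hw, hwu, hwf, -⟩ := exists_implicit_near_compact (u := fun _ => 0) hO hf
    (isCompact_singleton (x := (p, F p))) continuousOn_const
    (by rintro _ rfl; simpa [L] using hp) (by rintro _ rfl; simp [f, L])
    (by
      rintro _ rfl e he
      rw [hfd.fderiv] at he
      refine hR e ?_
      simpa using he)
  have hmem : (p, F p) ∈ V := hKV rfl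
  refine ⟨w, ?_, ?_⟩
  · have := (hw.continuousOn.continuousAt (hV.mem_nhds hmem)).tendsto
    rwa [hwu rfl] at this
  · filter_upwards [hV.mem_nhds hmem] with z hz
    have := (hwf z hz).2
    simpa [f, L, sub_eq_zero] using this

/-- The map `(y, a) ↦ (y, F (y + R a))` has invertible derivative at `(p, 0)`, hence is injective
nearby; compare `(y, a)` with `(y, 0)`. -/
theorem eventually_eq_zero_of_shift_eq {F : E → W} {p : E} {F' : E →L[ℝ] W}
    (hF : HasStrictFDerivAt F F' p) {R : W →L[ℝ] E} (hR : ∀ a, F' (R a) = 0 → a = 0) :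
    ∀ᶠ z : E × W in 𝓝 (p, 0), F (z.1 + R z.2) = F z.1 → z.2 = 0 := by
  let G : E × W → E × W := fun z => (z.1, F (z.1 + R z.2))
  let L : E × W →L[ℝ] E := ContinuousLinearMap.fst ℝ E W + R ∘L ContinuousLinearMap.snd ℝ E W
  have hF' : HasStrictFDerivAt F F' (L (p, 0)) := by simpa [L] using hF
  have hG : HasStrictFDerivAt G ((ContinuousLinearMap.fst ℝ E W).prod (F' ∘L L)) (p, 0) :=
    hasStrictFDerivAt_fst.prodMk (hF'.comp (p, (0 : W)) L.hasStrictFDerivAt)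
  obtain ⟨e, he⟩ := exists_equiv_of_injective rfl
    (A := (ContinuousLinearMap.fst ℝ E W).prod (F' ∘L L)) (by
      rw [injective_iff_map_eq_zero]
      rintro ⟨h, a⟩ hz
      simp only [ContinuousLinearMap.prod_apply, ContinuousLinearMap.coe_fst', Prod.mk_eq_zero]
        at hz
      obtain ⟨rfl, h2⟩ := hz
      rw [hR a (by simpa [L] using h2)]
      rfl)
  rw [← he] at hG
  have hinj := (hG.toOpenPartialHomeomorph G).injOn
  have hsrc := (hG.toOpenPartialHomeomorph G).open_source.mem_nhds
    hG.mem_toOpenPartialHomeomorph_source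
  have h2 : Tendsto (fun z : E × W => (z.1, (0 : W))) (𝓝 (p, 0)) (𝓝 (p, 0)) := by
    have : ContinuousAt (fun z : E × W => (z.1, (0 : W))) (p, 0) := by fun_prop
    exact this.tendsto
  filter_upwards [hsrc, h2.eventually hsrc] with z hz1 hz2 heq
  have := hinj hz1 hz2 (show G z = G (z.1, 0) by simp [G, heq])
  exact congrArg Prod.snd this

/-- If `F ∈ Q` implies `F₁ = F` near `p`, then `F₁ ∈ Q` implies `F₁ = F` near `p`. -/
theorem eventually_eq_of_level_subset {F F₁ : E → W} {U : Set E} {p : E} (hU : IsOpen U)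
    (hp : p ∈ U) (hF : ContDiffOn ℝ ∞ F U) (hF₁ : ContDiffAt ℝ ∞ F₁ p) (hFp : F₁ p = F p)
    {R : W →L[ℝ] E} (hR : ∀ a, fderiv ℝ F p (R a) = 0 → a = 0)
    (hR₁ : ∀ a, fderiv ℝ F₁ p (R a) = 0 → a = 0) {Q : Set W}
    (hQ : ∀ᶠ y in 𝓝 p, F y ∈ Q → F₁ y = F y) : ∀ᶠ y in 𝓝 p, F₁ y ∈ Q → F₁ y = F y := by
  obtain ⟨a, ha, hFa⟩ := exists_shift hU hp hF hR
  have h1 : Tendsto (fun y => (y, F₁ y)) (𝓝 p) (𝓝 (p, F p)) := by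
    have := (continuousAt_id (x := p)).prodMk hF₁.continuousAt
    simpa [ContinuousAt, hFp] using this
  have h2 : Tendsto (fun y => a (y, F₁ y)) (𝓝 p) (𝓝 0) := ha.comp h1
  have h3 : Tendsto (fun y => y + R (a (y, F₁ y))) (𝓝 p) (𝓝 p) := by
    have := tendsto_id.add ((R.continuous.tendsto 0).comp h2)
    simpa using this
  have h4 := eventually_eq_zero_of_shift_eq (hF₁.hasStrictFDerivAt (by simp)) hR₁
  have h5 : Tendsto (fun y => (y, a (y, F₁ y))) (𝓝 p) (𝓝 (p, 0)) := tendsto_id.prodMk_nhds h2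
  -- Shift `y` to a point where `F` takes the value `F₁ y`. If this value lies in `Q`, then `F₁`
  -- takes it at both points, so the shift is zero and `F y = F₁ y`.
  filter_upwards [h1.eventually hFa, h3.eventually hQ, h5.eventually h4] with y e1 e2 e3 hy
  change F (y + R (a (y, F₁ y))) = F₁ y at e1
  rw [e1] at e2
  have := e3 (e2 hy)
  rw [this] at e1
  simpa using e1.symm

end Shift

/-! ### The sign of a function vanishing on a codimension-two level set. -/

section Sign

variable {E Z : Type*} [NormedAddCommGroup E] [NormedSpace ℝ E] [FiniteDimensional ℝ E]
  [NormedAddCommGroup Z] [NormedSpace ℝ Z]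

/-- If `H` vanishes where `f = g = 0` and increases with `g` along `{f = 0}`, then `H < 0` where
`f = 0` and `g < 0`. -/
theorem eventually_neg_of_level {f g : E → ℝ} {U : Set E} {p : E} {H : E × Z → ℝ}
    {H' : E × Z →L[ℝ] ℝ} {z₀ : Z} {C : Set Z} (hU : IsOpen U) (hp : p ∈ U)
    (hf : ContDiffOn ℝ ∞ f U) (hg : ContDiffOn ℝ ∞ g U) (hf0 : f p = 0) (hg0 : g p = 0)
    (hH : HasStrictFDerivAt H H' (p, z₀))
    (h0 : ∀ᶠ q in 𝓝 (p, z₀), q.2 ∈ C → f q.1 = 0 → g q.1 = 0 → H q = 0)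
    {e e' : E} (he : fderiv ℝ f p e = 0 ∧ fderiv ℝ g p e = 1)
    (he' : fderiv ℝ f p e' = 1 ∧ fderiv ℝ g p e' = 0) (hpos : 0 < H' (e, 0)) :
    ∀ᶠ q in 𝓝 (p, z₀), q.2 ∈ C → f q.1 = 0 → g q.1 < 0 → H q < 0 := by
  let F : E → ℝ × ℝ := fun y => (f y, g y)
  have hF : ContDiffOn ℝ ∞ F U := hf.prodMk hg
  have hfs := (hf.contDiffAt (hU.mem_nhds hp)).hasStrictFDerivAt (by simp)
  have hgs := (hg.contDiffAt (hU.mem_nhds hp)).hasStrictFDerivAt (by simp)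
  have hFs : HasStrictFDerivAt F _ p := hfs.prodMk hgs
  let R : ℝ × ℝ →L[ℝ] E := (ContinuousLinearMap.fst ℝ ℝ ℝ).smulRight e' +
    (ContinuousLinearMap.snd ℝ ℝ ℝ).smulRight e
  have hRa : ∀ a : ℝ × ℝ, R a = a.1 • e' + a.2 • e := fun a => by simp [R]
  have hFR : ∀ a, ((fderiv ℝ f p).prod (fderiv ℝ g p)) (R a) = a := by
    intro a
    rw [hRa]
    ext <;> simp [he, he']
  -- The argument moves a point by a combination of `e'` and `e` onto `{f = g = 0}`, where `H` is
  -- zero, and reads off the sign of `H` from strict differentiability along this displacement.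
  obtain ⟨a, ha, hFa⟩ := exists_shift hU hp hF (R := R) (by
    intro a ha
    rw [hFs.hasFDerivAt.fderiv, hFR] at ha
    exact ha)
  have hFp : F p = 0 := by simp [F, hf0, hg0]
  rw [hFp] at ha hFa
  -- the constants
  obtain ⟨c, hc, hc0⟩ : ∃ c, c = H' (e, 0) ∧ 0 < c := ⟨_, rfl, hpos⟩
  obtain ⟨M, hM0, hM1, hM2⟩ : ∃ M : ℝ, 1 ≤ M ∧ ‖R‖ ≤ M ∧ |H' (e', 0)| ≤ M :=
    ⟨max 1 (max ‖R‖ |H' (e', 0)|), le_max_left _ _, (le_max_left _ _).trans (le_max_right _ _),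
      (le_max_right _ _).trans (le_max_right _ _)⟩
  -- The first bound makes the `e`-component of the displacement dominate its `e'`-component. The
  -- second lets the main term `A.2 * c` beat the linearisation error and the contribution of `e'`.
  obtain ⟨ε, hε0, hε1, hε2⟩ : ∃ ε : ℝ, 0 < ε ∧ ε * M < 1 ∧ 2 * ε * M + ε * M * M < c := by
    refine ⟨min (1 / (2 * M)) (c / (4 * M * M)), by positivity, ?_, ?_⟩
    · have : min (1 / (2 * M)) (c / (4 * M * M)) * M ≤ 1 / (2 * M) * M := by
        gcongr; exact min_le_left _ _
      have h2 : 1 / (2 * M) * M = 1 / 2 := by field_simp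
      linarith
    · set ε := min (1 / (2 * M)) (c / (4 * M * M))
      have h1 : ε ≤ c / (4 * M * M) := min_le_right _ _
      have h3 : ε * (4 * M * M) ≤ c := by
        rwa [le_div_iff₀ (by positivity)] at h1
      have h4 : 0 < ε := by positivity
      have h5 : ε * M ≤ ε * (M * M) := by gcongr; nlinarith
      nlinarith [mul_pos h4 (mul_pos (by linarith : 0 < M) (by linarith : 0 < M))]
  have t1 : Tendsto (fun q : E × Z => (q.1, (0 : ℝ × ℝ))) (𝓝 (p, z₀)) (𝓝 (p, 0)) := by
    have : ContinuousAt (fun q : E × Z => (q.1, (0 : ℝ × ℝ))) (p, z₀) := by fun_prop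
    exact this.tendsto
  have t2 : Tendsto (fun q : E × Z => a (q.1, 0)) (𝓝 (p, z₀)) (𝓝 0) := ha.comp t1
  have t3 : Tendsto (fun q : E × Z => q.1 + R (a (q.1, 0))) (𝓝 (p, z₀)) (𝓝 p) := by
    have h1 : Tendsto (fun q : E × Z => q.1) (𝓝 (p, z₀)) (𝓝 p) := continuousAt_fst.tendsto
    have := h1.add ((R.continuous.tendsto 0).comp t2)
    simpa using this
  have t4 : Tendsto (fun q : E × Z => ((q.1 + R (a (q.1, 0)), q.2) : E × Z)) (𝓝 (p, z₀))
      (𝓝 (p, z₀)) := t3.prodMk_nhds continuousAt_snd.tendsto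
  have t5 : Tendsto (fun q : E × Z => (q.1 + R (a (q.1, 0)), q.1)) (𝓝 (p, z₀))
      (𝓝 (p, p)) := t3.prodMk_nhds continuousAt_fst.tendsto
  have t6 := t4.prodMk_nhds (tendsto_id (x := 𝓝 (p, z₀)))
  have b1 := t5.eventually (hFs.isLittleO.bound hε0)
  have b2 := t6.eventually (hH.isLittleO.bound hε0)
  filter_upwards [b1, b2, t1.eventually hFa, t4.eventually h0] with q b1 b2 b3 b4 hqC hfq hgq
  simp only [id_eq] at b1 b2 b3 b4
  set A := a (q.1, 0) with hA
  have hH0 : H (q.1 + R A, q.2) = 0 := b4 hqC (congrArg Prod.fst b3) (congrArg Prod.snd b3)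
  have hRA : ‖R A‖ ≤ M * ‖A‖ := (R.le_opNorm A).trans (by gcongr)
  -- Linearising `F`, which is `0` at the shifted point and `(0, g)` at the original one, gives `A ≈
  -- (0, -g)`. Hence `A.2 > 0`, and linearising `H` gives `-H ≈ A.2 * c`.
  rw [add_sub_cancel_left, hFR, b3] at b1
  have e2 : ((q.1 + R A, q.2) - q : E × Z) = (R A, 0) := by ext <;> simp
  rw [hH0, e2] at b2
  have e3 : H' (R A, 0) = A.1 * H' (e', 0) + A.2 * c := by
    have : ((R A, 0) : E × Z) = A.1 • (e', 0) + A.2 • (e, 0) := by rw [hRa]; simp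
    rw [this, map_add, map_smul, map_smul, hc]; simp
  rw [e3] at b2
  have n1 : ‖((R A, 0) : E × Z)‖ = ‖R A‖ := by simp [Prod.norm_def]
  rw [n1] at b2
  have c1 : |A.1| ≤ ε * M * ‖A‖ := by
    have := (norm_fst_le _).trans b1
    simp only [F, Prod.fst_sub, Prod.fst_zero, hfq, Real.norm_eq_abs] at this
    rw [zero_sub, abs_sub_comm] at this
    simp only [sub_zero, neg_zero] at this
    calc |A.1| ≤ ε * ‖R A‖ := by simpa using this
      _ ≤ ε * (M * ‖A‖) := by gcongr
      _ = _ := by ring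
  have c2 : |-g q.1 - A.2| ≤ ε * M * ‖A‖ := by
    have := (norm_snd_le _).trans b1
    simp only [F, Prod.snd_sub, Real.norm_eq_abs, zero_sub] at this
    calc _ ≤ ε * ‖R A‖ := this
      _ ≤ ε * (M * ‖A‖) := by gcongr
      _ = _ := by ring
  have hεM : 0 ≤ ε * M := by positivity
  have c3 : ‖A‖ ≤ |A.2| := by
    rw [Prod.norm_def, Real.norm_eq_abs, Real.norm_eq_abs]
    refine max_le ?_ le_rfl
    by_contra! hcon
    have : ‖A‖ = |A.1| := by
      rw [Prod.norm_def, Real.norm_eq_abs, Real.norm_eq_abs]; exact max_eq_left hcon.le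
    rw [this] at c1
    have : 0 < |A.1| := (abs_nonneg _).trans_lt hcon
    nlinarith
  have c4 : 0 < A.2 := by
    by_contra! hcon
    have h1 : |A.2| = -A.2 := abs_of_nonpos hcon
    have h2 := (abs_le.1 c2).2
    rw [h1] at c3
    nlinarith [mul_le_mul_of_nonneg_left c3 hεM]
  rw [abs_of_pos c4] at c3
  have c5 : |A.1| ≤ ε * M * A.2 := c1.trans (by gcongr)
  have c6 : |A.1 * H' (e', 0)| ≤ ε * M * A.2 * M := by
    rw [abs_mul]
    exact mul_le_mul c5 hM2 (abs_nonneg _) (by positivity)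
  have c7 : ε * ‖R A‖ ≤ ε * M * A.2 := by
    calc _ ≤ ε * (M * ‖A‖) := by gcongr
      _ ≤ ε * (M * A.2) := by gcongr
      _ = _ := by ring
  rw [Real.norm_eq_abs] at b2
  have d1 := (abs_le.1 (b2.trans c7)).1
  have d2 := (abs_le.1 c6).1
  nlinarith [mul_pos c4 hc0, mul_lt_mul_of_pos_right hε2 c4, mul_pos (mul_pos hε0 (by linarith : 0 < M)) c4]

/-- The positive side is the negative side for `-g`, `-H` and `-e`. -/
theorem eventually_sign_of_level {f g : E → ℝ} {U : Set E} {p : E} {H : E × Z → ℝ}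
    {H' : E × Z →L[ℝ] ℝ} {z₀ : Z} {C : Set Z} (hU : IsOpen U) (hp : p ∈ U)
    (hf : ContDiffOn ℝ ∞ f U) (hg : ContDiffOn ℝ ∞ g U) (hf0 : f p = 0) (hg0 : g p = 0)
    (hH : HasStrictFDerivAt H H' (p, z₀))
    (h0 : ∀ᶠ q in 𝓝 (p, z₀), q.2 ∈ C → f q.1 = 0 → g q.1 = 0 → H q = 0)
    {e e' : E} (he : fderiv ℝ f p e = 0 ∧ fderiv ℝ g p e = 1)
    (he' : fderiv ℝ f p e' = 1 ∧ fderiv ℝ g p e' = 0) (hpos : 0 < H' (e, 0)) :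
    ∀ᶠ q in 𝓝 (p, z₀), q.2 ∈ C → f q.1 = 0 →
      (g q.1 < 0 → H q < 0) ∧ (0 < g q.1 → 0 < H q) := by
  have h1 := eventually_neg_of_level hU hp hf hg hf0 hg0 hH h0 he he' hpos
  have h2 := eventually_neg_of_level (g := fun y => -g y) (H := fun q => -H q) (e := -e) (e' := e')
    (C := C) hU hp hf hg.neg hf0 (by simp [hg0]) hH.fun_neg
    (by filter_upwards [h0] with q hq a b c; simpa using hq a b (by simpa using c))
    (by simpa [fderiv_fun_neg] using he) (by simpa [fderiv_fun_neg] using he') (by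
      have : ((-e, 0) : E × Z) = -(e, 0) := by simp
      rw [this, neg_apply, map_neg, neg_neg]; exact hpos)
  filter_upwards [h1, h2] with q a b hq hfq
  exact ⟨a hq hfq, fun hg => by simpa using b hq hfq (by simpa using hg)⟩

end Sign

variable {N : ℕ}

/-! ### Gradients and dual vectors. -/

section Gradient

theorem inner_gradient (f : Euc N → ℝ) (x v : Euc N) :
    inner ℝ (gradient f x) v = fderiv ℝ f x v := by simp [gradient]

theorem gradient_ne_zero_iff {f : Euc N → ℝ} {x : Euc N} : gradient f x ≠ 0 ↔ fderiv ℝ f x ≠ 0 := by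
  simp [gradient]

theorem eq_smul_of_forall_inner_eq_zero {E : Type*} [NormedAddCommGroup E] [InnerProductSpace ℝ E]
    {g ν : E} (h : ∀ v, inner ℝ g v = 0 → inner ℝ ν v = 0) : ∃ c : ℝ, ν = c • g := by
  have h1 : ν ∈ (ℝ ∙ g)ᗮᗮ := by
    rw [Submodule.mem_orthogonal']
    intro v hv
    exact h v (Submodule.mem_orthogonal_singleton_iff_inner_right.1 hv)
  rw [Submodule.orthogonal_orthogonal, Submodule.mem_span_singleton] at h1
  obtain ⟨c, hc⟩ := h1
  exact ⟨c, hc.symm⟩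

/-- Without such a vector, everything orthogonal to `v` would be orthogonal to `u`, making `u` a
multiple of `v`. -/
theorem exists_dual_of_linearIndependent {E : Type*} [NormedAddCommGroup E] [InnerProductSpace ℝ E]
    {u v : E} (h : LinearIndependent ℝ ![u, v]) : ∃ x, inner ℝ u x = 1 ∧ inner ℝ v x = 0 := by
  by_contra! hcon
  have h1 : ∀ x, inner ℝ v x = 0 → inner ℝ u x = 0 := by
    intro x hx
    by_contra hne
    refine hcon ((inner ℝ u x)⁻¹ • x) ?_ ?_
    · rw [inner_smul_right, inv_mul_cancel₀ hne]
    · rw [inner_smul_right, hx, mul_zero]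
  obtain ⟨c, hc⟩ := eq_smul_of_forall_inner_eq_zero h1
  have := LinearIndependent.pair_iff.1 h 1 (-c) (by rw [hc]; simp)
  exact one_ne_zero this.1

theorem ContDiffOn.hasFDerivAt_of_mem {E F : Type*} [NormedAddCommGroup E] [NormedSpace ℝ E]
    [NormedAddCommGroup F] [NormedSpace ℝ F] {f : E → F} {U : Set E} {x : E}
    (hf : ContDiffOn ℝ ∞ f U) (hU : IsOpen U) (hx : x ∈ U) : HasFDerivAt f (fderiv ℝ f x) x :=
  ((hf.contDiffAt (hU.mem_nhds hx)).differentiableAt (by simp)).hasFDerivAt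

theorem ContDiffOn.hasStrictFDerivAt_of_mem {E F : Type*} [NormedAddCommGroup E] [NormedSpace ℝ E]
    [NormedAddCommGroup F] [NormedSpace ℝ F] {f : E → F} {U : Set E} {x : E}
    (hf : ContDiffOn ℝ ∞ f U) (hU : IsOpen U) (hx : x ∈ U) :
    HasStrictFDerivAt f (fderiv ℝ f x) x :=
  (hf.contDiffAt (hU.mem_nhds hx)).hasStrictFDerivAt (by simp)

theorem surjective_of_ne_zero {E : Type*} [NormedAddCommGroup E] [NormedSpace ℝ E]
    {f : E →L[ℝ] ℝ} (hf : f ≠ 0) : Function.Surjective f :=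
  LinearMap.surjective (f := (f : E →ₗ[ℝ] ℝ))
    (fun h => hf (by ext x; simpa using LinearMap.congr_fun h x))

theorem exists_apply_eq_one {E : Type*} [NormedAddCommGroup E] [NormedSpace ℝ E]
    {f : E →L[ℝ] ℝ} (hf : f ≠ 0) : ∃ v, f v = 1 := surjective_of_ne_zero hf 1

end Gradient

/-! ### A global defining function of the domain. -/

section Domain

variable {Ω : Set (Euc N)}

theorem eq_zero_of_mem_frontier_of_sublevel {U : Set (Euc N)} {φ : Euc N → ℝ} (hΩ : IsOpen Ω)
    (hU : IsOpen U)
    (hφ : ContDiffOn ℝ ∞ φ U) (hΩU : Ω ∩ U = {x ∈ U | φ x < 0}) {y : Euc N} (hy : y ∈ U)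
    (hyf : y ∈ frontier Ω) : φ y = 0 := by
  have hyΩ : y ∉ Ω := by rw [hΩ.frontier_eq] at hyf; exact hyf.2
  have h1 : 0 ≤ φ y := by
    by_contra! h
    exact hyΩ (hΩU.symm ▸ (show y ∈ {x ∈ U | φ x < 0} from ⟨hy, h⟩) : y ∈ Ω ∩ U).1
  refine le_antisymm ?_ h1
  by_contra! h
  have hc : ∀ᶠ z in 𝓝 y, 0 < φ z :=
    (hφ.continuousOn.continuousAt (hU.mem_nhds hy)).tendsto.eventually (lt_mem_nhds h)
  obtain ⟨z, ⟨hz1, hz2⟩, hz3⟩ := mem_closure_iff_nhds.1 (frontier_subset_closure hyf) _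
    (inter_mem hc (hU.mem_nhds hy))
  have : z ∈ {x ∈ U | φ x < 0} := hΩU ▸ (⟨hz3, hz2⟩ : z ∈ Ω ∩ U)
  exact absurd this.2 (not_lt.2 (le_of_lt hz1))

/-- Near such a point `φ` is nonnegative, and a zero would be a local minimum, contrary to the
nonvanishing gradient. -/
theorem pos_of_not_mem_closure_of_sublevel {U : Set (Euc N)} {φ : Euc N → ℝ} (hU : IsOpen U)
    (hφ' : ∀ x ∈ U, gradient φ x ≠ 0) (hΩU : Ω ∩ U = {x ∈ U | φ x < 0}) {y : Euc N} (hy : y ∈ U)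
    (hyf : y ∉ closure Ω) : 0 < φ y := by
  have hnn : ∀ z ∈ U, z ∉ Ω → 0 ≤ φ z := by
    intro z hz hzΩ
    by_contra! h
    exact hzΩ (hΩU.symm ▸ (show z ∈ {x ∈ U | φ x < 0} from ⟨hz, h⟩) : z ∈ Ω ∩ U).1
  refine lt_of_le_of_ne (hnn y hy fun h => hyf (subset_closure h)) fun h0 => ?_
  have : IsLocalMin φ y := by
    filter_upwards [hU.mem_nhds hy, isClosed_closure.isOpen_compl.mem_nhds hyf] with z h1 h2
    rw [← h0]
    exact hnn z h1 fun h => h2 (subset_closure h)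
  exact gradient_ne_zero_iff.1 (hφ' y hy) this.fderiv_eq_zero

theorem ker_fderiv_le_tangentSpace_frontier {U : Set (Euc N)} {φ : Euc N → ℝ} (hΩ : IsOpen Ω)
    (hU : IsOpen U) (hφ : ContDiffOn ℝ ∞ φ U)
    (hφ' : ∀ x ∈ U, gradient φ x ≠ 0) (hΩU : Ω ∩ U = {x ∈ U | φ x < 0}) {y v : Euc N} (hy : y ∈ U)
    (hyf : y ∈ frontier Ω) (hv : fderiv ℝ φ y v = 0) : v ∈ tangentSpace (frontier Ω) y := by
  refine Submodule.subset_span (ker_le_span_tangentConeAt (ContDiffOn.hasStrictFDerivAt_of_mem hφ hU hy)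
    (surjective_of_ne_zero (gradient_ne_zero_iff.1 (hφ' y hy))) ?_ hv)
  filter_upwards [hU.mem_nhds hy] with z hz hφz
  rw [eq_zero_of_mem_frontier_of_sublevel hΩ hU hφ hΩU hy hyf] at hφz
  rw [hΩ.frontier_eq]
  refine ⟨?_, fun h => ?_⟩
  · by_contra h
    have := pos_of_not_mem_closure_of_sublevel hU hφ' hΩU hz h
    linarith
  · have : z ∈ {x ∈ U | φ x < 0} := hΩU ▸ (⟨h, hz⟩ : z ∈ Ω ∩ U)
    linarith [this.2]

/-- On `Ω` the function `φ` is maximal at `y`, and `-ν` is a one-sided tangent direction, so the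
derivative along `ν` is nonnegative. If it were zero, `ν` would be tangent to the boundary as well
as normal to it. -/
theorem fderiv_outerNormal_pos {U : Set (Euc N)} {φ : Euc N → ℝ} (hΩ : IsOpen Ω)
    (hU : IsOpen U) (hφ : ContDiffOn ℝ ∞ φ U)
    (hφ' : ∀ x ∈ U, gradient φ x ≠ 0) (hΩU : Ω ∩ U = {x ∈ U | φ x < 0}) {y ν : Euc N} (hy : y ∈ U)
    (hyf : y ∈ frontier Ω) (hν : IsOuterUnitNormal Ω y ν) : 0 < fderiv ℝ φ y ν := by
  obtain ⟨h1, h2, h3⟩ := hν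
  have hφy := eq_zero_of_mem_frontier_of_sublevel hΩ hU hφ hΩU hy hyf
  have hmax : IsLocalMaxOn φ Ω y := by
    filter_upwards [nhdsWithin_le_nhds (hU.mem_nhds hy), self_mem_nhdsWithin] with z hz1 hz2
    have : z ∈ {x ∈ U | φ x < 0} := hΩU ▸ (⟨hz2, hz1⟩ : z ∈ Ω ∩ U)
    rw [hφy]
    exact this.2.le
  have h4 := hmax.hasFDerivWithinAt_nonpos
    (ContDiffOn.hasFDerivAt_of_mem hφ hU hy).hasFDerivWithinAt h3
  rw [map_neg] at h4
  refine lt_of_le_of_ne (by linarith) fun h0 => ?_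
  have h5 := ker_fderiv_le_tangentSpace_frontier hΩ hU hφ hφ' hΩU hy hyf h0.symm
  have h6 := (Submodule.mem_orthogonal _ _).1 h2 ν h5
  rw [real_inner_self_eq_norm_sq, h1] at h6
  norm_num at h6

/-- A smooth domain is globally the sublevel set of a smooth function. -/
theorem IsBoundedSmoothDomain.exists_defining_function (hΩ : IsBoundedSmoothDomain Ω)
    {ν : Euc N → Euc N} (hν : ∀ x ∈ frontier Ω, IsOuterUnitNormal Ω x (ν x)) :
    ∃ φ : Euc N → ℝ, ContDiff ℝ ∞ φ ∧ (∀ x, x ∈ Ω ↔ φ x < 0) ∧ (∀ x, x ∈ frontier Ω ↔ φ x = 0) ∧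
      ∀ x ∈ frontier Ω, gradient φ x ≠ 0 ∧ ν x = ‖gradient φ x‖⁻¹ • gradient φ x := by
  have hop := hΩ.isOpen
  have hloc : ∀ x : Euc N, ∃ (U : Set (Euc N)) (f : Euc N → ℝ), IsOpen U ∧ x ∈ U ∧
      ContDiffOn ℝ ∞ f U ∧ (∀ y ∈ U, y ∈ Ω → f y < 0) ∧ (∀ y ∈ U, y ∉ closure Ω → 0 < f y) ∧
      ∀ y ∈ U, y ∈ frontier Ω → f y = 0 ∧ 0 < fderiv ℝ f y (ν y) := by
    intro x
    -- The local models are `-1` inside, `1` outside and the given function near the boundary. Their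
    -- signs, and the positive derivative along `ν` on the frontier, survive gluing.
    by_cases hx : x ∈ Ω
    · refine ⟨Ω, fun _ => -1, hop, hx, contDiffOn_const, fun _ _ _ => by norm_num,
        fun y hy hy' => absurd (subset_closure hy) hy', fun y hy hy' => ?_⟩
      rw [hop.frontier_eq] at hy'
      exact absurd hy hy'.2
    by_cases hx' : x ∈ closure Ω
    · obtain ⟨U, φ, hU, hxU, hφ, hφ', hΩU⟩ := hΩ.smooth_boundary x (by
        rw [hop.frontier_eq]; exact ⟨hx', hx⟩)
      refine ⟨U, φ, hU, hxU, hφ, fun y hy hy' => ?_, fun y hy hy' =>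
        pos_of_not_mem_closure_of_sublevel hU hφ' hΩU hy hy', fun y hy hy' =>
        ⟨eq_zero_of_mem_frontier_of_sublevel hop hU hφ hΩU hy hy',
          fderiv_outerNormal_pos hop hU hφ hφ' hΩU hy hy' (hν y hy')⟩⟩
      have : y ∈ {x ∈ U | φ x < 0} := hΩU ▸ (⟨hy', hy⟩ : y ∈ Ω ∩ U)
      exact this.2
    · refine ⟨(closure Ω)ᶜ, fun _ => 1, isClosed_closure.isOpen_compl, hx', contDiffOn_const,
        fun y hy hy' => absurd (subset_closure hy') hy, fun _ _ _ => by norm_num,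
        fun y hy hy' => absurd (frontier_subset_closure hy') hy⟩
  choose U f hU hxU hf hneg hpos hfr using hloc
  obtain ⟨φ, hφs, hφC, hφd⟩ := exists_smooth_glue hU hxU hf
  have e1 : ∀ y ∈ Ω, φ y < 0 := fun y hy =>
    hφC y (Iio 0) (convex_Iio 0) fun x hx => hneg x y hx hy
  have e2 : ∀ y, y ∉ closure Ω → 0 < φ y := fun y hy =>
    hφC y (Ioi 0) (convex_Ioi 0) fun x hx => hpos x y hx hy
  have e3 : ∀ y ∈ frontier Ω, φ y = 0 := fun y hy =>
    hφC y {0} (convex_singleton 0) fun x hx => (hfr x y hx hy).1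
  have e4 : ∀ y ∈ frontier Ω, 0 < fderiv ℝ φ y (ν y) := fun y hy =>
    hφd y (ν y) fun x hx => hfr x y hx hy
  have i1 : ∀ x, x ∈ frontier Ω ↔ φ x = 0 := by
    refine fun x => ⟨e3 x, fun h => ?_⟩
    rw [hop.frontier_eq]
    refine ⟨?_, fun hx => absurd (e1 x hx) (by simp [h])⟩
    by_contra hx
    exact absurd (e2 x hx) (by simp [h])
  refine ⟨φ, hφs, fun x => ⟨e1 x, fun h => ?_⟩, i1, fun x hx => ?_⟩
  · by_contra hx
    by_cases hx' : x ∈ closure Ω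
    · have := e3 x (by rw [hop.frontier_eq]; exact ⟨hx', hx⟩)
      linarith
    · linarith [e2 x hx']
  · have hne : fderiv ℝ φ x ≠ 0 := by
      intro h
      have := e4 x hx
      rw [h] at this
      simp at this
    have hg : gradient φ x ≠ 0 := gradient_ne_zero_iff.2 hne
    refine ⟨hg, ?_⟩
    -- Vectors orthogonal to `∇φ` are tangent to the frontier, hence orthogonal to `ν`. So `ν` is a
    -- multiple of `∇φ`; the sign and size of the factor follow from `e4` and `‖ν‖ = 1`.
    obtain ⟨c, hc⟩ := eq_smul_of_forall_inner_eq_zero (g := gradient φ x) (ν := ν x) (by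
      intro v hv
      rw [inner_gradient] at hv
      have : v ∈ tangentSpace (frontier Ω) x := Submodule.subset_span
        (ker_le_span_tangentConeAt (hφs.contDiffAt.hasStrictFDerivAt (by simp))
          (surjective_of_ne_zero hne) (by
            rw [e3 x hx]
            exact Eventually.of_forall fun y hy => (i1 y).2 hy) hv)
      rw [real_inner_comm]
      exact (Submodule.mem_orthogonal _ _).1 (hν x hx).2.1 v this)
    have h1 := e4 x hx
    rw [hc, map_smul, ← inner_gradient, real_inner_self_eq_norm_sq, smul_eq_mul] at h1
    have h2 : 0 < ‖gradient φ x‖ := norm_pos_iff.2 hg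
    have hc0 : 0 < c := by
      by_contra! h
      have : c * ‖gradient φ x‖ ^ 2 ≤ 0 := mul_nonpos_of_nonpos_of_nonneg h (by positivity)
      linarith
    have h3 := (hν x hx).1
    rw [hc, norm_smul, Real.norm_eq_abs, abs_of_pos hc0] at h3
    rw [hc, eq_inv_of_mul_eq_one_left h3]

end Domain

/-! ### Local descriptions of hypersurfaces by a given level function. -/

section Level

variable {A : Set (Euc N)} {ψ : Euc N → ℝ} {p : Euc N}

theorem IsInteriorPoint.fderiv_eq_zero_of_ker {U : Set (Euc N)} {f : Euc N → ℝ} (hU : IsOpen U)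
    (hp : p ∈ U) (hpA : p ∈ A)
    (hf : ContDiffOn ℝ ∞ f U) (hf' : ∀ x ∈ U, gradient f x ≠ 0) (hA : A ∩ U = {x ∈ U | f x = 0})
    {v : Euc N} (hv : fderiv ℝ f p v = 0) : v ∈ tangentConeAt ℝ A p := by
  have hfp : f p = 0 := (hA ▸ (⟨hpA, hp⟩ : p ∈ A ∩ U) : p ∈ {x ∈ U | f x = 0}).2
  refine ker_le_span_tangentConeAt (ContDiffOn.hasStrictFDerivAt_of_mem hf hU hp)
    (surjective_of_ne_zero (gradient_ne_zero_iff.1 (hf' p hp))) ?_ hv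
  filter_upwards [hU.mem_nhds hp] with y hy hfy
  exact (hA.symm ▸ (⟨hy, hfy.trans hfp⟩ : y ∈ {x ∈ U | f x = 0}) : y ∈ A ∩ U).1

/-- Two level functions of the same hypersurface have locally the same zero set. -/
theorem IsInteriorPoint.eventually_mem_iff (h : IsInteriorPoint A p) (hpA : p ∈ A)
    (hψ : ContDiff ℝ ∞ ψ) (hψA : ∀ y ∈ A, ψ y = 0) (hψp : fderiv ℝ ψ p ≠ 0) :
    ∀ᶠ y in 𝓝 p, y ∈ A ↔ ψ y = 0 := by
  obtain ⟨U, f, hU, hp, hf, hf', hA⟩ := h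
  have hfp : f p = 0 := (hA ▸ (⟨hpA, hp⟩ : p ∈ A ∩ U) : p ∈ {x ∈ U | f x = 0}).2
  obtain ⟨v, hv⟩ := exists_apply_eq_one hψp
  have hψd : HasFDerivAt ψ (fderiv ℝ ψ p) p := (hψ.differentiable (by simp)).differentiableAt.hasFDerivAt
  have hfv : fderiv ℝ f p v ≠ 0 := by
    intro h0
    have := fderiv_eq_zero_of_mem_span_tangentConeAt hψd (s := A) (by
      filter_upwards [self_mem_nhdsWithin] with y hy
      rw [hψA y hy, hψA p hpA])
      (Submodule.subset_span (IsInteriorPoint.fderiv_eq_zero_of_ker hU hp hpA hf hf' hA h0))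
    rw [hv] at this
    exact one_ne_zero this
  -- The zero set of `f` is contained in that of `ψ`; comparing levels with `Q = {0}` gives the
  -- reverse inclusion.
  have key := eventually_eq_of_level_subset (F := f) (F₁ := ψ) hU hp hf hψ.contDiffAt
    (by rw [hfp, hψA p hpA]) (R := (ContinuousLinearMap.id ℝ ℝ).smulRight v)
    (fun a ha => by simpa [hfv] using ha) (fun a ha => by simpa [hv] using ha) (Q := {0})
    (by
      filter_upwards [hU.mem_nhds hp] with y hy hfy
      have : y ∈ A ∩ U := hA.symm ▸ (⟨hy, hfy⟩ : y ∈ {x ∈ U | f x = 0})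
      rw [hψA y this.1, hfy])
  filter_upwards [key, hU.mem_nhds hp] with y h1 h2
  refine ⟨hψA y, fun h3 => ?_⟩
  have := h1 h3
  rw [h3] at this
  exact (hA.symm ▸ (⟨h2, this.symm⟩ : y ∈ {x ∈ U | f x = 0}) : y ∈ A ∩ U).1

theorem IsInteriorPoint.mem_tangentSpace_iff (h : IsInteriorPoint A p) (hpA : p ∈ A)
    (hψ : ContDiff ℝ ∞ ψ) (hψA : ∀ y ∈ A, ψ y = 0) (hψp : fderiv ℝ ψ p ≠ 0) (v : Euc N) :
    v ∈ tangentSpace A p ↔ fderiv ℝ ψ p v = 0 := by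
  have hψd : HasFDerivAt ψ (fderiv ℝ ψ p) p := (hψ.differentiable (by simp)).differentiableAt.hasFDerivAt
  refine ⟨fun hv => fderiv_eq_zero_of_mem_span_tangentConeAt hψd (s := A) (by
      filter_upwards [self_mem_nhdsWithin] with y hy
      rw [hψA y hy, hψA p hpA]) hv, fun hv => Submodule.subset_span ?_⟩
  refine ker_le_span_tangentConeAt (hψ.contDiffAt.hasStrictFDerivAt (by simp))
    (surjective_of_ne_zero hψp) ?_ hv
  filter_upwards [h.eventually_mem_iff hpA hψ hψA hψp] with y hy hy'
  exact hy.2 (by rw [hy', hψA p hpA])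

/-- `S` is near `p` the set `{ψ = 0, g ≤ 0}`, with `e, e'` dual to `dψ, dg` at `p`. -/
structure IsBoundaryChart (S : Set (Euc N)) (ψ : Euc N → ℝ) (p : Euc N) (U : Set (Euc N))
    (g : Euc N → ℝ) (e e' : Euc N) : Prop where
  isOpen : IsOpen U
  mem : p ∈ U
  smooth : ContDiffOn ℝ ∞ g U
  zero : g p = 0
  dual : fderiv ℝ ψ p e = 0 ∧ fderiv ℝ g p e = 1
  dual' : fderiv ℝ ψ p e' = 1 ∧ fderiv ℝ g p e' = 0
  mem_iff : ∀ y ∈ U, y ∈ S ↔ ψ y = 0 ∧ g y ≤ 0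
  mem_bdry : ∀ y ∈ U, ψ y = 0 → g y = 0 → y ∈ bdry S

end Level

section BoundaryChart

variable {S : Set (Euc N)} {ψ : Euc N → ℝ} {p : Euc N}

/-- The side function `g` is kept and the local `f` is replaced by `ψ`. Both vanish on `S`, so at
`p` their differentials are proportional, and the comparison of levels identifies `{f = 0, g ≤ 0}`
with `{ψ = 0, g ≤ 0}` near `p`. -/
theorem IsBoundaryPoint.exists_chart (h : IsBoundaryPoint S p)
    (hψ : ContDiff ℝ ∞ ψ) (hψS : ∀ y ∈ S, ψ y = 0) (hψp : fderiv ℝ ψ p ≠ 0) :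
    ∃ U g e e', IsBoundaryChart S ψ p U g e e' := by
  have hbd := h
  obtain ⟨U, f, g, hU, hp, hf, hg, hli, hfp, hgp, hS⟩ := h
  have hmem : ∀ y ∈ U, y ∈ S ↔ f y = 0 ∧ g y ≤ 0 := by
    intro y hy
    constructor
    · intro hyS
      exact (hS ▸ (⟨hyS, hy⟩ : y ∈ S ∩ U) : y ∈ {x ∈ U | f x = 0 ∧ g x ≤ 0}).2
    · intro h'
      exact (hS.symm ▸ (⟨hy, h'⟩ : y ∈ {x ∈ U | f x = 0 ∧ g x ≤ 0}) : y ∈ S ∩ U).1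
  have hpS : p ∈ S := (hmem p hp).2 ⟨hfp, hgp.le⟩
  have hψd : HasFDerivAt ψ (fderiv ℝ ψ p) p :=
    (hψ.differentiable (by simp)).differentiableAt.hasFDerivAt
  have hfd := ContDiffOn.hasStrictFDerivAt_of_mem hf hU hp
  have hgd := ContDiffOn.hasFDerivAt_of_mem hg hU hp
  obtain ⟨e', he'1, he'2⟩ := exists_dual_of_linearIndependent (hli p hp)
  obtain ⟨e, he2, he1⟩ := exists_dual_of_linearIndependent
    (u := gradient g p) (v := gradient f p) (LinearIndependent.pair_symm_iff.1 (hli p hp))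
  rw [inner_gradient] at he'1 he'2 he1 he2
  have hf0 : fderiv ℝ f p ≠ 0 := by
    intro h0; rw [h0] at he'1; simp at he'1
  have hneg : ∀ v, fderiv ℝ f p v = 0 → fderiv ℝ g p v < 0 → fderiv ℝ ψ p v = 0 := by
    intro v hv1 hv2
    refine fderiv_eq_zero_of_mem_span_tangentConeAt hψd (s := S) (by
      filter_upwards [self_mem_nhdsWithin] with y hy
      rw [hψS y hy, hψS p hpS]) (Submodule.subset_span ?_)
    refine mem_tangentConeAt_of_neg hfd hfp hf0 hgd hgp ?_ hv1 hv2
    filter_upwards [hU.mem_nhds hp] with y hy h1 h2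
    exact (hmem y hy).2 ⟨h1, h2⟩
  have hψe : fderiv ℝ ψ p e = 0 := by
    have := hneg (-e) (by simp [he1]) (by simp [he2])
    simpa using this
  -- Only directions with `dg < 0` are known to be tangent to `S`. Subtracting a multiple of `e`
  -- makes `dg` equal to `-1` and leaves `dψ` unchanged.
  have hker : ∀ v, fderiv ℝ f p v = 0 → fderiv ℝ ψ p v = 0 := by
    intro v hv
    have := hneg (v - (fderiv ℝ g p v + 1) • e) (by simp [hv, he1]) (by simp [he2])
    simpa [hψe] using this
  have hfac : ∀ v, fderiv ℝ ψ p v = fderiv ℝ f p v * fderiv ℝ ψ p e' := by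
    intro v
    have := hker (v - fderiv ℝ f p v • e') (by simp [he'1])
    simpa [sub_eq_zero] using this
  have hc : fderiv ℝ ψ p e' ≠ 0 := by
    intro h0
    apply hψp
    ext v
    simp [hfac v, h0]
  set c := fderiv ℝ ψ p e' with hcdef
  let R : ℝ × ℝ →L[ℝ] Euc N := (ContinuousLinearMap.fst ℝ ℝ ℝ).smulRight e' +
    (ContinuousLinearMap.snd ℝ ℝ ℝ).smulRight e
  have hRa : ∀ a : ℝ × ℝ, R a = a.1 • e' + a.2 • e := fun a => by simp [R]
  have hF : HasFDerivAt (fun y => (f y, g y)) _ p := hfd.hasFDerivAt.prodMk hgd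
  have hF₁ : HasFDerivAt (fun y => (ψ y, g y)) _ p := hψd.prodMk hgd
  have key := eventually_eq_of_level_subset (F := fun y => (f y, g y)) (F₁ := fun y => (ψ y, g y))
    hU hp (hf.prodMk hg) (hψ.contDiffAt.prodMk (hg.contDiffAt (hU.mem_nhds hp)))
    (by rw [hfp, hψS p hpS]) (R := R)
    (fun a ha => by
      rw [hF.fderiv, hRa] at ha
      simp only [ContinuousLinearMap.prod_apply, map_add, map_smul, he'1, he1, he2, he'2] at ha
      ext
      · simpa using congrArg Prod.fst ha
      · simpa using congrArg Prod.snd ha)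
    (fun a ha => by
      rw [hF₁.fderiv, hRa] at ha
      simp only [ContinuousLinearMap.prod_apply, map_add, map_smul, hψe, he2, he'2, ← hcdef] at ha
      ext
      · simpa [hc] using congrArg Prod.fst ha
      · simpa using congrArg Prod.snd ha)
    (Q := {w | w.1 = 0 ∧ w.2 ≤ 0})
    (by
      filter_upwards [hU.mem_nhds hp] with y hy hfy
      rw [hψS y ((hmem y hy).2 hfy), hfy.1])
  obtain ⟨U', hU'sub, hU'o, hpU'⟩ := eventually_nhds_iff.1 (key.and (hU.mem_nhds hp))
  have hgood : ∀ y ∈ U', ψ y = 0 → g y ≤ 0 → f y = 0 := by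
    intro y hy h1 h2
    have := congrArg Prod.fst ((hU'sub y hy).1 ⟨h1, h2⟩)
    simpa [h1] using this.symm
  refine ⟨U', g, e, c⁻¹ • e', hU'o, hpU', hg.mono fun y hy => (hU'sub y hy).2, hgp, ⟨hψe, he2⟩,
    ⟨by simp [← hcdef, hc], by simp [he'2]⟩, fun y hy => ?_, fun y hy h1 h2 => ?_⟩
  · have hyU := (hU'sub y hy).2
    exact ⟨fun hyS => ⟨hψS y hyS, ((hmem y hyU).1 hyS).2⟩,
      fun h' => (hmem y hyU).2 ⟨hgood y hy h'.1 h'.2, h'.2⟩⟩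
  · have hyU := (hU'sub y hy).2
    have hfy := hgood y hy h1 h2.le
    exact ⟨(hmem y hyU).2 ⟨hfy, h2.le⟩, U, f, g, hU, hyU, hf, hg, hli, hfy, h2, hS⟩

/-- The tangent cone contains the open half of the kernel of `dψ` where `dg < 0`, and this half
spans the kernel. -/
theorem IsBoundaryChart.mem_tangentSpace_iff {U : Set (Euc N)} {g : Euc N → ℝ} {e e' : Euc N}
    (h : IsBoundaryChart S ψ p U g e e') (hpS : p ∈ S)
    (hψ : ContDiff ℝ ∞ ψ) (hψS : ∀ y ∈ S, ψ y = 0) (v : Euc N) :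
    v ∈ tangentSpace S p ↔ fderiv ℝ ψ p v = 0 := by
  have hψd : HasStrictFDerivAt ψ (fderiv ℝ ψ p) p := hψ.contDiffAt.hasStrictFDerivAt (by simp)
  have hψp : fderiv ℝ ψ p ≠ 0 := by
    intro h0
    have := h.dual'.1
    rw [h0] at this
    simp at this
  refine ⟨fun hv => fderiv_eq_zero_of_mem_span_tangentConeAt hψd.hasFDerivAt (s := S) (by
      filter_upwards [self_mem_nhdsWithin] with y hy
      rw [hψS y hy, hψS p hpS]) hv, fun hv => ?_⟩
  have hneg : ∀ v, fderiv ℝ ψ p v = 0 → fderiv ℝ g p v < 0 → v ∈ tangentSpace S p := by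
    intro v hv1 hv2
    refine Submodule.subset_span (mem_tangentConeAt_of_neg hψd (hψS p hpS) hψp
      (ContDiffOn.hasFDerivAt_of_mem h.smooth h.isOpen h.mem) h.zero ?_ hv1 hv2)
    filter_upwards [h.isOpen.mem_nhds h.mem] with y hy h1 h2
    exact (h.mem_iff y hy).2 ⟨h1, h2⟩
  have h1 := hneg (v - (fderiv ℝ g p v + 1) • e) (by simp [hv, h.dual.1]) (by simp [h.dual.2])
  have h2 := hneg (-e) (by simp [h.dual.1]) (by simp [h.dual.2])
  have := (tangentSpace S p).sub_mem h1 ((tangentSpace S p).smul_mem (fderiv ℝ g p v + 1) h2)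
  simpa using this

theorem IsBoundaryChart.mem_tangentSpace_bdry {U : Set (Euc N)} {g : Euc N → ℝ} {e e' : Euc N}
    (h : IsBoundaryChart S ψ p U g e e') (hψp : ψ p = 0)
    (hψ : ContDiff ℝ ∞ ψ) {v : Euc N} (hv : fderiv ℝ ψ p v = 0)
    (hgv : fderiv ℝ g p v = 0) : v ∈ tangentSpace (bdry S) p := by
  have hψd : HasStrictFDerivAt ψ (fderiv ℝ ψ p) p := hψ.contDiffAt.hasStrictFDerivAt (by simp)
  have hF : HasStrictFDerivAt (fun y => (ψ y, g y)) _ p :=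
    hψd.prodMk (ContDiffOn.hasStrictFDerivAt_of_mem h.smooth h.isOpen h.mem)
  refine Submodule.subset_span (ker_le_span_tangentConeAt hF ?_ ?_ ?_)
  · rintro ⟨a, b⟩
    refine ⟨a • e' + b • e, ?_⟩
    simp [h.dual, h.dual']
  · filter_upwards [h.isOpen.mem_nhds h.mem] with y hy h1
    rw [hψp, h.zero] at h1
    exact h.mem_bdry y hy (congrArg Prod.fst h1) (congrArg Prod.snd h1)
  · simp [hv, hgv]

/-- The tangent space of a hypersurface with boundary is the kernel of the differential of a level
function. -/
theorem IsHypersurfaceWithBoundary.mem_tangentSpace_iff (hS : IsHypersurfaceWithBoundary S)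
    (hpS : p ∈ S) (hψ : ContDiff ℝ ∞ ψ) (hψS : ∀ y ∈ S, ψ y = 0) (hψp : fderiv ℝ ψ p ≠ 0)
    (v : Euc N) : v ∈ tangentSpace S p ↔ fderiv ℝ ψ p v = 0 := by
  rcases hS p hpS with h | h
  · exact h.mem_tangentSpace_iff hpS hψ hψS hψp v
  · obtain ⟨U, g, e, e', hc⟩ := h.exists_chart hψ hψS hψp
    exact hc.mem_tangentSpace_iff hpS hψ hψS v

end BoundaryChart

/-! ### Global level functions and retractions. -/

section LevelFunction

variable {S S₀ : Set (Euc N)}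

/-- An oriented hypersurface is a regular level set near a given closed subset. -/
theorem IsHypersurface.exists_level_function (hS₀ : IsHypersurface S₀) (hor : IsOrientable S₀)
    (hS : IsClosed S) (hSS₀ : S ⊆ S₀) :
    ∃ ψ : Euc N → ℝ, ContDiff ℝ ∞ ψ ∧ (∀ y ∈ S₀, ψ y = 0) ∧ ∀ y ∈ S, fderiv ℝ ψ y ≠ 0 := by
  obtain ⟨ν, hν, hν'⟩ := hor
  have hloc : ∀ x : Euc N, ∃ (U : Set (Euc N)) (f : Euc N → ℝ), IsOpen U ∧ x ∈ U ∧
      ContDiffOn ℝ ∞ f U ∧ (∀ y ∈ U, y ∈ S₀ → f y = 0) ∧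
      ∀ y ∈ U, y ∈ S → 0 < fderiv ℝ f y (ν y) := by
    intro x
    by_cases hx : x ∈ S
    swap
    · exact ⟨Sᶜ, fun _ => 0, hS.isOpen_compl, hx, contDiffOn_const, fun _ _ _ => rfl,
        fun y hy hy' => absurd hy' hy⟩
    obtain ⟨U, f, hU, hxU, hf, hf', hA⟩ := hS₀ x (hSS₀ hx)
    have hf0 : ∀ y ∈ U, y ∈ S₀ → f y = 0 := fun y hy hy' =>
      (hA ▸ (⟨hy', hy⟩ : y ∈ S₀ ∩ U) : y ∈ {x ∈ U | f x = 0}).2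
    have hcont : ContinuousWithinAt (fun y => fderiv ℝ f y (ν y)) S₀ x :=
      ((hf.continuousOn_fderiv_of_isOpen hU (by simp)).continuousAt
        (hU.mem_nhds hxU)).continuousWithinAt.clm_apply (hν x (hSS₀ hx))
    -- Otherwise `ν` would be tangent. Its continuity then fixes the sign near `x`, and replacing
    -- `f` by `-f` where needed makes all local functions increase along `ν`; this is where
    -- orientability enters.
    have hne : fderiv ℝ f x (ν x) ≠ 0 := by
      intro h0
      have h1 : ν x ∈ tangentSpace S₀ x := Submodule.subset_span
        (IsInteriorPoint.fderiv_eq_zero_of_ker hU hxU (hSS₀ hx) hf hf' hA h0)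
      have h2 := (Submodule.mem_orthogonal _ _).1 (hν' x (hSS₀ hx)).2 _ h1
      rw [real_inner_self_eq_norm_sq, (hν' x (hSS₀ hx)).1] at h2
      norm_num at h2
    rcases lt_or_gt_of_ne hne with hlt | hgt
    · obtain ⟨O, hO, hxO, hOsub⟩ := mem_nhdsWithin.1 (hcont.tendsto.eventually (gt_mem_nhds hlt))
      refine ⟨U ∩ O, fun y => -f y, hU.inter hO, ⟨hxU, hxO⟩, hf.neg.mono inter_subset_left,
        fun y hy hy' => by simp [hf0 y hy.1 hy'], fun y hy hy' => ?_⟩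
      rw [fderiv_fun_neg]
      have : fderiv ℝ f y (ν y) < 0 := hOsub ⟨hy.2, hSS₀ hy'⟩
      simpa using this
    · obtain ⟨O, hO, hxO, hOsub⟩ := mem_nhdsWithin.1 (hcont.tendsto.eventually (lt_mem_nhds hgt))
      exact ⟨U ∩ O, f, hU.inter hO, ⟨hxU, hxO⟩, hf.mono inter_subset_left,
        fun y hy hy' => hf0 y hy.1 hy', fun y hy hy' => hOsub ⟨hy.2, hSS₀ hy'⟩⟩
  choose U f hU hxU hf hf0 hfd using hloc
  obtain ⟨ψ, hψ, hψC, hψd⟩ := exists_smooth_glue hU hxU hf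
  refine ⟨ψ, hψ, fun y hy => hψC y {0} (convex_singleton 0) fun x hx => hf0 x y hx hy,
    fun y hy h0 => ?_⟩
  have := hψd y (ν y) fun x hx => ⟨hf0 x y hx (hSS₀ hy), hfd x y hx hy⟩
  rw [h0] at this
  simp at this

/-- A smooth retraction of a neighbourhood of a compact piece of a regular level set. -/
theorem exists_level_retraction {ψ : Euc N → ℝ} (hψ : ContDiff ℝ ∞ ψ) (hS : IsCompact S)
    (hψS : ∀ y ∈ S, ψ y = 0) (hψd : ∀ y ∈ S, fderiv ℝ ψ y ≠ 0) {U : Set (Euc N)} (hU : IsOpen U)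
    (hSU : S ⊆ U) :
    ∃ (V : Set (Euc N)) (π : Euc N → Euc N), IsOpen V ∧ S ⊆ V ∧ V ⊆ U ∧ ContDiffOn ℝ ∞ π V ∧
      (∀ y ∈ V, π y ∈ U ∧ ψ (π y) = 0) ∧ (∀ y ∈ V, ψ y = 0 → π y = y) ∧
      ∀ y ∈ S, fderiv ℝ π y (gradient ψ y) = 0 ∧
        ∀ v, fderiv ℝ ψ y v = 0 → fderiv ℝ π y v = v := by
  have hgs : ContDiff ℝ ∞ (gradient ψ) := by
    have h1 : ContDiff ℝ ∞ (fderiv ℝ ψ) := hψ.fderiv_right (by simp)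
    exact (InnerProductSpace.toDual ℝ (Euc N)).symm.contDiff.comp h1
  -- The retraction moves `y` along `-∇ψ` until `ψ` vanishes. Where `ψ` already vanishes, uniqueness
  -- makes the displacement zero.
  let L : Euc N × ℝ → Euc N := fun q => q.1 - q.2 • gradient ψ q.1
  have hL : ContDiff ℝ ∞ L := by
    have := hgs.comp (contDiff_fst (𝕜 := ℝ) (E := Euc N) (F := ℝ) (n := ∞))
    exact contDiff_fst.sub (contDiff_snd.smul this)
  have hF : ContDiff ℝ ∞ (fun q => ψ (L q)) := hψ.comp hL
  have hL0 : ∀ y, L (y, 0) = y := fun y => by simp [L]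
  have hψd' : ∀ y, HasFDerivAt ψ (fderiv ℝ ψ y) y := fun y =>
    (hψ.differentiable (by simp)).differentiableAt.hasFDerivAt
  obtain ⟨V, w, O', hV, hSV, hw, hwS, hwV, hO', hSO', hO'u⟩ := exists_implicit_near_compact
    (f := fun q => ψ (L q)) (u := fun _ => (0 : ℝ)) (O := L ⁻¹' U) (K := S)
    (hU.preimage hL.continuous) hF.contDiffOn hS continuousOn_const
    (fun y hy => by simpa [hL0] using hSU hy) (fun y hy => by simp [hL0, hψS y hy])
    (by
      intro y hy τ hτ
      have h1 : HasDerivAt (fun a : ℝ => y - (a * τ) • gradient ψ y) (-(τ • gradient ψ y)) 0 := by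
        have := (((hasDerivAt_id (0 : ℝ)).mul_const τ).smul_const (gradient ψ y)).const_sub y
        simpa using this
      have h2 : HasDerivAt (fun a : ℝ => ψ (L (y, a * τ)))
          (fderiv ℝ ψ y (-(τ • gradient ψ y))) 0 := by
        have hy' : HasFDerivAt ψ (fderiv ℝ ψ y) (y - ((0 : ℝ) * τ) • gradient ψ y) := by
          simpa using hψd' y
        exact hy'.comp_hasDerivAt (0 : ℝ) h1
      have h3 : HasDerivAt (fun a : ℝ => (y, a * τ)) ((0 : Euc N), τ) 0 := by
        have := (hasDerivAt_const (0 : ℝ) y).prodMk ((hasDerivAt_id (0 : ℝ)).mul_const τ)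
        simpa using this
      have h4 : HasFDerivAt (fun q => ψ (L q)) (fderiv ℝ (fun q => ψ (L q)) (y, 0))
          (y, (0 : ℝ) * τ) := by
        rw [zero_mul]
        exact (hF.differentiable (by simp)).differentiableAt.hasFDerivAt
      have h4' := h4.comp_hasDerivAt (0 : ℝ) h3
      have h5 := h4'.unique (show HasDerivAt ((fun q => ψ (L q)) ∘ fun a : ℝ => (y, a * τ))
        (fderiv ℝ ψ y (-(τ • gradient ψ y))) 0 from h2)
      rw [hτ, map_neg, map_smul, ← inner_gradient, real_inner_self_eq_norm_sq] at h5
      have h6 : ‖gradient ψ y‖ ≠ 0 := norm_ne_zero_iff.2 (gradient_ne_zero_iff.2 (hψd y hy))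
      simpa [h6] using h5.symm)
  have hO'' : IsOpen ((fun y : Euc N => (y, (0 : ℝ))) ⁻¹' O') := hO'.preimage (by fun_prop)
  have hπ : ContDiffOn ℝ ∞ (fun y => L (y, w y)) V :=
    hL.comp_contDiffOn (contDiffOn_id.prodMk hw)
  refine ⟨V ∩ (U ∩ (fun y : Euc N => (y, (0 : ℝ))) ⁻¹' O'), fun y => L (y, w y),
    hV.inter (hU.inter hO''), fun y hy => ⟨hSV hy, hSU hy, hSO' y hy⟩, fun y hy => hy.2.1,
    hπ.mono inter_subset_left, fun y hy => hwV y hy.1, fun y hy h0 => ?_, fun y hy => ?_⟩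
  · have := (hO'u y 0 hy.2.2 (by simpa [hL0] using h0)).2
    simp only [this, hL0]
  · have hyV := hSV hy
    have hwd : HasFDerivAt w (fderiv ℝ w y) y := ContDiffOn.hasFDerivAt_of_mem hw hV hyV
    have hgd : HasFDerivAt (gradient ψ) (fderiv ℝ (gradient ψ) y) y :=
      (hgs.differentiable (by simp)).differentiableAt.hasFDerivAt
    have hπd : HasFDerivAt (fun y => L (y, w y)) _ y := (hasFDerivAt_id y).sub (hwd.smul hgd)
    have hw0 : w y = 0 := hwS hy
    have hval : ∀ v, fderiv ℝ (fun y => L (y, w y)) y v = v - fderiv ℝ w y v • gradient ψ y := by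
      intro v
      rw [hπd.fderiv]
      simp [hw0]
    have hcomp : ∀ v, fderiv ℝ ψ y (fderiv ℝ (fun y => L (y, w y)) y v) = 0 := by
      intro v
      have h1 : HasFDerivAt ψ (fderiv ℝ ψ y) (L (y, w y)) := by rw [hw0, hL0]; exact hψd' y
      have h2 := h1.comp y (hπd.differentiableAt.hasFDerivAt)
      have h3 : (ψ ∘ fun y => L (y, w y)) =ᶠ[𝓝 y] fun _ => 0 := by
        filter_upwards [hV.mem_nhds hyV] with z hz using (hwV z hz).2
      have h4 := h2.unique ((hasFDerivAt_const (0 : ℝ) y).congr_of_eventuallyEq h3)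
      exact congrArg (fun A => A v) h4
    have hg0 : ‖gradient ψ y‖ ^ 2 ≠ 0 :=
      pow_ne_zero 2 (norm_ne_zero_iff.2 (gradient_ne_zero_iff.2 (hψd y hy)))
    -- This determines `dw`, and makes the derivative of the retraction the orthogonal projection
    -- onto the kernel of `dψ`.
    have hrel : ∀ v, fderiv ℝ ψ y v = fderiv ℝ w y v * ‖gradient ψ y‖ ^ 2 := by
      intro v
      have := hcomp v
      rw [hval, map_sub, map_smul, ← inner_gradient ψ y (gradient ψ y), real_inner_self_eq_norm_sq,
        smul_eq_mul] at this
      linarith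
    constructor
    · rw [hval]
      have := hrel (gradient ψ y)
      rw [← inner_gradient, real_inner_self_eq_norm_sq] at this
      have h1 : fderiv ℝ w y (gradient ψ y) = 1 := mul_right_cancel₀ hg0 (by linarith)
      simp [h1]
    · intro v hv
      rw [hval]
      have := hrel v
      rw [hv] at this
      have h1 : fderiv ℝ w y v = 0 := by
        rcases mul_eq_zero.1 this.symm with h | h
        · exact h
        · exact absurd h hg0
      simp [h1]

end LevelFunction

/-! ### Ambient extension of the evolving hypersurface and its normal. -/

/-- Extension of an evolving hypersurface `X₀` and its unit normal `n` to a neighbourhood `D` of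
`S × [0, T]` in `ℝ^N × ℝ`, together with a level function `ψ` of `S'`. -/
structure IsAmbientExtension (S S' : Set (Euc N)) (T : ℝ) (X₀ n : Euc N × ℝ → Euc N)
    (ψ : Euc N → ℝ) (U : Set (Euc N)) (D : Set (Euc N × ℝ)) (χ ν : Euc N × ℝ → Euc N) :
    Prop where
  level_smooth : ContDiff ℝ ∞ ψ
  level_eq_zero : ∀ y ∈ S', ψ y = 0
  level_fderiv : ∀ y ∈ S, fderiv ℝ ψ y ≠ 0
  subset : S ⊆ S'
  isOpen_U : IsOpen U
  subset_U : S ⊆ U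
  mem_iff : ∀ y ∈ U, y ∈ S' ↔ ψ y = 0
  isOpen_D : IsOpen D
  subset_D : S ×ˢ Icc 0 T ⊆ D
  smooth : ContDiffOn ℝ ∞ χ D
  normal_smooth : ContDiffOn ℝ ∞ ν D
  eq : ∀ q ∈ D, ψ q.1 = 0 → χ q = X₀ q
  normal_eq : ∀ s ∈ S, ∀ t ∈ Icc 0 T, ν (s, t) = n (s, t)
  normal_unit : ∀ q ∈ D, ‖ν q‖ = 1
  injOn : ∀ t ∈ Icc 0 T, InjOn (fun s => χ (s, t)) S
  immersion : ∀ s ∈ S, ∀ t ∈ Icc 0 T, ∀ v, fderiv ℝ ψ s v = 0 → fderiv ℝ χ (s, t) (v, 0) = 0 → v = 0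
  orthogonal : ∀ s ∈ S, ∀ t ∈ Icc 0 T, ∀ v, inner ℝ (ν (s, t)) (fderiv ℝ χ (s, t) (v, 0)) = 0

/-- Decomposition of the space into a normal line and the image of an injective linear map of a
hyperplane. -/
theorem exists_decomposition {A : Euc N →L[ℝ] Euc N} {ℓ : Euc N →L[ℝ] ℝ} {n : Euc N} (hℓ : ℓ ≠ 0)
    (hn : ‖n‖ = 1) (hA : ∀ v, ℓ v = 0 → A v = 0 → v = 0) (hnA : ∀ v, inner ℝ n (A v) = 0)
    (h : Euc N) : ∃ (ρ : ℝ) (v : Euc N), ℓ v = 0 ∧ h = ρ • n + A v := by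
  obtain ⟨k, hk⟩ := exists_apply_eq_one hℓ
  let L : Euc N →ₗ[ℝ] Euc N :=
    ((A.comp (ContinuousLinearMap.id ℝ (Euc N) - ℓ.smulRight k) + ℓ.smulRight n :
      Euc N →L[ℝ] Euc N) : Euc N →ₗ[ℝ] Euc N)
  have hL : ∀ v, L v = A (v - ℓ v • k) + ℓ v • n := fun v => by simp [L]
  -- The component along `n` recovers `ℓ v`, and the rest is injective on the kernel of `ℓ`;
  -- surjectivity follows by dimension.
  have hinj : Function.Injective L := by
    rw [injective_iff_map_eq_zero]
    intro v hv
    rw [hL] at hv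
    have h1 : inner ℝ n (A (v - ℓ v • k) + ℓ v • n) = ℓ v := by
      rw [inner_add_right, hnA, inner_smul_right, real_inner_self_eq_norm_sq, hn]; simp
    rw [hv, inner_zero_right] at h1
    rw [← h1] at hv
    exact hA v h1.symm (by simpa using hv)
  obtain ⟨v, hv⟩ := LinearMap.injective_iff_surjective.1 hinj h
  refine ⟨ℓ v, v - ℓ v • k, by simp [hk], ?_⟩
  rw [← hv, hL, add_comm]

/-- Smooth extension of a unit normal field given on a compact set. -/
theorem exists_normal_extension {D : Set (Euc N × ℝ)} {K : Set (Euc N × ℝ)}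
    {χ n : Euc N × ℝ → Euc N} {ψ : Euc N → ℝ} (hψ : ContDiff ℝ ∞ ψ) (hD : IsOpen D)
    (hχ : ContDiffOn ℝ ∞ χ D) (hK : IsCompact K) (hKD : K ⊆ D) (hn : ContinuousOn n K)
    (hnu : ∀ q ∈ K, ‖n q‖ = 1) (hψd : ∀ q ∈ K, fderiv ℝ ψ q.1 ≠ 0)
    (himm : ∀ q ∈ K, ∀ v, fderiv ℝ ψ q.1 v = 0 → fderiv ℝ χ q (v, 0) = 0 → v = 0)
    (hgrad : ∀ q ∈ K, fderiv ℝ χ q (gradient ψ q.1, 0) = 0)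
    (horth : ∀ q ∈ K, ∀ v, inner ℝ (n q) (fderiv ℝ χ q (v, 0)) = 0) :
    ∃ (V : Set (Euc N × ℝ)) (ν : Euc N × ℝ → Euc N), IsOpen V ∧ K ⊆ V ∧ ContDiffOn ℝ ∞ ν V ∧
      EqOn ν n K ∧ ∀ q ∈ V, ‖ν q‖ = 1 := by
  let A : Euc N × ℝ → Euc N →L[ℝ] Euc N := fun q =>
    (fderiv ℝ χ q).comp (ContinuousLinearMap.inl ℝ (Euc N) ℝ)
  have hA : ContDiffOn ℝ ∞ A D :=
    (hχ.fderiv_of_isOpen hD (by simp)).clm_comp contDiffOn_const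
  have hAv : ∀ q v, A q v = fderiv ℝ χ q (v, 0) := fun q v => by simp [A]
  -- One equation encodes both orthogonality and unit length. On `K`, testing with `∇ψ`, which `A`
  -- annihilates, isolates `‖x‖² = 1`; what remains is orthogonality to the range of `A`. The
  -- solution `n` is nondegenerate, so it extends smoothly.
  let B : (Euc N × ℝ) × Euc N → Euc N →L[ℝ] ℝ := fun z =>
    (innerSL ℝ z.2).comp (A z.1) + (‖z.2‖ ^ 2 - 1) • fderiv ℝ ψ z.1.1
  let F : (Euc N × ℝ) × Euc N → Euc N := fun z => (InnerProductSpace.toDual ℝ (Euc N)).symm (B z)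
  have hFv : ∀ z v, inner ℝ (F z) v = inner ℝ z.2 (A z.1 v) + (‖z.2‖ ^ 2 - 1) * fderiv ℝ ψ z.1.1 v :=
    fun z v => by
      rw [InnerProductSpace.toDual_symm_apply]
      simp [B]
  have hO : IsOpen (D ×ˢ (univ : Set (Euc N))) := hD.prod isOpen_univ
  have hψs : ContDiff ℝ ∞ (fderiv ℝ ψ) := hψ.fderiv_right (by simp)
  have hB : ContDiffOn ℝ ∞ B (D ×ˢ univ) := by
    refine ContDiffOn.add ?_ ?_
    · refine ContDiffOn.clm_comp ?_ (hA.comp contDiffOn_fst fun z hz => hz.1)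
      exact ((innerSL ℝ (E := Euc N)).contDiff.comp contDiff_snd).contDiffOn
    · have h1 : ContDiff ℝ ∞ fun z : (Euc N × ℝ) × Euc N => ‖z.2‖ ^ 2 - 1 :=
        (contDiff_snd.norm_sq ℝ).sub contDiff_const
      have h2 : ContDiff ℝ ∞ fun z : (Euc N × ℝ) × Euc N => fderiv ℝ ψ z.1.1 :=
        hψs.comp (contDiff_fst.comp contDiff_fst)
      exact (h1.smul h2).contDiffOn
  have hF : ContDiffOn ℝ ∞ F (D ×ˢ univ) :=
    (InnerProductSpace.toDual ℝ (Euc N)).symm.contDiff.comp_contDiffOn hB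
  obtain ⟨V, w, -, hV, hKV, hw, hwn, -, -⟩ := exists_implicit_near_compact hO hF hK hn
    (fun q hq => ⟨hKD hq, mem_univ _⟩)
    (fun q hq => by
      refine ext_inner_right ℝ fun v => ?_
      rw [hFv, hAv, horth q hq, hnu q hq]
      simp)
    (by
      intro q hq e he
      have hFd := ContDiffOn.hasFDerivAt_of_mem hF hO
        (show (q, n q) ∈ D ×ˢ (univ : Set (Euc N)) from ⟨hKD hq, mem_univ _⟩)
      have key : ∀ v, inner ℝ e (A q v) + 2 * inner ℝ (n q) e * fderiv ℝ ψ q.1 v = 0 := by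
        intro v
        have h1 : HasDerivAt (fun a : ℝ => n q + a • e) e 0 := by
          simpa using ((hasDerivAt_id (0 : ℝ)).smul_const e).const_add (n q)
        have h2 : HasDerivAt (fun a : ℝ => (q, n q + a • e)) (0, e) 0 :=
          (hasDerivAt_const (0 : ℝ) q).prodMk h1
        have h3 : HasFDerivAt F (fderiv ℝ F (q, n q)) ((fun a : ℝ => (q, n q + a • e)) 0) := by
          simpa using hFd
        have h4 := (h3.comp_hasDerivAt (0 : ℝ) h2).inner ℝ (hasDerivAt_const (0 : ℝ) v)
        rw [he] at h4
        have h5 : HasDerivAt (fun a : ℝ => inner ℝ (n q + a • e) (A q v) +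
            (‖n q + a • e‖ ^ 2 - 1) * fderiv ℝ ψ q.1 v)
            (inner ℝ e (A q v) + 2 * inner ℝ (n q) e * fderiv ℝ ψ q.1 v) 0 := by
          have h6 := h1.inner ℝ (hasDerivAt_const (0 : ℝ) (A q v))
          have h7 := ((h1.norm_sq).sub_const 1).mul_const (fderiv ℝ ψ q.1 v)
          have := h6.fun_add h7
          simpa using this
        have h8 : HasDerivAt (fun a : ℝ => inner ℝ (n q + a • e) (A q v) +
            (‖n q + a • e‖ ^ 2 - 1) * fderiv ℝ ψ q.1 v) 0 0 := by
          refine (h4.congr_of_eventuallyEq (Eventually.of_forall fun a => ?_)).congr_deriv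
            (by simp)
          exact (hFv (q, n q + a • e) v).symm
        exact h5.unique h8
      have hg0 : ‖gradient ψ q.1‖ ≠ 0 := norm_ne_zero_iff.2 (gradient_ne_zero_iff.2 (hψd q hq))
      have hne : inner ℝ (n q) e = 0 := by
        have := key (gradient ψ q.1)
        rw [hAv, hgrad q hq, ← inner_gradient, real_inner_self_eq_norm_sq, inner_zero_right] at this
        simpa [hg0] using this
      have hAe : ∀ v, inner ℝ e (A q v) = 0 := fun v => by
        have := key v
        rw [hne] at this
        simpa using this
      obtain ⟨ρ, v, -, hv⟩ := exists_decomposition (A := A q) (hψd q hq) (hnu q hq)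
        (fun v hv hv' => himm q hq v hv (by rwa [hAv] at hv'))
        (fun v => by rw [hAv]; exact horth q hq v) e
      have h9 : inner ℝ e e = 0 := by
        nth_rw 2 [hv]
        rw [inner_add_right, inner_smul_right, hAe, real_inner_comm, hne]
        simp
      exact inner_self_eq_zero.1 h9)
  -- Off `K` nothing ensures that `A` annihilates `∇ψ`, so the solution there is normalised by hand.
  have hV' : IsOpen (V ∩ w ⁻¹' {0}ᶜ) :=
    hw.continuousOn.isOpen_inter_preimage hV isOpen_compl_singleton
  refine ⟨V ∩ w ⁻¹' {0}ᶜ, fun q => ‖w q‖⁻¹ • w q, hV', fun q hq => ⟨hKV hq, ?_⟩, ?_, ?_, ?_⟩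
  · intro h0
    have := hnu q hq
    rw [← hwn hq, h0] at this
    simp at this
  · have hw' := hw.mono (inter_subset_left : V ∩ w ⁻¹' {0}ᶜ ⊆ V)
    exact ((hw'.norm ℝ fun q hq => hq.2).inv fun q hq => norm_ne_zero_iff.2 hq.2).smul hw'
  · intro q hq
    simp [hwn hq, hnu q hq]
  · intro q hq
    have : ‖w q‖ ≠ 0 := norm_ne_zero_iff.2 hq.2
    rw [norm_smul, norm_inv, norm_norm, inv_mul_cancel₀ this]

/-- The extension is `X₀` composed in space with a retraction onto the level set. It is smooth on an
open set although `X₀` is smooth only on `S₀ × I`. Its derivative annihilates `∇ψ`, so orthogonality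
of `n` to tangential derivatives gives orthogonality to all spatial derivatives. -/
theorem exists_ambient_extension {S S' S₀ : Set (Euc N)}
    (hS : IsHypersurfaceWithBoundary S) (hSc : IsCompact S)
    (hS₀ : IsHypersurface S₀) (hS₀o : IsOrientable S₀)
    (hS' : IsHypersurfaceWithBoundary S') (hSS' : S ⊆ S' \ bdry S') (hS'S₀ : S' ⊆ S₀)
    {T τ₀ : ℝ} (hτ₀ : 0 < τ₀)
    {X₀ : Euc N × ℝ → Euc N} (hX₀ : ContDiffOn ℝ ∞ X₀ (S₀ ×ˢ Ioo (-τ₀) (T + τ₀)))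
    (hX₀inj : ∀ t ∈ Ioo (-τ₀) (T + τ₀), InjOn (fun s => X₀ (s, t)) S₀)
    (hX₀imm : ∀ t ∈ Ioo (-τ₀) (T + τ₀), ∀ s ∈ S₀, ∀ v ∈ tangentSpace S₀ s,
      fderivWithin ℝ (fun s' => X₀ (s', t)) S₀ s v = 0 → v = 0)
    {n : Euc N × ℝ → Euc N} (hn : ContinuousOn n (S ×ˢ Icc 0 T))
    (hn_unit : ∀ t ∈ Icc 0 T, ∀ s ∈ S, ‖n (s, t)‖ = 1)
    (hn_normal : ∀ t ∈ Icc 0 T, ∀ s ∈ S,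
      n (s, t) ∈ (tangentSpace (slice X₀ S t) (X₀ (s, t)))ᗮ) :
    ∃ ψ U D χ ν, IsAmbientExtension S S' T X₀ n ψ U D χ ν := by
  have hSS'1 : S ⊆ S' := fun s hs => (hSS' hs).1
  have hSS₀ : S ⊆ S₀ := hSS'1.trans hS'S₀
  obtain ⟨ψ, hψ, hψ0, hψd⟩ := hS₀.exists_level_function hS₀o hSc.isClosed hSS₀
  have hψS' : ∀ y ∈ S', ψ y = 0 := fun y hy => hψ0 y (hS'S₀ hy)
  set U : Set (Euc N) := interior {y | y ∈ S' ↔ ψ y = 0} with hUdef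
  have hSU : S ⊆ U := by
    intro s hs
    rw [hUdef, mem_interior_iff_mem_nhds]
    have hi : IsInteriorPoint S' s := by
      rcases hS' s (hSS'1 hs) with h | h
      · exact h
      · exact absurd ⟨hSS'1 hs, h⟩ (hSS' hs).2
    exact hi.eventually_mem_iff (hSS'1 hs) hψ hψS' (hψd s hs)
  have hUiff : ∀ y ∈ U, y ∈ S' ↔ ψ y = 0 := fun y hy => (interior_subset hy : _)
  obtain ⟨V, π, hV, hSV, -, hπ, hπU, hπid, hπd⟩ := exists_level_retraction hψ hSc
    (fun y hy => hψS' y (hSS'1 hy)) hψd isOpen_interior hSU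
  set I := Ioo (-τ₀) (T + τ₀) with hI
  have hII : Icc 0 T ⊆ I := fun t ht => ⟨by linarith [ht.1], by linarith [ht.2]⟩
  let χ : Euc N × ℝ → Euc N := fun q => X₀ (π q.1, q.2)
  let P : Euc N × ℝ → Euc N × ℝ := fun q => (π q.1, q.2)
  have hP : ContDiffOn ℝ ∞ P (V ×ˢ I) :=
    (hπ.comp contDiffOn_fst fun q hq => hq.1).prodMk contDiffOn_snd
  have hPm : MapsTo P (V ×ˢ I) (S₀ ×ˢ I) := fun q hq =>
    ⟨hS'S₀ ((hUiff _ (hπU _ hq.1).1).2 (hπU _ hq.1).2), hq.2⟩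
  have hDo : IsOpen (V ×ˢ I) := hV.prod isOpen_Ioo
  have hχ : ContDiffOn ℝ ∞ χ (V ×ˢ I) := hX₀.comp hP hPm
  have hχeq : ∀ q ∈ V ×ˢ I, ψ q.1 = 0 → χ q = X₀ q := by
    intro q hq h0
    simp only [χ, hπid _ hq.1 h0]
  have hKD : S ×ˢ Icc 0 T ⊆ V ×ˢ I := prod_mono hSV hII
  -- derivative of the extension
  have hchain : ∀ s ∈ S, ∀ t ∈ Icc 0 T, ∀ v, fderiv ℝ χ (s, t) (v, 0) =
      fderivWithin ℝ X₀ (S₀ ×ˢ I) (s, t) (fderiv ℝ π s v, 0) := by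
    intro s hs t ht v
    have hmem := hKD (⟨hs, ht⟩ : (s, t) ∈ S ×ˢ Icc 0 T)
    have hPs : P (s, t) = (s, t) := by simp [P, hπid s (hSV hs) (hψS' s (hSS'1 hs))]
    have h1 : HasFDerivWithinAt X₀ (fderivWithin ℝ X₀ (S₀ ×ˢ I) (s, t)) (S₀ ×ˢ I) (P (s, t)) := by
      rw [hPs]
      exact ((hX₀ _ ⟨hSS₀ hs, hII ht⟩).differentiableWithinAt (by simp)).hasFDerivWithinAt
    have hπ' : HasFDerivAt π (fderiv ℝ π s) (s, t).1 := ContDiffOn.hasFDerivAt_of_mem hπ hV (hSV hs)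
    have h2 : HasFDerivAt P _ (s, t) := (hπ'.comp (s, t) hasFDerivAt_fst).prodMk hasFDerivAt_snd
    have h3 := (h1.comp (s, t) h2.hasFDerivWithinAt hPm).hasFDerivAt (hDo.mem_nhds hmem)
    have h4 : fderiv ℝ χ (s, t) = _ := h3.fderiv
    rw [h4]
    simp
  have hslice : ∀ s ∈ S, ∀ t ∈ Icc 0 T, HasFDerivAt (fun s' => χ (s', t))
      ((fderiv ℝ χ (s, t)).comp (ContinuousLinearMap.inl ℝ (Euc N) ℝ)) s := by
    intro s hs t ht
    have h1 := ContDiffOn.hasFDerivAt_of_mem hχ hDo (hKD (⟨hs, ht⟩ : (s, t) ∈ S ×ˢ Icc 0 T))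
    exact HasFDerivAt.comp (g := χ) (f := fun s' : Euc N => (s', t)) s h1 (hasFDerivAt_prodMk_left s t)
  have hwithin : ∀ s ∈ S, ∀ t ∈ Icc 0 T, ∀ A ⊆ S₀, s ∈ A → HasFDerivWithinAt (fun s' => X₀ (s', t))
      ((fderiv ℝ χ (s, t)).comp (ContinuousLinearMap.inl ℝ (Euc N) ℝ)) A s := by
    intro s hs t ht A hA hsA
    suffices hev : (fun s' => X₀ (s', t)) =ᶠ[𝓝[A] s] fun s' => χ (s', t) by
      exact (hslice s hs t ht).hasFDerivWithinAt.congr_of_eventuallyEq hev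
        (hev.self_of_nhdsWithin hsA)
    filter_upwards [self_mem_nhdsWithin, nhdsWithin_le_nhds (hV.mem_nhds (hSV hs))] with y h1 h2
    exact (hχeq (y, t) ⟨h2, hII ht⟩ (hψ0 y (hA h1))).symm
  have himm : ∀ s ∈ S, ∀ t ∈ Icc 0 T, ∀ v, fderiv ℝ ψ s v = 0 →
      fderiv ℝ χ (s, t) (v, 0) = 0 → v = 0 := by
    intro s hs t ht v hv h0
    have hvT : v ∈ tangentSpace S₀ s :=
      ((hS₀ s (hSS₀ hs)).mem_tangentSpace_iff (hSS₀ hs) hψ hψ0 (hψd s hs) v).2 hv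
    refine hX₀imm t (hII ht) s (hSS₀ hs) v hvT ?_
    have h1 := hwithin s hs t ht S₀ Subset.rfl (hSS₀ hs)
    rw [fderiv_eq_of_mem_span_tangentConeAt h1.differentiableWithinAt.hasFDerivWithinAt h1 hvT]
    simpa using h0
  have hgrad : ∀ s ∈ S, ∀ t ∈ Icc 0 T, fderiv ℝ χ (s, t) (gradient ψ s, 0) = 0 := by
    intro s hs t ht
    rw [hchain s hs t ht, (hπd s hs).1]
    exact map_zero _
  have horth : ∀ s ∈ S, ∀ t ∈ Icc 0 T, ∀ v, inner ℝ (n (s, t)) (fderiv ℝ χ (s, t) (v, 0)) = 0 := by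
    intro s hs t ht v
    have hker : ∀ v, fderiv ℝ ψ s v = 0 → inner ℝ (n (s, t)) (fderiv ℝ χ (s, t) (v, 0)) = 0 := by
      intro v hv
      have hvT : v ∈ tangentSpace S s := (hS.mem_tangentSpace_iff hs hψ
        (fun y hy => hψS' y (hSS'1 hy)) (hψd s hs) v).2 hv
      have h1 := hwithin s hs t ht S hSS₀ hs
      have h2 : fderiv ℝ χ (s, t) (v, 0) ∈ tangentSpace (slice X₀ S t) (X₀ (s, t)) := by
        have h3 : tangentSpace S s ≤ (tangentSpace (slice X₀ S t) (X₀ (s, t))).comap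
            (((fderiv ℝ χ (s, t)).comp (ContinuousLinearMap.inl ℝ (Euc N) ℝ) :
              Euc N →L[ℝ] Euc N) : Euc N →ₗ[ℝ] Euc N) :=
          Submodule.span_le.2 fun u hu => Submodule.subset_span (h1.mapsTo_tangent_cone hu)
        simpa using h3 hvT
      rw [real_inner_comm]
      exact (Submodule.mem_orthogonal _ _).1 (hn_normal t ht s hs) _ h2
    have hg0 : ‖gradient ψ s‖ ^ 2 ≠ 0 :=
      pow_ne_zero 2 (norm_ne_zero_iff.2 (gradient_ne_zero_iff.2 (hψd s hs)))
    set c := fderiv ℝ ψ s v / ‖gradient ψ s‖ ^ 2 with hc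
    have h1 : fderiv ℝ ψ s (v - c • gradient ψ s) = 0 := by
      rw [map_sub, map_smul, ← inner_gradient ψ s (gradient ψ s), real_inner_self_eq_norm_sq,
        smul_eq_mul, hc, div_mul_cancel₀ _ hg0, sub_self]
    have h2 := hker _ h1
    have h3 : ((v - c • gradient ψ s, 0) : Euc N × ℝ) = (v, 0) - c • (gradient ψ s, 0) := by simp
    rw [h3, map_sub, map_smul, hgrad s hs t ht, smul_zero, sub_zero] at h2
    exact h2
  obtain ⟨W, ν, hW, hKW, hν, hνn, hνu⟩ := exists_normal_extension hψ hDo hχ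
    (hSc.prod isCompact_Icc) hKD hn (fun q hq => hn_unit q.2 hq.2 q.1 hq.1)
    (fun q hq => hψd q.1 hq.1) (fun q hq => himm q.1 hq.1 q.2 hq.2)
    (fun q hq => hgrad q.1 hq.1 q.2 hq.2) (fun q hq => horth q.1 hq.1 q.2 hq.2)
  refine ⟨ψ, U, V ×ˢ I ∩ W, χ, ν, ?_⟩
  exact
    { level_smooth := hψ
      level_eq_zero := hψS'
      level_fderiv := hψd
      subset := hSS'1
      isOpen_U := isOpen_interior
      subset_U := hSU
      mem_iff := hUiff
      isOpen_D := hDo.inter hW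
      subset_D := fun q hq => ⟨hKD hq, hKW hq⟩
      smooth := hχ.mono inter_subset_left
      normal_smooth := hν.mono inter_subset_right
      eq := fun q hq => hχeq q hq.1
      normal_eq := fun s hs t ht => hνn ⟨hs, ht⟩
      normal_unit := fun q hq => hνu q hq.2
      injOn := fun t ht a ha b hb hab => by
        have h1 := hχeq (a, t) (hKD ⟨ha, ht⟩) (hψS' a (hSS'1 ha))
        have h2 := hχeq (b, t) (hKD ⟨hb, ht⟩) (hψS' b (hSS'1 hb))
        refine hX₀inj t (hII ht) (hSS₀ ha) (hSS₀ hb) ?_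
        simp only at hab ⊢
        rw [← h1, ← h2, hab]
      immersion := himm
      orthogonal := fun s hs t ht v => by rw [hνn ⟨hs, ht⟩]; exact horth s hs t ht v }

/-! ### The corrected tube map. -/

open scoped Manifold in
/-- A smooth cutoff function which is `1` near a compact set. -/
theorem exists_cutoff {B O : Set (Euc N)} (hB : IsCompact B) (hO : IsOpen O) (hBO : B ⊆ O) :
    ∃ (η : Euc N → ℝ) (M C : Set (Euc N)), ContDiff ℝ ∞ η ∧ IsOpen M ∧ B ⊆ M ∧ IsClosed C ∧ M ⊆ C ∧
      C ⊆ O ∧ (∀ y ∈ M, η y = 1) ∧ ∀ y ∉ C, η y = 0 := by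
  obtain ⟨C, hC, hBC, hCO⟩ := exists_compact_between hB hO hBO
  obtain ⟨K, hK, hBK, hKC⟩ := exists_compact_between hB isOpen_interior hBC
  obtain ⟨η, hη, -, hη0, hη1⟩ := exists_contMDiff_zero_iff_one_iff_of_isClosed 𝓘(ℝ, Euc N) (n := (⊤ : ℕ∞))
    (s := (interior C)ᶜ) (t := K) isOpen_interior.isClosed_compl hK.isClosed
    (by
      rw [Set.disjoint_left]
      exact fun x hx hxK => hx (hKC hxK))
  refine ⟨η, interior K, C, hη.contDiff, isOpen_interior, hBK, hC.isClosed,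
    (interior_subset.trans hKC).trans interior_subset, hCO, fun y hy => (hη1 y).1 (interior_subset hy),
    fun y hy => (hη0 y).1 fun h => hy (interior_subset h)⟩

/-- Curves `r ↦ X(r, s, t)` with initial velocity `ν` along which, near `B`, the function `φ` is
affine. -/
structure IsCoordinateMap (S B O : Set (Euc N)) (T : ℝ) (D : Set (Euc N × ℝ))
    (χ ν : Euc N × ℝ → Euc N) (φ : Euc N → ℝ) (G : Set (ℝ × Euc N × ℝ))
    (X : ℝ × Euc N × ℝ → Euc N) (M C : Set (Euc N)) : Prop where
  isOpen_G : IsOpen G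
  mem_G : ∀ s ∈ S, ∀ t ∈ Icc 0 T, (0, s, t) ∈ G
  mem_D : ∀ q ∈ G, q.2 ∈ D
  smooth : ContDiffOn ℝ ∞ X G
  isOpen_M : IsOpen M
  subset_M : B ⊆ M
  isClosed_C : IsClosed C
  subset_O : C ⊆ O
  zero : ∀ y t, (0, y, t) ∈ G → X (0, y, t) = χ (y, t)
  inner_eq : ∀ q ∈ G, inner ℝ (ν q.2) (X q - χ q.2) = q.1
  eq : ∀ q ∈ G, q.2.1 ∉ C → X q = χ q.2 + q.1 • ν q.2
  level : ∀ q ∈ G, q.2.1 ∈ M → φ (X q) = φ (χ q.2) + q.1 * fderiv ℝ φ (χ q.2) (ν q.2)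
  velocity : ∀ y t, (0, y, t) ∈ G → fderiv ℝ X (0, y, t) (1, 0, 0) = ν (y, t)

-- The map is `χ + r ν + η β w`, with `w` the part of `∇φ` orthogonal to `ν`, `β` solving the affine
-- law for `φ`, and `η` a cutoff around `B`. Orthogonality of `w` gives `inner_eq` for any `β`. The
-- law is exact to first order at `r = 0`, so the correction does not change the initial velocity.
set_option maxHeartbeats 1000000 in
theorem exists_coordinate_map {S B O : Set (Euc N)} {T : ℝ} {D : Set (Euc N × ℝ)}
    {χ ν : Euc N × ℝ → Euc N} {φ : Euc N → ℝ} (hD : IsOpen D) (hSD : S ×ˢ Icc 0 T ⊆ D)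
    (hχ : ContDiffOn ℝ ∞ χ D) (hν : ContDiffOn ℝ ∞ ν D) (hνu : ∀ q ∈ D, ‖ν q‖ = 1)
    (hφ : ContDiff ℝ ∞ φ) (hB : IsCompact B) (hBS : B ⊆ S) (hO : IsOpen O) (hBO : B ⊆ O)
    (hφB : ∀ s ∈ B, ∀ t ∈ Icc 0 T, gradient φ (χ (s, t)) ≠ 0 ∧
      inner ℝ (gradient φ (χ (s, t))) (ν (s, t)) = 0) :
    ∃ G X M C, IsCoordinateMap S B O T D χ ν φ G X M C := by
  have hgs : ContDiff ℝ ∞ (gradient φ) := by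
    have h1 : ContDiff ℝ ∞ (fderiv ℝ φ) := hφ.fderiv_right (by simp)
    exact (InnerProductSpace.toDual ℝ (Euc N)).symm.contDiff.comp h1
  have hφd : ∀ y, HasFDerivAt φ (fderiv ℝ φ y) y := fun y =>
    (hφ.differentiable (by simp)).differentiableAt.hasFDerivAt
  let w : Euc N × ℝ → Euc N := fun q =>
    gradient φ (χ q) - (inner ℝ (gradient φ (χ q)) (ν q) : ℝ) • ν q
  have hgχ : ContDiffOn ℝ ∞ (fun q => gradient φ (χ q)) D := hgs.comp_contDiffOn hχ
  have hw : ContDiffOn ℝ ∞ w D := hgχ.sub ((hgχ.inner ℝ hν).smul hν)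
  have hνw : ∀ q ∈ D, inner ℝ (ν q) (w q) = 0 := by
    intro q hq
    simp only [w]
    rw [inner_sub_right, inner_smul_right, real_inner_self_eq_norm_sq, hνu q hq,
      real_inner_comm (gradient φ (χ q)) (ν q)]
    simp
  -- the implicit equation
  let L : (ℝ × Euc N × ℝ) × ℝ → Euc N := fun z =>
    χ z.1.2 + z.1.1 • ν z.1.2 + z.2 • w z.1.2
  let F : (ℝ × Euc N × ℝ) × ℝ → ℝ := fun z =>
    φ (L z) - (φ (χ z.1.2) + z.1.1 * inner ℝ (gradient φ (χ z.1.2)) (ν z.1.2))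
  set E : Set ((ℝ × Euc N × ℝ) × ℝ) := (fun z => z.1.2) ⁻¹' D with hE
  have hEo : IsOpen E := hD.preimage (by fun_prop)
  have hp : ContDiff ℝ ∞ (fun z : (ℝ × Euc N × ℝ) × ℝ => z.1.2) := by fun_prop
  have hpm : MapsTo (fun z : (ℝ × Euc N × ℝ) × ℝ => z.1.2) E D := fun z hz => hz
  have hχE : ContDiffOn ℝ ∞ (fun z : (ℝ × Euc N × ℝ) × ℝ => χ z.1.2) E :=
    hχ.comp hp.contDiffOn hpm
  have hνE : ContDiffOn ℝ ∞ (fun z : (ℝ × Euc N × ℝ) × ℝ => ν z.1.2) E :=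
    hν.comp hp.contDiffOn hpm
  have hwE : ContDiffOn ℝ ∞ (fun z : (ℝ × Euc N × ℝ) × ℝ => w z.1.2) E :=
    hw.comp hp.contDiffOn hpm
  have hr : ContDiffOn ℝ ∞ (fun z : (ℝ × Euc N × ℝ) × ℝ => z.1.1) E := by fun_prop
  have hb : ContDiffOn ℝ ∞ (fun z : (ℝ × Euc N × ℝ) × ℝ => z.2) E := by fun_prop
  have hLs : ContDiffOn ℝ ∞ L E := (hχE.add (hr.smul hνE)).add (hb.smul hwE)
  have hFs : ContDiffOn ℝ ∞ F E := (hφ.comp_contDiffOn hLs).sub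
    ((hφ.comp_contDiffOn hχE).add (hr.mul ((hgs.comp_contDiffOn hχE).inner ℝ hνE)))
  have hL0 : ∀ y t, L ((0, y, t), 0) = χ (y, t) := fun y t => by simp [L]
  have hF0 : ∀ y t, F ((0, y, t), 0) = 0 := fun y t => by simp [F, hL0]
  have hK : IsCompact (({0} : Set ℝ) ×ˢ B ×ˢ Icc 0 T) :=
    isCompact_singleton.prod (hB.prod isCompact_Icc)
  have hKD : ∀ q ∈ ({0} : Set ℝ) ×ˢ B ×ˢ Icc 0 T, q.2 ∈ D := fun q hq =>
    hSD ⟨hBS hq.2.1, hq.2.2⟩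
  -- Over `B` the contact angle gives `w = ∇φ`, so the equation for `β` has derivative `‖∇φ‖² > 0`
  -- in the unknown.
  have hφw : ∀ q ∈ ({0} : Set ℝ) ×ˢ B ×ˢ Icc 0 T, 0 < inner ℝ (gradient φ (χ q.2)) (w q.2) := by
    intro q hq
    obtain ⟨h1, h2⟩ := hφB q.2.1 hq.2.1 q.2.2 hq.2.2
    simp only [w]
    rw [h2, zero_smul, sub_zero, real_inner_self_eq_norm_sq]
    have := norm_pos_iff.2 h1
    positivity
  obtain ⟨V, β, O', hV, hKV, hβ, hβ0, hβV, hO', hKO', hO'u⟩ :=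
    exists_implicit_near_compact (f := F) (u := fun _ => 0) (O := E)
      (K := ({0} : Set ℝ) ×ˢ B ×ˢ Icc 0 T) hEo hFs hK continuousOn_const (fun q hq => hKD q hq)
    (by rintro ⟨r, y, t⟩ ⟨hr, -⟩; obtain rfl : r = 0 := hr; exact hF0 y t)
    (by
      rintro ⟨r, y, t⟩ hq e he
      obtain rfl : r = 0 := hq.1
      have h1 : HasDerivAt (fun a : ℝ => L ((0, y, t), a * e)) (e • w (y, t)) 0 := by
        have := ((((hasDerivAt_id (0 : ℝ)).mul_const e).smul_const (w (y, t))).const_add (χ (y, t)))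
        simpa [L] using this
      have h2 : HasDerivAt (fun a : ℝ => F ((0, y, t), a * e))
          (fderiv ℝ φ (χ (y, t)) (e • w (y, t))) 0 := by
        have h3 : HasFDerivAt φ (fderiv ℝ φ (χ (y, t))) (L ((0, y, t), (0 : ℝ) * e)) := by
          rw [zero_mul, hL0]; exact hφd _
        exact (h3.comp_hasDerivAt (0 : ℝ) h1).sub_const
          (φ (χ (y, t)) + 0 * inner ℝ (gradient φ (χ (y, t))) (ν (y, t)))
      have h3 : HasDerivAt (fun a : ℝ => (((0, y, t) : ℝ × Euc N × ℝ), a * e)) (0, e) 0 := by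
        have := (hasDerivAt_const (0 : ℝ) ((0, y, t) : ℝ × Euc N × ℝ)).prodMk
          ((hasDerivAt_id (0 : ℝ)).mul_const e)
        simpa using this
      have h4 : HasFDerivAt F (fderiv ℝ F ((0, y, t), 0)) ((0, y, t), (0 : ℝ) * e) := by
        rw [zero_mul]
        exact ContDiffOn.hasFDerivAt_of_mem hFs hEo (hKD _ hq)
      have h5 := (h4.comp_hasDerivAt (0 : ℝ) h3).unique
        (show HasDerivAt (F ∘ fun a : ℝ => (((0, y, t) : ℝ × Euc N × ℝ), a * e))
          (fderiv ℝ φ (χ (y, t)) (e • w (y, t))) 0 from h2)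
      rw [he, map_smul, ← inner_gradient, smul_eq_mul] at h5
      exact (mul_eq_zero.1 h5.symm).resolve_right (hφw _ hq).ne')
  -- the good region for `β`
  set V' : Set (ℝ × Euc N × ℝ) := (V ∩ {q | q.2 ∈ D}) ∩ ({q | (q, (0 : ℝ)) ∈ O'} ∩
    (({q | q.2 ∈ D}) ∩ (fun q => (inner ℝ (gradient φ (χ q.2)) (w q.2) : ℝ)) ⁻¹' {0}ᶜ)) with hV'
  have hDo : IsOpen {q : ℝ × Euc N × ℝ | q.2 ∈ D} := hD.preimage continuous_snd
  have hV'o : IsOpen V' := by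
    refine (hV.inter hDo).inter ((hO'.preimage (by fun_prop)).inter ?_)
    refine ContinuousOn.isOpen_inter_preimage ?_ hDo isOpen_compl_singleton
    exact (hgχ.inner ℝ hw).continuousOn.comp continuousOn_snd fun q hq => hq
  have hKV' : ({0} : Set ℝ) ×ˢ B ×ˢ Icc 0 T ⊆ V' := fun q hq =>
    ⟨⟨hKV hq, hKD q hq⟩, hKO' q hq, hKD q hq, (hφw q hq).ne'⟩
  -- The cutoff must live over points `y` for which `β` is defined at every `t ∈ [0, T]`. Then each
  -- `(0, s, t)` either lies in `V'` or has `s` outside the support, where no `β` is needed.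
  obtain ⟨u₀, u₁, -, hu₁, h0u₀, hBu₁, hu⟩ := generalized_tube_lemma isCompact_singleton
    (hB.prod isCompact_Icc) hV'o hKV'
  obtain ⟨uB, uT, huB, -, hBuB, hTuT, hu'⟩ := generalized_tube_lemma hB isCompact_Icc hu₁ hBu₁
  obtain ⟨η, M, C, hη, hM, hBM, hC, hMC, hCO, hη1, hη0⟩ := exists_cutoff hB (hO.inter huB)
    (subset_inter hBO hBuB)
  let X : ℝ × Euc N × ℝ → Euc N := fun q => χ q.2 + q.1 • ν q.2 + (η q.2.1 * β q) • w q.2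
  set G : Set (ℝ × Euc N × ℝ) := {q | q.2 ∈ D} ∩ (V' ∪ {q | q.2.1 ∉ C}) with hG
  have hCo : IsOpen {q : ℝ × Euc N × ℝ | q.2.1 ∉ C} :=
    hC.isOpen_compl.preimage (by fun_prop : Continuous fun q : ℝ × Euc N × ℝ => q.2.1)
  have hχ' : ContDiffOn ℝ ∞ (fun q : ℝ × Euc N × ℝ => χ q.2 + q.1 • ν q.2) {q | q.2 ∈ D} := by
    have h1 : ContDiffOn ℝ ∞ (fun q : ℝ × Euc N × ℝ => χ q.2) {q | q.2 ∈ D} :=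
      hχ.comp contDiffOn_snd fun q hq => hq
    have h2 : ContDiffOn ℝ ∞ (fun q : ℝ × Euc N × ℝ => ν q.2) {q | q.2 ∈ D} :=
      hν.comp contDiffOn_snd fun q hq => hq
    exact h1.add (contDiffOn_fst.smul h2)
  have hXC : ∀ q : ℝ × Euc N × ℝ, q.2.1 ∉ C → X q = χ q.2 + q.1 • ν q.2 := by
    intro q hq
    simp [X, hη0 _ hq]
  refine ⟨G, X, M, C, ?_⟩
  refine
    { isOpen_G := hDo.inter (hV'o.union hCo)
      mem_G := fun s hs t ht => ⟨hSD ⟨hs, ht⟩, ?_⟩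
      mem_D := fun q hq => hq.1
      smooth := ?_
      isOpen_M := hM
      subset_M := hBM
      isClosed_C := hC
      subset_O := fun y hy => (hCO hy).1
      zero := fun y t hq => ?_
      inner_eq := fun q hq => ?_
      eq := fun q _ => hXC q
      level := fun q hq hqM => ?_
      velocity := fun y t hq => ?_ }
  · by_cases hsC : s ∈ C
    · exact Or.inl (hu ⟨h0u₀ rfl, hu' ⟨(hCO hsC).2, hTuT ht⟩⟩)
    · exact Or.inr hsC
  · rintro q ⟨hqD, hq | hq⟩
    · refine ContDiffAt.contDiffWithinAt ?_
      have h1 := hχ'.contDiffAt (hDo.mem_nhds hqD)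
      have h2 : ContDiffAt ℝ ∞ (fun q : ℝ × Euc N × ℝ => w q.2) q :=
        (hw.contDiffAt (hD.mem_nhds hqD)).comp q contDiffAt_snd
      have h3 : ContDiffAt ℝ ∞ (fun q : ℝ × Euc N × ℝ => η q.2.1) q :=
        (hη.comp (contDiff_fst.comp contDiff_snd)).contDiffAt
      exact h1.add ((h3.mul (hβ.contDiffAt (hV.mem_nhds hq.1.1))).smul h2)
    · refine ContDiffAt.contDiffWithinAt ?_
      refine (hχ'.contDiffAt (hDo.mem_nhds hqD)).congr_of_eventuallyEq ?_
      filter_upwards [hCo.mem_nhds hq] with z hz using hXC z hz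
  · by_cases hyC : y ∈ C
    · have h1 : ((0, y, t) : ℝ × Euc N × ℝ) ∈ V' := hq.2.resolve_right fun h => h hyC
      have h2 : β (0, y, t) = 0 := (hO'u _ 0 h1.2.1 (hF0 y t)).2
      simp [X, h2]
    · rw [hXC _ hyC]; simp
  · have h1 : X q - χ q.2 = q.1 • ν q.2 + (η q.2.1 * β q) • w q.2 := by simp only [X]; abel
    rw [h1, inner_add_right, inner_smul_right, inner_smul_right, hνw _ hq.1,
      real_inner_self_eq_norm_sq, hνu _ hq.1]
    simp
  · have h1 : q ∈ V' := hq.2.resolve_right fun h => h (hMC hqM)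
    have h2 := (hβV q h1.1.1).2
    simp only [F, L, sub_eq_zero] at h2
    simp only [X, hη1 _ hqM, one_mul]
    rw [h2, inner_gradient]
  · have hcurve : HasDerivAt (fun ρ : ℝ => ((ρ, y, t) : ℝ × Euc N × ℝ)) (1, 0, 0) 0 :=
      (hasDerivAt_id (0 : ℝ)).prodMk (hasDerivAt_const (0 : ℝ) ((y, t) : Euc N × ℝ))
    have hGo : IsOpen G := hDo.inter (hV'o.union hCo)
    suffices hX : HasDerivAt (fun ρ : ℝ => X (ρ, y, t)) (ν (y, t)) 0 ∧
        DifferentiableAt ℝ X (0, y, t) from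
      (hX.2.hasFDerivAt.comp_hasDerivAt (0 : ℝ) hcurve).unique
        (show HasDerivAt (X ∘ fun ρ : ℝ => (ρ, y, t)) (ν (y, t)) 0 from hX.1)
    have hlin : HasDerivAt (fun ρ : ℝ => χ (y, t) + ρ • ν (y, t)) (ν (y, t)) 0 := by
      simpa using ((hasDerivAt_id (0 : ℝ)).smul_const (ν (y, t))).const_add (χ (y, t))
    by_cases hyC : y ∈ C
    · have h1 : ((0, y, t) : ℝ × Euc N × ℝ) ∈ V' := hq.2.resolve_right fun h => h hyC
      have hβd := ContDiffOn.hasFDerivAt_of_mem hβ hV h1.1.1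
      have hβc := hβd.comp_hasDerivAt (0 : ℝ) hcurve
      set b' := fderiv ℝ β (0, y, t) (1, 0, 0) with hb'
      have hβ00 : β (0, y, t) = 0 := (hO'u _ 0 h1.2.1 (hF0 y t)).2
      have hs : HasDerivAt (fun ρ : ℝ => χ (y, t) + ρ • ν (y, t) + β (ρ, y, t) • w (y, t))
          (ν (y, t) + b' • w (y, t)) 0 := hlin.add (hβc.smul_const (w (y, t)))
      have hφc : HasDerivAt (fun ρ : ℝ => φ (χ (y, t) + ρ • ν (y, t) + β (ρ, y, t) • w (y, t)))
          (fderiv ℝ φ (χ (y, t)) (ν (y, t) + b' • w (y, t))) 0 := by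
        have h3 : HasFDerivAt φ (fderiv ℝ φ (χ (y, t)))
            (χ (y, t) + (0 : ℝ) • ν (y, t) + β (0, y, t) • w (y, t)) := by
          rw [hβ00]; simpa using hφd (χ (y, t))
        exact h3.comp_hasDerivAt (0 : ℝ) hs
      have hφl : HasDerivAt (fun ρ : ℝ => φ (χ (y, t)) + ρ *
          inner ℝ (gradient φ (χ (y, t))) (ν (y, t)))
          (inner ℝ (gradient φ (χ (y, t))) (ν (y, t))) 0 := by
        simpa using ((hasDerivAt_id (0 : ℝ)).mul_const
          (inner ℝ (gradient φ (χ (y, t))) (ν (y, t)))).const_add (φ (χ (y, t)))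
      have hev : (fun ρ : ℝ => φ (χ (y, t) + ρ • ν (y, t) + β (ρ, y, t) • w (y, t))) =ᶠ[𝓝 0]
          (fun ρ : ℝ => φ (χ (y, t)) + ρ * inner ℝ (gradient φ (χ (y, t))) (ν (y, t))) := by
        filter_upwards [hcurve.continuousAt.preimage_mem_nhds (hV.mem_nhds h1.1.1)] with ρ hρ
        have := (hβV _ hρ).2
        simpa only [F, L, sub_eq_zero] using this
      -- Differentiating the affine law at `r = 0` gives `dφ(ν + b' w) = dφ(ν)`, and `∇φ·w ≠ 0` on
      -- `V'` forces `b' = 0`.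
      have h4 := hφc.unique (hφl.congr_of_eventuallyEq hev)
      rw [map_add, map_smul, ← inner_gradient, ← inner_gradient, add_eq_left, smul_eq_mul] at h4
      have hb0 : b' = 0 := (mul_eq_zero.1 h4).resolve_right h1.2.2.2
      have hηβ : HasDerivAt (fun ρ : ℝ => η y * β (ρ, y, t)) 0 0 := by
        have : HasDerivAt (fun ρ : ℝ => η y * β (ρ, y, t)) (η y * b') 0 := hβc.const_mul (η y)
        simpa [hb0] using this
      refine ⟨?_, ?_⟩
      · exact (hlin.fun_add (hηβ.smul_const (w (y, t)))).congr_deriv (by simp)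
      · have e1 := (hχ'.contDiffAt (hDo.mem_nhds hq.1)).differentiableAt (by simp)
        have e2 : DifferentiableAt ℝ (fun q : ℝ × Euc N × ℝ => w q.2) (0, y, t) :=
          ((hw.contDiffAt (hD.mem_nhds hq.1)).comp (0, y, t) contDiffAt_snd).differentiableAt
            (by simp)
        have e3 : DifferentiableAt ℝ (fun q : ℝ × Euc N × ℝ => η q.2.1) (0, y, t) :=
          ((hη.comp (contDiff_fst.comp contDiff_snd)).differentiable (by simp)).differentiableAt
        exact e1.add ((e3.mul hβd.differentiableAt).smul e2)
    · have hev : X =ᶠ[𝓝 (0, y, t)] fun q => χ q.2 + q.1 • ν q.2 := by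
        filter_upwards [hCo.mem_nhds (show ((0, y, t) : ℝ × Euc N × ℝ) ∈ {q | q.2.1 ∉ C} from hyC)]
          with z hz using hXC z hz
      refine ⟨?_, ((hχ'.contDiffAt (hDo.mem_nhds hq.1)).differentiableAt
        (by simp)).congr_of_eventuallyEq hev⟩
      refine hlin.congr_of_eventuallyEq (Eventually.of_forall fun ρ => hXC _ hyC)

/-! ### Inverse coordinates and their derivatives. -/

/-- `(r, s, pr_t)` is the inverse of `(X, pr_t)` on the part of `V` over the level set `{ψ = 0}`. -/
structure IsInverseCoord (ψ : Euc N → ℝ) (X : ℝ × Euc N × ℝ → Euc N) (V : Set (ℝ × Euc N × ℝ))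
    (Z : Set (Euc N × ℝ)) (r : Euc N × ℝ → ℝ) (s : Euc N × ℝ → Euc N) : Prop where
  level_smooth : ContDiff ℝ ∞ ψ
  isOpen_V : IsOpen V
  isOpen_Z : IsOpen Z
  smooth : ContDiffOn ℝ ∞ X V
  smooth_r : ContDiffOn ℝ ∞ r Z
  smooth_s : ContDiffOn ℝ ∞ s Z
  right_inv : ∀ y ∈ Z, (r y, s y, y.2) ∈ V ∧ ψ (s y) = 0 ∧ X (r y, s y, y.2) = y.1
  left_inv : ∀ q ∈ V, ψ q.2.1 = 0 →
    (X q, q.2.2) ∈ Z ∧ r (X q, q.2.2) = q.1 ∧ s (X q, q.2.2) = q.2.1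
  injective : ∀ q ∈ V, ∀ ρ v, fderiv ℝ ψ q.2.1 v = 0 → fderiv ℝ X q (ρ, v, 0) = 0 → ρ = 0 ∧ v = 0

/-- Since `s` is an ambient variable, `(X, t)` has one unknown too many; adjoining `ψ` as a further
component makes the system square. Fixing that component to `0` in the inverse puts `s` back on the
level set. -/
theorem exists_inverse_coord {ψ : Euc N → ℝ} {X : ℝ × Euc N × ℝ → Euc N}
    {G K : Set (ℝ × Euc N × ℝ)} (hψ : ContDiff ℝ ∞ ψ) (hG : IsOpen G) (hX : ContDiffOn ℝ ∞ X G)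
    (hK : IsCompact K) (hKG : K ⊆ G)
    (hinj : InjOn (fun q => (X q, q.2.2)) K)
    (hd : ∀ q ∈ K, ∀ ρ v, fderiv ℝ ψ q.2.1 v = 0 → fderiv ℝ X q (ρ, v, 0) = 0 → ρ = 0 ∧ v = 0) :
    ∃ V Z r s, IsInverseCoord ψ X V Z r s ∧ K ⊆ V ∧ V ⊆ G := by
  let Ψ : ℝ × Euc N × ℝ → (Euc N × ℝ) × ℝ := fun q => ((X q, q.2.2), ψ q.2.1)
  have hp1 : ContDiff ℝ ∞ (fun q : ℝ × Euc N × ℝ => q.2.2) := by fun_prop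
  have hp2 : ContDiff ℝ ∞ (fun q : ℝ × Euc N × ℝ => q.2.1) := by fun_prop
  have hΨ : ContDiffOn ℝ ∞ Ψ G :=
    (hX.prodMk hp1.contDiffOn).prodMk (hψ.comp hp2).contDiffOn
  have hΨd : ∀ q ∈ G, ∀ h, fderiv ℝ Ψ q h = ((fderiv ℝ X q h, h.2.2), fderiv ℝ ψ q.2.1 h.2.1) := by
    intro q hq h
    have h1 : HasFDerivAt (fun q : ℝ × Euc N × ℝ => q.2.2)
        ((ContinuousLinearMap.snd ℝ (Euc N) ℝ).comp (ContinuousLinearMap.snd ℝ ℝ (Euc N × ℝ))) q :=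
      ((ContinuousLinearMap.snd ℝ (Euc N) ℝ).comp
        (ContinuousLinearMap.snd ℝ ℝ (Euc N × ℝ))).hasFDerivAt
    have h2 : HasFDerivAt (fun q : ℝ × Euc N × ℝ => q.2.1)
        ((ContinuousLinearMap.fst ℝ (Euc N) ℝ).comp (ContinuousLinearMap.snd ℝ ℝ (Euc N × ℝ))) q :=
      ((ContinuousLinearMap.fst ℝ (Euc N) ℝ).comp
        (ContinuousLinearMap.snd ℝ ℝ (Euc N × ℝ))).hasFDerivAt
    have h3 : HasFDerivAt ψ (fderiv ℝ ψ q.2.1) q.2.1 :=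
      (hψ.differentiable (by simp)).differentiableAt.hasFDerivAt
    have h4 : HasFDerivAt Ψ _ q :=
      ((ContDiffOn.hasFDerivAt_of_mem hX hG hq).prodMk h1).prodMk (h3.comp q h2)
    rw [h4.fderiv]
    simp
  obtain ⟨V, g, hV, hKV, hVG, hgl, hio, hgs, hVd⟩ := exists_inverse_near_compact hG hΨ hK hKG
    (fun a ha b hb hab => hinj ha hb (congrArg Prod.fst hab)) (by simp; ring)
    (fun q hq => by
      rw [injective_iff_map_eq_zero]
      rintro ⟨ρ, v, θ⟩ h0
      rw [hΨd q (hKG hq)] at h0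
      simp only [Prod.mk_eq_zero] at h0
      obtain ⟨⟨h1, rfl⟩, h2⟩ := h0
      obtain ⟨rfl, rfl⟩ := hd q hq ρ v h2 h1
      rfl)
  have hgz : ∀ q ∈ V, ψ q.2.1 = 0 → g ((X q, q.2.2), 0) = q := by
    intro q hq h0
    have h1 := hgl hq
    simpa only [Ψ, h0] using h1
  have hZmem : ∀ y : Euc N × ℝ, (y, (0 : ℝ)) ∈ Ψ '' V → ∃ q ∈ V, ψ q.2.1 = 0 ∧ (X q, q.2.2) = y := by
    rintro y ⟨q, hq, hqe⟩
    exact ⟨q, hq, congrArg Prod.snd hqe, congrArg Prod.fst hqe⟩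
  refine ⟨V, (fun y => (y, (0 : ℝ))) ⁻¹' (Ψ '' V), fun y => (g (y, 0)).1, fun y => (g (y, 0)).2.1,
    ?_, hKV, hVG⟩
  have hgs' : ContDiffOn ℝ ∞ (fun y : Euc N × ℝ => g (y, 0)) ((fun y => (y, (0 : ℝ))) ⁻¹' (Ψ '' V)) :=
    hgs.comp (by fun_prop) (mapsTo_preimage _ _)
  exact
    { level_smooth := hψ
      isOpen_V := hV
      isOpen_Z := hio.preimage (by fun_prop)
      smooth := hX.mono hVG
      smooth_r := contDiff_fst.comp_contDiffOn hgs'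
      smooth_s := (contDiff_fst.comp contDiff_snd).comp_contDiffOn hgs'
      right_inv := by
        intro y hy
        obtain ⟨q, hq, h0, rfl⟩ := hZmem y hy
        simp only [hgz q hq h0]
        exact ⟨hq, h0, trivial⟩
      left_inv := by
        intro q hq h0
        refine ⟨⟨q, hq, by simp [Ψ, h0]⟩, ?_, ?_⟩ <;> simp only [hgz q hq h0]
      injective := by
        intro q hq ρ v h1 h2
        have := (injective_iff_map_eq_zero (fderiv ℝ Ψ q)).1 (hVd q hq) (ρ, v, 0) (by
          rw [hΨd q (hVG hq)]
          simp [h1, h2])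
        simpa using this }

namespace IsInverseCoord

variable {ψ : Euc N → ℝ} {X : ℝ × Euc N × ℝ → Euc N} {V : Set (ℝ × Euc N × ℝ)}
  {Z : Set (Euc N × ℝ)} {r : Euc N × ℝ → ℝ} {s : Euc N × ℝ → Euc N}

theorem fderiv_level (h : IsInverseCoord ψ X V Z r s) {y : Euc N × ℝ} (hy : y ∈ Z)
    (k : Euc N × ℝ) : fderiv ℝ ψ (s y) (fderiv ℝ s y k) = 0 := by
  have h1 : HasFDerivAt ψ (fderiv ℝ ψ (s y)) (s y) :=
    (h.level_smooth.differentiable (by simp)).differentiableAt.hasFDerivAt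
  have h2 := h1.comp y (ContDiffOn.hasFDerivAt_of_mem h.smooth_s h.isOpen_Z hy)
  have h3 : (ψ ∘ s) =ᶠ[𝓝 y] fun _ => 0 := by
    filter_upwards [h.isOpen_Z.mem_nhds hy] with z hz using (h.right_inv z hz).2.1
  have h4 := h2.unique ((hasFDerivAt_const (0 : ℝ) y).congr_of_eventuallyEq h3)
  exact congrArg (fun A => A k) h4

theorem fderiv_right_inv (h : IsInverseCoord ψ X V Z r s) {y : Euc N × ℝ} (hy : y ∈ Z)
    (k : Euc N × ℝ) :
    fderiv ℝ X (r y, s y, y.2) (fderiv ℝ r y k, fderiv ℝ s y k, k.2) = k.1 := by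
  have h1 := ContDiffOn.hasFDerivAt_of_mem h.smooth h.isOpen_V (h.right_inv y hy).1
  have h2 : HasFDerivAt (fun y => (r y, s y, y.2)) _ y :=
    (ContDiffOn.hasFDerivAt_of_mem h.smooth_r h.isOpen_Z hy).prodMk
      ((ContDiffOn.hasFDerivAt_of_mem h.smooth_s h.isOpen_Z hy).prodMk hasFDerivAt_snd)
  have h3 := h1.comp y h2
  have h4 : (X ∘ fun y => (r y, s y, y.2)) =ᶠ[𝓝 y] Prod.fst := by
    filter_upwards [h.isOpen_Z.mem_nhds hy] with z hz using (h.right_inv z hz).2.2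
  have h5 := h3.unique (hasFDerivAt_fst.congr_of_eventuallyEq h4)
  simpa using congrArg (fun A => A k) h5

/-- The left inverse identity holds only over the level set and cannot be differentiated freely.
Instead, the right inverse identity is compared with the given direction, using injectivity of `DX`
on tangential vectors. -/
theorem fderiv_left_inv (h : IsInverseCoord ψ X V Z r s) {q : ℝ × Euc N × ℝ} (hq : q ∈ V)
    (h0 : ψ q.2.1 = 0) (ρ : ℝ) {v : Euc N} (hv : fderiv ℝ ψ q.2.1 v = 0) (θ : ℝ) :
    fderiv ℝ r (X q, q.2.2) (fderiv ℝ X q (ρ, v, θ), θ) = ρ ∧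
      fderiv ℝ s (X q, q.2.2) (fderiv ℝ X q (ρ, v, θ), θ) = v := by
  obtain ⟨hy, hr, hs⟩ := h.left_inv q hq h0
  set y : Euc N × ℝ := (X q, q.2.2) with hydef
  set k : Euc N × ℝ := (fderiv ℝ X q (ρ, v, θ), θ) with hk
  have hqe : ((r y, s y, y.2) : ℝ × Euc N × ℝ) = q := by rw [hr, hs]
  have h1 := h.fderiv_right_inv hy k
  have h2 := h.fderiv_level hy k
  rw [hqe] at h1
  rw [hs] at h2
  have h3 := h.injective q hq (fderiv ℝ r y k - ρ) (fderiv ℝ s y k - v)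
    (by rw [map_sub, h2, hv, sub_zero]) (by
      have : ((fderiv ℝ r y k - ρ, fderiv ℝ s y k - v, 0) : ℝ × Euc N × ℝ) =
          (fderiv ℝ r y k, fderiv ℝ s y k, k.2) - (ρ, v, θ) := by simp [hk]
      rw [this, map_sub, h1, hk, sub_self])
  exact ⟨sub_eq_zero.1 h3.1, sub_eq_zero.1 h3.2⟩

theorem hasFDerivAt_slice_r (h : IsInverseCoord ψ X V Z r s) {y : Euc N × ℝ} (hy : y ∈ Z) :
    HasFDerivAt (fun x => r (x, y.2))
      ((fderiv ℝ r y).comp (ContinuousLinearMap.inl ℝ (Euc N) ℝ)) y.1 :=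
  HasFDerivAt.comp (g := r) (f := fun x => (x, y.2)) y.1
    (ContDiffOn.hasFDerivAt_of_mem h.smooth_r h.isOpen_Z hy) (hasFDerivAt_prodMk_left y.1 y.2)

theorem hasFDerivAt_slice_s (h : IsInverseCoord ψ X V Z r s) {y : Euc N × ℝ} (hy : y ∈ Z) :
    HasFDerivAt (fun x => s (x, y.2))
      ((fderiv ℝ s y).comp (ContinuousLinearMap.inl ℝ (Euc N) ℝ)) y.1 :=
  HasFDerivAt.comp (g := s) (f := fun x => (x, y.2)) y.1
    (ContDiffOn.hasFDerivAt_of_mem h.smooth_s h.isOpen_Z hy) (hasFDerivAt_prodMk_left y.1 y.2)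

theorem inner_gradX (h : IsInverseCoord ψ X V Z r s) {y : Euc N × ℝ} (hy : y ∈ Z) (k : Euc N) :
    inner ℝ (gradX r y) k = fderiv ℝ r y (k, 0) := by
  rw [gradX, inner_gradient, (h.hasFDerivAt_slice_r hy).fderiv]
  simp

theorem DX_apply (h : IsInverseCoord ψ X V Z r s) {y : Euc N × ℝ} (hy : y ∈ Z) (k : Euc N) :
    DX s y k = fderiv ℝ s y (k, 0) := by
  rw [DX, (h.hasFDerivAt_slice_s hy).fderiv]
  simp

theorem fderiv_X_eq (h : IsInverseCoord ψ X V Z r s) {q : ℝ × Euc N × ℝ} (hq : q ∈ V)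
    (h0 : ψ q.2.1 = 0) (k : Euc N) :
    fderiv ℝ X q (inner ℝ (gradX r (X q, q.2.2)) k, DX s (X q, q.2.2) k, 0) = k := by
  obtain ⟨hy, hr, hs⟩ := h.left_inv q hq h0
  have := h.fderiv_right_inv hy (k, 0)
  rw [hr, hs] at this
  rw [h.inner_gradX hy, h.DX_apply hy]
  exact this

theorem inner_gradX_fderiv (h : IsInverseCoord ψ X V Z r s) {q : ℝ × Euc N × ℝ} (hq : q ∈ V)
    (h0 : ψ q.2.1 = 0) (ρ : ℝ) {v : Euc N} (hv : fderiv ℝ ψ q.2.1 v = 0) :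
    inner ℝ (gradX r (X q, q.2.2)) (fderiv ℝ X q (ρ, v, 0)) = ρ := by
  rw [h.inner_gradX (h.left_inv q hq h0).1]
  exact (h.fderiv_left_inv hq h0 ρ hv 0).1

theorem DX_fderiv (h : IsInverseCoord ψ X V Z r s) {q : ℝ × Euc N × ℝ} (hq : q ∈ V)
    (h0 : ψ q.2.1 = 0) (ρ : ℝ) {v : Euc N} (hv : fderiv ℝ ψ q.2.1 v = 0) :
    DX s (X q, q.2.2) (fderiv ℝ X q (ρ, v, 0)) = v := by
  rw [h.DX_apply (h.left_inv q hq h0).1]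
  exact (h.fderiv_left_inv hq h0 ρ hv 0).2

theorem fderiv_level_DX (h : IsInverseCoord ψ X V Z r s) {y : Euc N × ℝ} (hy : y ∈ Z) (k : Euc N) :
    fderiv ℝ ψ (s y) (DX s y k) = 0 := by
  rw [h.DX_apply hy]
  exact h.fderiv_level hy _

/-- Where the `r`-curves have unit velocity orthogonal to the slices, `∇r` is this velocity. -/
theorem gradX_eq (h : IsInverseCoord ψ X V Z r s) {q : ℝ × Euc N × ℝ} (hq : q ∈ V)
    (h0 : ψ q.2.1 = 0) {n : Euc N} (hn : ‖n‖ = 1) (hnX : fderiv ℝ X q (1, 0, 0) = n)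
    (horth : ∀ v, fderiv ℝ ψ q.2.1 v = 0 → inner ℝ n (fderiv ℝ X q (0, v, 0)) = 0) :
    gradX r (X q, q.2.2) = n ∧ DX s (X q, q.2.2) n = 0 := by
  have hy := (h.left_inv q hq h0).1
  have hs := (h.left_inv q hq h0).2.2
  constructor
  · refine ext_inner_right ℝ fun k => ?_
    -- Writing `k` in the coordinate frame, its tangential part is orthogonal to `n`, so `n·k`
    -- equals the `r`-component `∇r·k`.
    nth_rw 2 [← h.fderiv_X_eq hq h0 k]
    set a := inner ℝ (gradX r (X q, q.2.2)) k
    set v := DX s (X q, q.2.2) k with hv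
    have h1 : ((a, v, 0) : ℝ × Euc N × ℝ) = a • (1, 0, 0) + (0, v, 0) := by simp
    have h2 : fderiv ℝ ψ q.2.1 v = 0 := by
      have := h.fderiv_level_DX hy k
      rwa [hs] at this
    rw [h1, map_add, map_smul, hnX, inner_add_right, inner_smul_right, horth v h2,
      real_inner_self_eq_norm_sq, hn]
    simp
  · have := h.DX_fderiv hq h0 1 (v := 0) (map_zero _)
    rwa [hnX] at this

theorem span_range_DX (h : IsInverseCoord ψ X V Z r s) {y : Euc N × ℝ} (hy : y ∈ Z) (v : Euc N) :
    v ∈ Submodule.span ℝ (range fun j => DX s y (EuclideanSpace.single j 1)) ↔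
      fderiv ℝ ψ (s y) v = 0 := by
  have hspan : Submodule.span ℝ (range fun j => DX s y (EuclideanSpace.single j 1)) =
      LinearMap.range (DX s y : Euc N →ₗ[ℝ] Euc N) := by
    have h1 := (EuclideanSpace.basisFun (Fin N) ℝ).toBasis.span_eq
    rw [← Submodule.map_top, ← h1, Submodule.map_span, ← range_comp]
    congr 2
    ext j
    simp
  rw [hspan, LinearMap.mem_range]
  constructor
  · rintro ⟨k, rfl⟩
    exact h.fderiv_level_DX hy k
  · intro hv
    obtain ⟨hq, h0, hX⟩ := h.right_inv y hy
    have := h.DX_fderiv hq h0 0 hv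
    simp only [hX] at this
    exact ⟨_, this⟩

theorem gradX_ne_zero (h : IsInverseCoord ψ X V Z r s) {y : Euc N × ℝ} (hy : y ∈ Z) :
    gradX r y ≠ 0 := by
  intro hc
  obtain ⟨hq, h0, hX⟩ := h.right_inv y hy
  have := h.inner_gradX_fderiv hq h0 1 (v := 0) (map_zero _)
  simp only [hX, Prod.mk.eta] at this
  rw [hc] at this
  simp at this

theorem contDiffOn_gradX (h : IsInverseCoord ψ X V Z r s) : ContDiffOn ℝ ∞ (gradX r) Z := by
  have h1 : ContDiffOn ℝ ∞ (fun y => (InnerProductSpace.toDual ℝ (Euc N)).symm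
      ((fderiv ℝ r y).comp (ContinuousLinearMap.inl ℝ (Euc N) ℝ))) Z :=
    (InnerProductSpace.toDual ℝ (Euc N)).symm.contDiff.comp_contDiffOn
      ((h.smooth_r.fderiv_of_isOpen h.isOpen_Z (by simp)).clm_comp contDiffOn_const)
  refine h1.congr fun y hy => ?_
  rw [gradX, gradient, (h.hasFDerivAt_slice_r hy).fderiv]

theorem continuousOn_DX (h : IsInverseCoord ψ X V Z r s) : ContinuousOn (DX s) Z := by
  have h1 : ContDiffOn ℝ ∞ (fun y => (fderiv ℝ s y).comp (ContinuousLinearMap.inl ℝ (Euc N) ℝ)) Z :=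
    (h.smooth_s.fderiv_of_isOpen h.isOpen_Z (by simp)).clm_comp contDiffOn_const
  refine h1.continuousOn.congr fun y hy => ?_
  rw [DX, (h.hasFDerivAt_slice_s hy).fderiv]

theorem exists_le_norm_gradX (h : IsInverseCoord ψ X V Z r s) {K : Set (Euc N × ℝ)}
    (hK : IsCompact K) (hKZ : K ⊆ Z) : ∃ c > 0, ∀ y ∈ K, c ≤ ‖gradX r y‖ := by
  rcases K.eq_empty_or_nonempty with rfl | hne
  · exact ⟨1, one_pos, by simp⟩
  obtain ⟨y, hy, hmin⟩ := hK.exists_isMinOn hne ((h.contDiffOn_gradX.continuousOn.mono hKZ).norm)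
  exact ⟨_, norm_pos_iff.2 (h.gradX_ne_zero (hKZ hy)), fun z hz => hmin hz⟩

/-- Uniform positivity of `D_x s (D_x s)ᵀ` on the tangent spaces. -/
theorem exists_le_inner_DX_adjoint (h : IsInverseCoord ψ X V Z r s) {K : Set (Euc N × ℝ)}
    (hK : IsCompact K) (hKZ : K ⊆ Z) :
    ∃ c > 0, ∀ y ∈ K, ∀ v, fderiv ℝ ψ (s y) v = 0 →
      c * ‖v‖ ^ 2 ≤ inner ℝ (DX s y (ContinuousLinearMap.adjoint (DX s y) v)) v := by
  let f : (Euc N × ℝ) × Euc N → ℝ := fun z => ‖ContinuousLinearMap.adjoint (DX s z.1) z.2‖ ^ 2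
  have hin : ∀ y v, inner ℝ (DX s y (ContinuousLinearMap.adjoint (DX s y) v)) v = f (y, v) := by
    intro y v
    rw [← ContinuousLinearMap.adjoint_inner_right, real_inner_self_eq_norm_sq]
  have hf : ContinuousOn f (K ×ˢ (univ : Set (Euc N))) := by
    have h1 : ContinuousOn (fun z : (Euc N × ℝ) × Euc N => ContinuousLinearMap.adjoint (DX s z.1))
        (K ×ˢ univ) :=
      (ContinuousLinearMap.adjoint (𝕜 := ℝ) (E := Euc N) (F := Euc N)).continuous.comp_continuousOn
        ((h.continuousOn_DX.mono hKZ).comp continuousOn_fst fun z hz => hz.1)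
    exact (h1.clm_apply continuousOn_snd).norm.pow 2
  -- The quadratic form `‖(D_x s)ᵀ v‖²` is minimised over unit tangent vectors. It has no zero
  -- there: `(D_x s)ᵀ v = 0` makes `v` orthogonal to the range of `D_x s`, which contains `v`.
  let K' : Set ((Euc N × ℝ) × Euc N) :=
    (K ×ˢ Metric.sphere (0 : Euc N) 1) ∩ {z | fderiv ℝ ψ (s z.1) z.2 = 0}
  have hK' : IsCompact K' := by
    have hc : IsCompact (K ×ˢ Metric.sphere (0 : Euc N) 1) := hK.prod (isCompact_sphere 0 1)
    have hg : ContinuousOn (fun z : (Euc N × ℝ) × Euc N => fderiv ℝ ψ (s z.1) z.2)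
        (K ×ˢ Metric.sphere (0 : Euc N) 1) := by
      refine ContinuousOn.clm_apply ?_ continuousOn_snd
      exact (h.level_smooth.continuous_fderiv (by simp)).comp_continuousOn
        ((h.smooth_s.continuousOn.mono hKZ).comp continuousOn_fst fun z hz => hz.1)
    have hcl := hg.preimage_isClosed_of_isClosed hc.isClosed (isClosed_singleton (x := (0 : ℝ)))
    exact hc.of_isClosed_subset hcl inter_subset_left
  have hpos : ∀ z ∈ K', 0 < f z := by
    rintro ⟨y, v⟩ ⟨⟨hy, hv1⟩, hv⟩
    have hne : ContinuousLinearMap.adjoint (DX s y) v ≠ 0 := by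
      intro h0
      have h2 := (h.span_range_DX (hKZ hy) v).2 hv
      have h3 : Submodule.span ℝ (range fun j => DX s y (EuclideanSpace.single j 1)) ≤ (ℝ ∙ v)ᗮ := by
        rw [Submodule.span_le]
        rintro _ ⟨j, rfl⟩
        rw [SetLike.mem_coe, Submodule.mem_orthogonal_singleton_iff_inner_right]
        rw [← ContinuousLinearMap.adjoint_inner_left, h0, inner_zero_left]
      have h4 := Submodule.mem_orthogonal_singleton_iff_inner_right.1 (h3 h2)
      rw [inner_self_eq_zero] at h4
      rw [h4] at hv1
      simp at hv1
    have := norm_pos_iff.2 hne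
    simp only [f]
    positivity
  obtain ⟨c, hc, hcle⟩ : ∃ c > 0, ∀ z ∈ K', c ≤ f z := by
    rcases K'.eq_empty_or_nonempty with he | hne
    · exact ⟨1, one_pos, by simp [he]⟩
    obtain ⟨z, hz, hmin⟩ := hK'.exists_isMinOn hne
      (hf.mono fun z hz => ⟨hz.1.1, mem_univ _⟩)
    exact ⟨_, hpos z hz, fun z' hz' => hmin hz'⟩
  refine ⟨c, hc, fun y hy v hv => ?_⟩
  rw [hin]
  by_cases hv0 : v = 0
  · simp [hv0, f]
  have hnv : ‖v‖ ≠ 0 := norm_ne_zero_iff.2 hv0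
  have h1 := hcle (y, ‖v‖⁻¹ • v) ⟨⟨hy, by simp [norm_smul, hnv]⟩, by
    show fderiv ℝ ψ (s y) (‖v‖⁻¹ • v) = 0
    rw [map_smul, hv, smul_zero]⟩
  have h2 : f (y, ‖v‖⁻¹ • v) = (‖v‖⁻¹) ^ 2 * f (y, v) := by
    simp only [f]
    rw [map_smul, norm_smul, mul_pow, norm_inv, norm_norm]
  rw [h2] at h1
  calc c * ‖v‖ ^ 2 ≤ (‖v‖⁻¹) ^ 2 * f (y, v) * ‖v‖ ^ 2 := by gcongr
    _ = f (y, v) := by field_simp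

end IsInverseCoord

/-! ### Tangent spaces of the evolving hypersurface. -/

section Ambient

variable {S S' U : Set (Euc N)} {T : ℝ} {X₀ n χ ν : Euc N × ℝ → Euc N} {ψ : Euc N → ℝ}
  {D : Set (Euc N × ℝ)}

namespace IsAmbientExtension

theorem hasFDerivAt (h : IsAmbientExtension S S' T X₀ n ψ U D χ ν) {q : Euc N × ℝ} (hq : q ∈ D) :
    HasFDerivAt χ (fderiv ℝ χ q) q := ContDiffOn.hasFDerivAt_of_mem h.smooth h.isOpen_D hq

theorem level_zero (h : IsAmbientExtension S S' T X₀ n ψ U D χ ν) {s : Euc N} (hs : s ∈ S) :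
    ψ s = 0 := h.level_eq_zero s (h.subset hs)

theorem mem_D (h : IsAmbientExtension S S' T X₀ n ψ U D χ ν) {s : Euc N} (hs : s ∈ S) {t : ℝ}
    (ht : t ∈ Icc 0 T) : (s, t) ∈ D := h.subset_D ⟨hs, ht⟩

theorem eq_of_mem (h : IsAmbientExtension S S' T X₀ n ψ U D χ ν) {s : Euc N} (hs : s ∈ S) {t : ℝ}
    (ht : t ∈ Icc 0 T) : χ (s, t) = X₀ (s, t) := h.eq _ (h.mem_D hs ht) (h.level_zero hs)

theorem hasFDerivWithinAt_slice (h : IsAmbientExtension S S' T X₀ n ψ U D χ ν) {s : Euc N}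
    (hs : s ∈ S) {t : ℝ} (ht : t ∈ Icc 0 T) : HasFDerivWithinAt (fun s' => X₀ (s', t))
      ((fderiv ℝ χ (s, t)).comp (ContinuousLinearMap.inl ℝ (Euc N) ℝ)) S s := by
  have h1 : HasFDerivAt (fun s' => χ (s', t))
      ((fderiv ℝ χ (s, t)).comp (ContinuousLinearMap.inl ℝ (Euc N) ℝ)) s :=
    HasFDerivAt.comp (g := χ) (f := fun s' : Euc N => (s', t)) s (h.hasFDerivAt (h.mem_D hs ht))
      (hasFDerivAt_prodMk_left s t)
  exact h1.hasFDerivWithinAt.congr (fun y hy => (h.eq_of_mem hy ht).symm) (h.eq_of_mem hs ht).symm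

theorem hasDerivWithinAt_time (h : IsAmbientExtension S S' T X₀ n ψ U D χ ν) {s : Euc N}
    (hs : s ∈ S) {t : ℝ} (ht : t ∈ Icc 0 T) : HasDerivWithinAt (fun t' => X₀ (s, t'))
      (fderiv ℝ χ (s, t) (0, 1)) (Icc 0 T) t := by
  have h1 : HasDerivAt (fun t' => χ (s, t')) (fderiv ℝ χ (s, t) (0, 1)) t :=
    HasFDerivAt.comp_hasDerivAt (f := fun t' : ℝ => (s, t')) t (h.hasFDerivAt (h.mem_D hs ht))
      ((hasDerivAt_const t s).prodMk (hasDerivAt_id t))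
  exact h1.hasDerivWithinAt.congr (fun y hy => (h.eq_of_mem hs hy).symm) (h.eq_of_mem hs ht).symm

/-- The tangent space of the evolving hypersurface is the orthogonal complement of the normal. -/
theorem tangentSpace_slice (h : IsAmbientExtension S S' T X₀ n ψ U D χ ν)
    (hS : IsHypersurfaceWithBoundary S) {s : Euc N} (hs : s ∈ S) {t : ℝ} (ht : t ∈ Icc 0 T)
    (hn_normal : n (s, t) ∈ (tangentSpace (slice X₀ S t) (X₀ (s, t)))ᗮ) :
    tangentSpace (slice X₀ S t) (X₀ (s, t)) = (ℝ ∙ n (s, t))ᗮ := by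
  refine le_antisymm ?_ fun u hu => ?_
  · exact Submodule.le_orthogonal_iff_le_orthogonal.2
      ((Submodule.span_singleton_le_iff_mem _ _).2 hn_normal)
  rw [Submodule.mem_orthogonal_singleton_iff_inner_right] at hu
  have hν := h.normal_eq s hs t ht
  -- A vector orthogonal to the normal has `ρ = 0`, hence is the image of a tangent vector of `S`.
  obtain ⟨ρ, v, hv, huv⟩ := exists_decomposition
    (A := (fderiv ℝ χ (s, t)).comp (ContinuousLinearMap.inl ℝ (Euc N) ℝ)) (h.level_fderiv s hs)
    (h.normal_unit _ (h.mem_D hs ht)) (fun v hv h0 => h.immersion s hs t ht v hv (by simpa using h0))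
    (fun v => by simpa using h.orthogonal s hs t ht v) u
  have hρ : ρ = 0 := by
    have h1 : inner ℝ (ν (s, t)) u = ρ := by
      rw [huv, inner_add_right, inner_smul_right, real_inner_self_eq_norm_sq,
        h.normal_unit _ (h.mem_D hs ht)]
      have := h.orthogonal s hs t ht v
      simp [this]
    rw [hν, hu] at h1
    exact h1.symm
  have hvT : v ∈ tangentSpace S s := (hS.mem_tangentSpace_iff hs h.level_smooth
    (fun y hy => h.level_zero hy) (h.level_fderiv s hs) v).2 hv
  have h3 : tangentSpace S s ≤ (tangentSpace (slice X₀ S t) (X₀ (s, t))).comap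
      (((fderiv ℝ χ (s, t)).comp (ContinuousLinearMap.inl ℝ (Euc N) ℝ) :
        Euc N →L[ℝ] Euc N) : Euc N →ₗ[ℝ] Euc N) :=
    Submodule.span_le.2 fun u hu => Submodule.subset_span
      ((h.hasFDerivWithinAt_slice hs ht).mapsTo_tangent_cone hu)
  rw [huv, hρ, zero_smul, zero_add]
  exact h3 hvT

end IsAmbientExtension

end Ambient

/-! ### Gradient, normal velocity and mean curvature on the track. -/

section Track

variable {S S' U B O M C : Set (Euc N)} {T : ℝ} {X₀ n χ ν : Euc N × ℝ → Euc N} {ψ φ : Euc N → ℝ}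
  {D Z : Set (Euc N × ℝ)} {X : ℝ × Euc N × ℝ → Euc N} {G V : Set (ℝ × Euc N × ℝ)}
  {r : Euc N × ℝ → ℝ} {s : Euc N × ℝ → Euc N}

theorem IsCoordinateMap.fderiv_slice (hC : IsCoordinateMap S B O T D χ ν φ G X M C) (hD : IsOpen D)
    (hχ : ContDiffOn ℝ ∞ χ D) {y : Euc N} {t : ℝ} (hq : (0, y, t) ∈ G) (k : Euc N × ℝ) :
    fderiv ℝ X (0, y, t) (0, k) = fderiv ℝ χ (y, t) k := by
  have h1 := ContDiffOn.hasFDerivAt_of_mem hC.smooth hC.isOpen_G hq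
  have h2 : HasFDerivAt (fun z : Euc N × ℝ => X (0, z)) _ (y, t) :=
    HasFDerivAt.comp (g := X) (f := fun z : Euc N × ℝ => ((0 : ℝ), z)) (y, t) h1
      (hasFDerivAt_prodMk_right 0 (y, t))
  have h3 := ContDiffOn.hasFDerivAt_of_mem hχ hD (hC.mem_D _ hq)
  have h4 : (fun z : Euc N × ℝ => X (0, z)) =ᶠ[𝓝 (y, t)] χ := by
    have : Continuous fun z : Euc N × ℝ => ((0 : ℝ), z) := by fun_prop
    filter_upwards [(hC.isOpen_G.preimage this).mem_nhds hq] with z hz using hC.zero z.1 z.2 hz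
  have h5 := h2.unique (h3.congr_of_eventuallyEq h4)
  simpa using congrArg (fun A => A k) h5

theorem hasDerivAt_line (ρ : ℝ) (z : Euc N × ℝ) :
    HasDerivAt (fun ρ : ℝ => ((ρ, z) : ℝ × Euc N × ℝ)) (1, 0, 0) ρ :=
  (hasDerivAt_id ρ).prodMk (hasDerivAt_const ρ z)

/-- Differentiate `inner_eq` in `r`. Validity for all `r`, not only at `0`, later kills the normal
component of the acceleration. -/
theorem IsCoordinateMap.inner_velocity (hC : IsCoordinateMap S B O T D χ ν φ G X M C)
    {q : ℝ × Euc N × ℝ} (hq : q ∈ G) : inner ℝ (ν q.2) (fderiv ℝ X q (1, 0, 0)) = 1 := by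
  obtain ⟨ρ, z⟩ := q
  have h1 : HasDerivAt (fun ρ : ℝ => X (ρ, z)) (fderiv ℝ X (ρ, z) (1, 0, 0)) ρ :=
    HasFDerivAt.comp_hasDerivAt (f := fun ρ : ℝ => (ρ, z)) ρ
      (ContDiffOn.hasFDerivAt_of_mem hC.smooth hC.isOpen_G hq) (hasDerivAt_line ρ z)
  have h2 := (hasDerivAt_const ρ (ν z)).inner ℝ (h1.sub_const (χ z))
  have h3 : (fun ρ : ℝ => inner ℝ (ν z) (X (ρ, z) - χ z)) =ᶠ[𝓝 ρ] id := by
    filter_upwards [(hasDerivAt_line ρ z).continuousAt.preimage_mem_nhds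
      (hC.isOpen_G.mem_nhds hq)] with a ha using hC.inner_eq _ ha
  have h4 := h2.unique ((hasDerivAt_id ρ).congr_of_eventuallyEq h3)
  simpa using h4

theorem IsCoordinateMap.fderiv_of_not_mem (hC : IsCoordinateMap S B O T D χ ν φ G X M C)
    (hD : IsOpen D)
    (hχ : ContDiffOn ℝ ∞ χ D) (hν : ContDiffOn ℝ ∞ ν D) {q : ℝ × Euc N × ℝ} (hq : q ∈ G)
    (hqC : q.2.1 ∉ C) (h : ℝ × Euc N × ℝ) :
    fderiv ℝ X q h = fderiv ℝ χ q.2 h.2 + (q.1 • fderiv ℝ ν q.2 h.2 + h.1 • ν q.2) := by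
  have h1 := (ContDiffOn.hasFDerivAt_of_mem hχ hD (hC.mem_D q hq)).comp q hasFDerivAt_snd
  have h2 := (ContDiffOn.hasFDerivAt_of_mem hν hD (hC.mem_D q hq)).comp q hasFDerivAt_snd
  have h3 : HasFDerivAt (fun q : ℝ × Euc N × ℝ => χ q.2 + q.1 • ν q.2) _ q :=
    h1.fun_add (hasFDerivAt_fst.fun_smul h2)
  have h4 : X =ᶠ[𝓝 q] fun q => χ q.2 + q.1 • ν q.2 := by
    have hc : Continuous fun q : ℝ × Euc N × ℝ => q.2.1 := by fun_prop
    filter_upwards [hC.isOpen_G.mem_nhds hq,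
      (hC.isClosed_C.isOpen_compl.preimage hc).mem_nhds hqC] with z hz hz' using hC.eq z hz hz'
  rw [(h3.congr_of_eventuallyEq h4).fderiv]
  simp

theorem gradX_track (hE : IsAmbientExtension S S' T X₀ n ψ U D χ ν)
    (hC : IsCoordinateMap S B O T D χ ν φ G X M C) (hI : IsInverseCoord ψ X V Z r s)
    (hVG : V ⊆ G) {σ : Euc N} (hσ : σ ∈ S) {t : ℝ} (ht : t ∈ Icc 0 T)
    (hV : (0, σ, t) ∈ V) :
    gradX r (X₀ (σ, t), t) = n (σ, t) ∧ DX s (X₀ (σ, t), t) (n (σ, t)) = 0 := by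
  have h1 := hI.gradX_eq hV (hE.level_zero hσ) (n := ν (σ, t)) (hE.normal_unit _ (hE.mem_D hσ ht))
    (hC.velocity σ t (hVG hV)) (fun v _ => by
      rw [hC.fderiv_slice hE.isOpen_D hE.smooth (hVG hV)]
      exact hE.orthogonal σ hσ t ht v)
  simp only [hC.zero σ t (hVG hV), hE.eq_of_mem hσ ht, hE.normal_eq σ hσ t ht] at h1
  exact h1

/-- Where the tube is straight, `ν` remains orthogonal to the slices for `r ≠ 0`, because `ν·dν = 0`
by unit length. -/
theorem gradX_of_not_mem (hE : IsAmbientExtension S S' T X₀ n ψ U D χ ν)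
    (hC : IsCoordinateMap S B O T D χ ν φ G X M C) (hI : IsInverseCoord ψ X V Z r s)
    (hVG : V ⊆ G) {ρ : ℝ} {σ : Euc N} (hσ : σ ∈ S) {t : ℝ} (ht : t ∈ Icc 0 T)
    (hV : (ρ, σ, t) ∈ V) (hσC : σ ∉ C) :
    gradX r (X (ρ, σ, t), t) = n (σ, t) ∧ DX s (X (ρ, σ, t), t) (n (σ, t)) = 0 := by
  have hD := hE.mem_D hσ ht
  rw [← hE.normal_eq σ hσ t ht]
  refine hI.gradX_eq hV (hE.level_zero hσ) (n := ν (σ, t)) (hE.normal_unit _ hD) ?_ fun v _ => ?_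
  · rw [hC.fderiv_of_not_mem hE.isOpen_D hE.smooth hE.normal_smooth (hVG hV) hσC]
    have e0 : ((0, 0) : Euc N × ℝ) = 0 := rfl
    simp only [e0, map_zero, smul_zero, zero_add, one_smul]
  · rw [hC.fderiv_of_not_mem hE.isOpen_D hE.smooth hE.normal_smooth (hVG hV) hσC]
    have h1 := ContDiffOn.hasFDerivAt_of_mem hE.normal_smooth hE.isOpen_D hD
    have h2 := h1.norm_sq
    have h3 : (fun z => ‖ν z‖ ^ 2) =ᶠ[𝓝 (σ, t)] fun _ => 1 := by
      filter_upwards [hE.isOpen_D.mem_nhds hD] with z hz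
      rw [hE.normal_unit z hz, one_pow]
    have h4 := h2.unique ((hasFDerivAt_const (1 : ℝ) (σ, t)).congr_of_eventuallyEq h3)
    have h5 : inner ℝ (ν (σ, t)) (fderiv ℝ ν (σ, t) (v, 0)) = 0 := by
      simpa using congrArg (fun A => A (v, 0)) h4
    simp [inner_add_right, inner_smul_right, h5, hE.orthogonal σ hσ t ht v]

/-- The Hessian of `r` vanishes in normal direction on `Γ`. -/
theorem inner_fderiv_gradX_normal (hE : IsAmbientExtension S S' T X₀ n ψ U D χ ν)
    (hC : IsCoordinateMap S B O T D χ ν φ G X M C) (hI : IsInverseCoord ψ X V Z r s)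
    (hVG : V ⊆ G) {σ : Euc N} (hσ : σ ∈ S) {t : ℝ} (ht : t ∈ Icc 0 T)
    (hV : (0, σ, t) ∈ V) :
    inner ℝ (n (σ, t)) (fderiv ℝ (gradX r) (X₀ (σ, t), t) (n (σ, t), 0)) = 0 ∧
      HasDerivAt (fun ρ : ℝ => gradX r (X (ρ, σ, t), t))
        (fderiv ℝ (gradX r) (X₀ (σ, t), t) (n (σ, t), 0)) 0 := by
  have hG := hVG hV
  have h0 := hE.level_zero hσ
  have hX0 : X (0, σ, t) = X₀ (σ, t) := by rw [hC.zero σ t hG, hE.eq_of_mem hσ ht]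
  have hν := hE.normal_eq σ hσ t ht
  obtain ⟨hZ, -, -⟩ := hI.left_inv _ hV h0
  have hgr := (gradX_track hE hC hI hVG hσ ht hV).1
  have hvel : fderiv ℝ X (0, σ, t) (1, 0, 0) = n (σ, t) := by rw [hC.velocity σ t hG, hν]
  have hXd : HasDerivAt (fun ρ : ℝ => X (ρ, σ, t)) (n (σ, t)) 0 := by
    rw [← hvel]
    exact HasFDerivAt.comp_hasDerivAt (f := fun ρ : ℝ => (ρ, σ, t)) 0
      (ContDiffOn.hasFDerivAt_of_mem hC.smooth hC.isOpen_G hG) (hasDerivAt_line 0 (σ, t))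
  have hgd : HasDerivAt (fun ρ : ℝ => gradX r (X (ρ, σ, t), t))
      (fderiv ℝ (gradX r) (X₀ (σ, t), t) (n (σ, t), 0)) 0 := by
    have h1 := ContDiffOn.hasFDerivAt_of_mem hI.contDiffOn_gradX hI.isOpen_Z hZ
    simp only [] at h1
    rw [show fderiv ℝ (gradX r) (X₀ (σ, t), t) = fderiv ℝ (gradX r) (X (0, σ, t), t) by rw [hX0]]
    exact HasFDerivAt.comp_hasDerivAt (f := fun ρ : ℝ => (X (ρ, σ, t), t)) 0 h1
      (hXd.prodMk (hasDerivAt_const 0 t))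
  refine ⟨?_, hgd⟩
  have hXr : ContDiffOn ℝ ∞ (fun q => fderiv ℝ X q (1, 0, 0)) G :=
    (hC.smooth.fderiv_of_isOpen hC.isOpen_G (by simp)).clm_apply contDiffOn_const
  have hXrd : HasDerivAt (fun ρ : ℝ => fderiv ℝ X (ρ, σ, t) (1, 0, 0)) _ 0 :=
    HasFDerivAt.comp_hasDerivAt (f := fun ρ : ℝ => (ρ, σ, t)) 0
      (ContDiffOn.hasFDerivAt_of_mem hXr hC.isOpen_G hG) (hasDerivAt_line 0 (σ, t))
  set k := fderiv ℝ (fun q => fderiv ℝ X q (1, 0, 0)) (0, σ, t) (1, 0, 0) with hk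
  have hVev := (hasDerivAt_line 0 (σ, t)).continuousAt.preimage_mem_nhds (hI.isOpen_V.mem_nhds hV)
  have e1 : inner ℝ (n (σ, t)) k = 0 := by
    have h1 := (hasDerivAt_const (0 : ℝ) (n (σ, t))).inner ℝ hXrd
    have h2 : (fun ρ : ℝ => inner ℝ (n (σ, t)) (fderiv ℝ X (ρ, σ, t) (1, 0, 0))) =ᶠ[𝓝 0]
        fun _ => (1 : ℝ) := by
      filter_upwards [hVev] with ρ hρ
      rw [← hν]
      exact hC.inner_velocity (hVG hρ)
    simpa using h1.unique ((hasDerivAt_const (0 : ℝ) (1 : ℝ)).congr_of_eventuallyEq h2)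
  -- Differentiating `∇r·∂_r X = 1` at `r = 0` leaves `D²r(n)·n`, since by `e1` the acceleration has
  -- no normal component.
  have h1 := hgd.inner ℝ hXrd
  have h2 : (fun ρ : ℝ => inner ℝ (gradX r (X (ρ, σ, t), t)) (fderiv ℝ X (ρ, σ, t) (1, 0, 0)))
      =ᶠ[𝓝 0] fun _ => (1 : ℝ) := by
    filter_upwards [hVev] with ρ hρ
    exact hI.inner_gradX_fderiv hρ h0 1 (map_zero _)
  have h3 := h1.unique ((hasDerivAt_const (0 : ℝ) (1 : ℝ)).congr_of_eventuallyEq h2)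
  rw [hX0, hgr, hvel, e1, zero_add] at h3
  rw [real_inner_comm]
  exact h3

theorem hasDerivAt_norm_gradX_sq (hE : IsAmbientExtension S S' T X₀ n ψ U D χ ν)
    (hC : IsCoordinateMap S B O T D χ ν φ G X M C) (hI : IsInverseCoord ψ X V Z r s)
    (hVG : V ⊆ G) {σ : Euc N} (hσ : σ ∈ S) {t : ℝ} (ht : t ∈ Icc 0 T)
    (hV : (0, σ, t) ∈ V) :
    HasDerivAt (fun ρ : ℝ => ‖gradX r (X (ρ, σ, t), t)‖ ^ 2) 0 0 := by
  obtain ⟨h1, h2⟩ := inner_fderiv_gradX_normal hE hC hI hVG hσ ht hV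
  have h3 := h2.norm_sq
  have hX0 : X (0, σ, t) = X₀ (σ, t) := by rw [hC.zero σ t (hVG hV), hE.eq_of_mem hσ ht]
  rw [hX0, (gradX_track hE hC hI hVG hσ ht hV).1, h1, mul_zero] at h3
  exact h3

/-- Along a material point `r` stays zero, so `∂_t r + n·∂_t X₀ = 0`. At `t = 0` and `t = T` the
one-sided derivative of `X₀` is supplied by the extension `χ`. -/
theorem evolvingNormalVelocity_eq (hE : IsAmbientExtension S S' T X₀ n ψ U D χ ν)
    (hC : IsCoordinateMap S B O T D χ ν φ G X M C) (hI : IsInverseCoord ψ X V Z r s)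
    (hT : 0 < T) (hVG : V ⊆ G) {σ : Euc N} (hσ : σ ∈ S) {t : ℝ}
    (ht : t ∈ Icc 0 T) (hV : (0, σ, t) ∈ V) :
    evolvingNormalVelocity X₀ n T σ t = -dT r (X₀ (σ, t), t) := by
  have h0 := hE.level_zero hσ
  have hX0 : X (0, σ, t) = X₀ (σ, t) := by rw [hC.zero σ t (hVG hV), hE.eq_of_mem hσ ht]
  obtain ⟨hZ, -, -⟩ := hI.left_inv _ hV h0
  have h1 := (hI.fderiv_left_inv hV h0 0 (v := 0) (map_zero _) 1).1
  simp only [hX0] at h1 hZ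
  rw [hC.fderiv_slice hE.isOpen_D hE.smooth (hVG hV) (0, 1)] at h1
  set w := fderiv ℝ χ (σ, t) (0, 1) with hw
  have h2 : ((w, 1) : Euc N × ℝ) = (w, 0) + (0, 1) := by simp
  rw [h2, map_add, ← hI.inner_gradX hZ, (gradX_track hE hC hI hVG hσ ht hV).1] at h1
  have h3 : dT r (X₀ (σ, t), t) = fderiv ℝ r (X₀ (σ, t), t) (0, 1) := by
    have : HasDerivAt (fun t' => r (X₀ (σ, t), t')) (fderiv ℝ r (X₀ (σ, t), t) (0, 1)) t :=
      HasFDerivAt.comp_hasDerivAt (f := fun t' : ℝ => (X₀ (σ, t), t')) t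
        (ContDiffOn.hasFDerivAt_of_mem hI.smooth_r hI.isOpen_Z hZ)
        ((hasDerivAt_const t _).prodMk (hasDerivAt_id t))
    exact this.deriv
  have h4 := (hE.hasDerivWithinAt_time hσ ht).derivWithin (uniqueDiffOn_Icc hT t ht)
  rw [evolvingNormalVelocity, h3, h4]
  linarith

/-- On `Γ_t` the normal is `∇r`, so the shape operator is minus the tangential part of the Hessian
of `r`. Its trace differs from `-Δr` only by the term `n·D²r n`, which vanishes. -/
theorem evolvingMeanCurvature_eq (hE : IsAmbientExtension S S' T X₀ n ψ U D χ ν)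
    (hC : IsCoordinateMap S B O T D χ ν φ G X M C) (hI : IsInverseCoord ψ X V Z r s)
    (hS : IsHypersurfaceWithBoundary S)
    (hVG : V ⊆ G) (hV : ∀ σ ∈ S, ∀ t ∈ Icc 0 T, (0, σ, t) ∈ V) {σ : Euc N} (hσ : σ ∈ S) {t : ℝ}
    (ht : t ∈ Icc 0 T) (hn_normal : n (σ, t) ∈ (tangentSpace (slice X₀ S t) (X₀ (σ, t)))ᗮ) :
    evolvingMeanCurvature X₀ n S σ t = -lapX r (X₀ (σ, t), t) := by
  have h0 := hE.level_zero hσ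
  have hVσ := hV σ hσ t ht
  have hX0 : X (0, σ, t) = X₀ (σ, t) := by rw [hC.zero σ t (hVG hVσ), hE.eq_of_mem hσ ht]
  obtain ⟨hZ, -, -⟩ := hI.left_inv _ hVσ h0
  simp only [hX0] at hZ
  have hn1 : ‖n (σ, t)‖ = 1 := by
    rw [← hE.normal_eq σ hσ t ht]; exact hE.normal_unit _ (hE.mem_D hσ ht)
  set p := X₀ (σ, t) with hp
  set H : Euc N →L[ℝ] Euc N :=
    (fderiv ℝ (gradX r) (p, t)).comp (ContinuousLinearMap.inl ℝ (Euc N) ℝ) with hH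
  have hHd : HasFDerivAt (fun x => gradX r (x, t)) H p :=
    HasFDerivAt.comp (g := gradX r) (f := fun x => (x, t)) p
      (ContDiffOn.hasFDerivAt_of_mem hI.contDiffOn_gradX hI.isOpen_Z hZ)
      (hasFDerivAt_prodMk_left p t)
  have hHn : inner ℝ (n (σ, t)) (H (n (σ, t))) = 0 := by
    simpa [hH] using (inner_fderiv_gradX_normal hE hC hI hVG hσ ht hVσ).1
  -- the Laplacian
  have hfr : ∀ x w, fderiv ℝ (fun x => r (x, t)) x w = inner ℝ (gradX r (x, t)) w := by
    intro x w
    rw [gradX, inner_gradient]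
  have hfC : ContDiffAt ℝ ∞ (fun x => r (x, t)) p :=
    ContDiffAt.comp (g := r) (f := fun x : Euc N => (x, t)) p
      (hI.smooth_r.contDiffAt (hI.isOpen_Z.mem_nhds hZ)) (by fun_prop)
  have hf2 : ∀ v w, fderiv ℝ (fderiv ℝ (fun x => r (x, t))) p v w = inner ℝ (H v) w := by
    intro v w
    have h1 : HasFDerivAt (fderiv ℝ (fun x => r (x, t))) _ p :=
      ((hfC.fderiv_right (m := ∞) (by simp)).differentiableAt (by simp)).hasFDerivAt
    have h2 := h1.clm_apply (hasFDerivAt_const w p)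
    have h3 := hHd.inner ℝ (hasFDerivAt_const w p)
    have h4 := h2.unique (h3.congr_of_eventuallyEq (Eventually.of_forall fun x => hfr x w))
    simpa using congrArg (fun A => A v) h4
  have hlap : lapX r (p, t) = LinearMap.trace ℝ (Euc N) (H : Euc N →ₗ[ℝ] Euc N) := by
    rw [lapX, InnerProductSpace.laplacian_eq_iteratedFDeriv_stdOrthonormalBasis,
      LinearMap.trace_eq_sum_inner _ (stdOrthonormalBasis ℝ (Euc N))]
    refine Finset.sum_congr rfl fun i _ => ?_
    rw [iteratedFDeriv_two_apply]
    simp [hf2, real_inner_comm]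
  -- the shape operator
  set M' := slice X₀ S t with hM'
  have hT := hE.tangentSpace_slice hS hσ ht hn_normal
  have hsn : ∀ x ∈ M', sliceNormal X₀ n S t x = gradX r (x, t) := by
    rintro _ ⟨s', hs', rfl⟩
    have hinj : InjOn (fun s => X₀ (s, t)) S := fun a ha b hb hab => hE.injOn t ht ha hb (by
      change χ (a, t) = χ (b, t)
      rw [hE.eq_of_mem ha ht, hE.eq_of_mem hb ht]
      exact hab)
    have h1 : Function.invFunOn (fun s => X₀ (s, t)) S (X₀ (s', t)) = s' :=
      hinj.leftInvOn_invFunOn hs'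
    simp only [sliceNormal, h1]
    exact (gradX_track hE hC hI hVG hs' ht (hV s' hs' t ht)).1.symm
  have hpM : p ∈ M' := ⟨σ, hσ, rfl⟩
  have hsd : HasFDerivWithinAt (sliceNormal X₀ n S t) H M' p :=
    hHd.hasFDerivWithinAt.congr hsn (hsn p hpM)
  have hsv : ∀ v ∈ tangentSpace M' p, fderivWithin ℝ (sliceNormal X₀ n S t) M' p v = H v :=
    fun v hv => fderiv_eq_of_mem_span_tangentConeAt
      hsd.differentiableWithinAt.hasFDerivWithinAt hsd hv
  have hshape : shapeOperator M' (sliceNormal X₀ n S t) p =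
      -((tangentSpace M' p).orthogonalProjectionOnto.toLinearMap ∘ₗ
        ((H : Euc N →ₗ[ℝ] Euc N) ∘ₗ (tangentSpace M' p).subtype)) := by
    ext v
    simp [shapeOperator, hsv v.1 v.2]
  have hproj : ∀ w : Euc N, (((tangentSpace M' p).orthogonalProjectionOnto w : tangentSpace M' p) :
      Euc N) = w - (inner ℝ (n (σ, t)) w : ℝ) • n (σ, t) := by
    intro w
    refine (Submodule.eq_starProjection_of_mem_of_inner_eq_zero ?_ ?_)
    · rw [hT, Submodule.mem_orthogonal_singleton_iff_inner_right, inner_sub_right,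
        inner_smul_right, real_inner_self_eq_norm_sq, hn1]
      simp
    · intro u hu
      rw [hT, Submodule.mem_orthogonal_singleton_iff_inner_right] at hu
      rw [sub_sub_cancel, inner_smul_left, hu, mul_zero]
  have htr : LinearMap.trace ℝ _ ((tangentSpace M' p).orthogonalProjectionOnto.toLinearMap ∘ₗ
        ((H : Euc N →ₗ[ℝ] Euc N) ∘ₗ (tangentSpace M' p).subtype)) =
      LinearMap.trace ℝ (Euc N) (H : Euc N →ₗ[ℝ] Euc N) := by
    -- Cyclicity of the trace turns an operator on the tangent space into the projected Hessian on
    -- the whole space.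
    rw [← LinearMap.comp_assoc, LinearMap.trace_comp_comm',
      LinearMap.trace_eq_sum_inner _ (stdOrthonormalBasis ℝ (Euc N)),
      LinearMap.trace_eq_sum_inner _ (stdOrthonormalBasis ℝ (Euc N))]
    set b := stdOrthonormalBasis ℝ (Euc N) with hb
    have h1 : ∀ i, inner ℝ (b i) (((tangentSpace M' p).subtype ∘ₗ
        ((tangentSpace M' p).orthogonalProjectionOnto.toLinearMap ∘ₗ
          (H : Euc N →ₗ[ℝ] Euc N))) (b i)) =
        inner ℝ (b i) (H (b i)) - inner ℝ (n (σ, t)) (H ((inner ℝ (b i) (n (σ, t)) : ℝ) • b i)) := by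
      intro i
      simp [hproj, inner_sub_right, inner_smul_right, mul_comm]
    rw [Finset.sum_congr rfl fun i _ => h1 i, Finset.sum_sub_distrib, ← inner_sum, ← map_sum,
      b.sum_repr', hHn, sub_zero]
    rfl
  rw [evolvingMeanCurvature, meanCurvature, hshape, map_neg, htr, hlap]

end Track

/-! ### Contact with the boundary of the domain. -/

/-- The evolving hypersurface meets the domain `{φ < 0}` orthogonally, exactly along its boundary. -/
structure HasContact (S : Set (Euc N)) (T : ℝ) (X₀ n : Euc N × ℝ → Euc N) (φ : Euc N → ℝ) :
    Prop where
  smooth : ContDiff ℝ ∞ φ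
  neg : ∀ s ∈ S \ bdry S, ∀ t ∈ Icc 0 T, φ (X₀ (s, t)) < 0
  zero : ∀ s ∈ bdry S, ∀ t ∈ Icc 0 T, φ (X₀ (s, t)) = 0
  fderiv_ne : ∀ s ∈ bdry S, ∀ t ∈ Icc 0 T, fderiv ℝ φ (X₀ (s, t)) ≠ 0
  orthogonal : ∀ s ∈ bdry S, ∀ t ∈ Icc 0 T, fderiv ℝ φ (X₀ (s, t)) (n (s, t)) = 0

section Contact

variable {S S' U O M C : Set (Euc N)} {T : ℝ} {X₀ n χ ν : Euc N × ℝ → Euc N} {ψ φ : Euc N → ℝ}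
  {D Z : Set (Euc N × ℝ)} {X : ℝ × Euc N × ℝ → Euc N} {G V : Set (ℝ × Euc N × ℝ)}
  {r : Euc N × ℝ → ℝ} {s : Euc N × ℝ → Euc N} {σ : Euc N} {t : ℝ}

theorem HasContact.hasFDerivAt (hF : HasContact S T X₀ n φ) (x : Euc N) :
    HasFDerivAt φ (fderiv ℝ φ x) x :=
  (hF.smooth.differentiable (by simp)).differentiableAt.hasFDerivAt

theorem HasContact.hasFDerivAt_slice (hE : IsAmbientExtension S S' T X₀ n ψ U D χ ν)
    (hF : HasContact S T X₀ n φ) (hσ : σ ∈ S) (ht : t ∈ Icc 0 T) :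
    HasFDerivAt (fun y => φ (χ (y, t))) ((fderiv ℝ φ (X₀ (σ, t))).comp
      ((fderiv ℝ χ (σ, t)).comp (ContinuousLinearMap.inl ℝ (Euc N) ℝ))) σ := by
  have h1 : HasFDerivAt (fun s' => χ (s', t))
      ((fderiv ℝ χ (σ, t)).comp (ContinuousLinearMap.inl ℝ (Euc N) ℝ)) σ :=
    HasFDerivAt.comp (g := χ) (f := fun s' : Euc N => (s', t)) σ (hE.hasFDerivAt (hE.mem_D hσ ht))
      (hasFDerivAt_prodMk_left σ t)
  rw [← hE.eq_of_mem hσ ht]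
  exact (hF.hasFDerivAt _).comp σ h1

theorem HasContact.fderiv_tangent_bdry (hE : IsAmbientExtension S S' T X₀ n ψ U D χ ν)
    (hF : HasContact S T X₀ n φ) (hσ : σ ∈ bdry S) (ht : t ∈ Icc 0 T) {v : Euc N}
    (hv : v ∈ tangentSpace (bdry S) σ) :
    fderiv ℝ φ (X₀ (σ, t)) (fderiv ℝ χ (σ, t) (v, 0)) = 0 := by
  have h := fderiv_eq_zero_of_mem_span_tangentConeAt
    (HasContact.hasFDerivAt_slice hE hF hσ.1 ht) (s := bdry S) (by
      filter_upwards [self_mem_nhdsWithin] with y hy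
      rw [hE.eq_of_mem hy.1 ht, hE.eq_of_mem hσ.1 ht, hF.zero y hy t ht, hF.zero σ hσ t ht]) hv
  simpa using h

/-- By the contact angle, the evolving hypersurface is transversal to `{φ = 0}`. -/
theorem HasContact.exists_fderiv_ne_zero (hE : IsAmbientExtension S S' T X₀ n ψ U D χ ν)
    (hF : HasContact S T X₀ n φ) (hσ : σ ∈ bdry S) (ht : t ∈ Icc 0 T) :
    ∃ v, fderiv ℝ ψ σ v = 0 ∧ fderiv ℝ φ (X₀ (σ, t)) (fderiv ℝ χ (σ, t) (v, 0)) ≠ 0 := by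
  by_contra! hcon
  apply hF.fderiv_ne σ hσ t ht
  ext h
  -- If `dφ` vanished on the tangent space as well as on `n`, it would vanish identically.
  obtain ⟨ρ, v, hv, rfl⟩ := exists_decomposition
    (A := (fderiv ℝ χ (σ, t)).comp (ContinuousLinearMap.inl ℝ (Euc N) ℝ))
    (hE.level_fderiv σ hσ.1) (hE.normal_unit _ (hE.mem_D hσ.1 ht))
    (fun v hv h0 => hE.immersion σ hσ.1 t ht v hv (by simpa using h0))
    (fun v => by simpa using hE.orthogonal σ hσ.1 t ht v) h
  have h1 := hcon v hv
  simp [hE.normal_eq σ hσ.1 t ht, hF.orthogonal σ hσ t ht, h1]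

theorem HasContact.le_zero (hF : HasContact S T X₀ n φ) (hσ : σ ∈ S) (ht : t ∈ Icc 0 T) :
    φ (X₀ (σ, t)) ≤ 0 := by
  by_cases h : σ ∈ bdry S
  · exact (hF.zero σ h t ht).le
  · exact (hF.neg σ ⟨hσ, h⟩ t ht).le

/-- The hypersurface crosses the boundary of the domain with positive speed. -/
theorem HasContact.fderiv_pos (hE : IsAmbientExtension S S' T X₀ n ψ U D χ ν)
    (hF : HasContact S T X₀ n φ) (hσ : σ ∈ bdry S) (ht : t ∈ Icc 0 T) {W : Set (Euc N)}
    {g : Euc N → ℝ} {e e' : Euc N} (hg : IsBoundaryChart S ψ σ W g e e') :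
    0 < fderiv ℝ φ (X₀ (σ, t)) (fderiv ℝ χ (σ, t) (e, 0)) := by
  have h0 := hE.level_zero hσ.1
  have hψd : HasStrictFDerivAt ψ (fderiv ℝ ψ σ) σ :=
    hE.level_smooth.contDiffAt.hasStrictFDerivAt (by simp)
  have hgd := ContDiffOn.hasFDerivAt_of_mem hg.smooth hg.isOpen hg.mem
  -- A curve entering `S` with velocity `-e` shows that the derivative is nonnegative. If it were
  -- zero, `dφ ∘ dχ` would vanish on `e` and on `T ∂S`, hence on every tangent vector, against
  -- transversality.
  refine lt_of_le_of_ne ?_ fun hne => ?_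
  · obtain ⟨c, hc0, hc, hcS⟩ := exists_curve_of_neg (s := S) (v := -e) hψd h0
      (hE.level_fderiv σ hσ.1) hgd hg.zero (by
        filter_upwards [hg.isOpen.mem_nhds hg.mem] with y hy h1 h2
        exact (hg.mem_iff y hy).2 ⟨h1, h2⟩) (by simp [hg.dual.1]) (by simp [hg.dual.2])
    have h1 := HasContact.hasFDerivAt_slice hE hF hσ.1 ht
    rw [← hc0] at h1
    have h2 := h1.comp_hasDerivAt (0 : ℝ) hc
    have h3 := h2.hasDerivWithinAt (s := Ioi 0)
    rw [hasDerivWithinAt_iff_tendsto_slope' (by simp)] at h3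
    have h4 := le_of_tendsto h3 (b := 0) (by
      filter_upwards [hcS, self_mem_nhdsWithin] with τ hτ hτ0
      have hτ0' : (0 : ℝ) < τ := hτ0
      have e1 : φ (χ (c τ, t)) ≤ 0 := by rw [hE.eq_of_mem hτ ht]; exact hF.le_zero hτ ht
      have e2 : φ (χ (c 0, t)) = 0 := by rw [hc0, hE.eq_of_mem hσ.1 ht]; exact hF.zero σ hσ t ht
      simp only [slope, vsub_eq_sub, sub_zero, Function.comp, e2, smul_eq_mul]
      exact mul_nonpos_of_nonneg_of_nonpos (by positivity) e1)
    rw [hc0] at h4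
    simp only [ContinuousLinearMap.comp_apply, ContinuousLinearMap.inl_apply, map_neg] at h4
    linarith
  · obtain ⟨v, hv, hv'⟩ := HasContact.exists_fderiv_ne_zero hE hF hσ ht
    apply hv'
    have hw := HasContact.fderiv_tangent_bdry hE hF hσ ht (hg.mem_tangentSpace_bdry h0
      hE.level_smooth (v := v - fderiv ℝ g σ v • e) (by simp [hv, hg.dual.1])
      (by simp [hg.dual.2]))
    have e3 : ((v - fderiv ℝ g σ v • e, 0) : Euc N × ℝ) = (v, 0) - fderiv ℝ g σ v • (e, 0) := by
      simp
    rw [e3, map_sub, map_smul, map_sub, map_smul, ← hne] at hw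
    simpa using hw

/-- The boundary is the zero set in `S` of the continuous function `φ ∘ χ(·, 0)`, which is negative
at interior points. -/
theorem HasContact.isCompact_bdry (hE : IsAmbientExtension S S' T X₀ n ψ U D χ ν)
    (hF : HasContact S T X₀ n φ) (hS : IsCompact S) (hT : 0 ≤ T) : IsCompact (bdry S) := by
  have h0 : (0 : ℝ) ∈ Icc 0 T := ⟨le_rfl, hT⟩
  have hc : ContinuousOn (fun y => φ (χ (y, 0))) S := fun y hy =>
    (HasContact.hasFDerivAt_slice hE hF hy h0).continuousAt.continuousWithinAt
  have h1 := hc.preimage_isClosed_of_isClosed hS.isClosed (isClosed_singleton (x := (0 : ℝ)))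
  have h2 : bdry S = S ∩ (fun y => φ (χ (y, 0))) ⁻¹' {0} := by
    ext y
    constructor
    · intro hy
      exact ⟨hy.1, by simp [hE.eq_of_mem hy.1 h0, hF.zero y hy 0 h0]⟩
    · rintro ⟨hy, hy0⟩
      by_contra hcon
      have := hF.neg y ⟨hy, hcon⟩ 0 h0
      rw [mem_preimage, mem_singleton_iff, hE.eq_of_mem hy h0] at hy0
      exact this.ne hy0
  rw [h2]
  exact hS.of_isClosed_subset h1 inter_subset_left

/-- Near the track, the sign of `φ ∘ X` detects the hypersurface and its boundary. -/
theorem eventually_level_sign (hE : IsAmbientExtension S S' T X₀ n ψ U D χ ν)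
    (hF : HasContact S T X₀ n φ) (hC : IsCoordinateMap S (bdry S) O T D χ ν φ G X M C)
    (hS : IsHypersurfaceWithBoundary S) (hbd : IsClosed (bdry S)) (hσ : σ ∈ S) (ht : t ∈ Icc 0 T) :
    ∀ᶠ q in 𝓝 ((0 : ℝ), σ, t), q.2.2 ∈ Icc 0 T → ψ q.2.1 = 0 →
      (q.2.1 ∈ S → φ (X q) ≤ 0 ∧ (φ (X q) = 0 ↔ q.2.1 ∈ bdry S)) ∧ (φ (X q) ≤ 0 → q.2.1 ∈ S) := by
  have hG := hC.mem_G σ hσ t ht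
  have hX0 : X (0, σ, t) = X₀ (σ, t) := by rw [hC.zero σ t hG, hE.eq_of_mem hσ ht]
  have hXs : HasStrictFDerivAt X (fderiv ℝ X (0, σ, t)) (0, σ, t) :=
    ContDiffOn.hasStrictFDerivAt_of_mem hC.smooth hC.isOpen_G hG
  have hp : Continuous fun q : ℝ × Euc N × ℝ => q.2.1 := by fun_prop
  by_cases hσb : σ ∈ bdry S
  · obtain ⟨W, g, e, e', hg⟩ := hσb.2.exists_chart hE.level_smooth (fun y hy => hE.level_zero hy)
      (hE.level_fderiv σ hσ)
    have hφs : HasStrictFDerivAt φ (fderiv ℝ φ (X₀ (σ, t))) (X (0, σ, t)) := by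
      rw [← hX0]
      exact hF.smooth.contDiffAt.hasStrictFDerivAt (by simp)
    -- This only reorders the variables, so that `y` comes first and `(r, t)` acts as the parameter
    -- of the sign lemma.
    let P : Euc N × ℝ × ℝ →L[ℝ] ℝ × Euc N × ℝ :=
      ((ContinuousLinearMap.fst ℝ ℝ ℝ).comp (ContinuousLinearMap.snd ℝ (Euc N) (ℝ × ℝ))).prod
        ((ContinuousLinearMap.fst ℝ (Euc N) (ℝ × ℝ)).prod
          ((ContinuousLinearMap.snd ℝ ℝ ℝ).comp (ContinuousLinearMap.snd ℝ (Euc N) (ℝ × ℝ))))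
    have hPe : ∀ y ρ τ, P (y, ρ, τ) = (ρ, y, τ) := fun _ _ _ => rfl
    have hP : Tendsto P (𝓝 (σ, (0, t))) (𝓝 (0, σ, t)) := P.continuous.tendsto (σ, (0, t))
    have hH : HasStrictFDerivAt (fun z => φ (X (P z)))
        ((fderiv ℝ φ (X₀ (σ, t))).comp ((fderiv ℝ X (0, σ, t)).comp P)) (σ, (0, t)) :=
      HasStrictFDerivAt.comp (g := φ) (f := fun z => X (P z)) (σ, ((0 : ℝ), t)) hφs
        (HasStrictFDerivAt.comp (g := X) (f := P) (σ, ((0 : ℝ), t)) hXs P.hasStrictFDerivAt)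
    have hev : ∀ᶠ q in 𝓝 ((0 : ℝ), σ, t), q ∈ G ∧ q.2.1 ∈ M ∧ q.2.1 ∈ W := by
      filter_upwards [hC.isOpen_G.mem_nhds hG, (hC.isOpen_M.preimage hp).mem_nhds (hC.subset_M hσb),
        (hg.isOpen.preimage hp).mem_nhds hg.mem] with q h1 h2 h3 using ⟨h1, h2, h3⟩
    -- Over `∂S` both terms of the affine law vanish: the first by contact, the second by the
    -- contact angle.
    have hlev : ∀ q ∈ G, q.2.1 ∈ M → q.2.2 ∈ Icc 0 T → q.2.1 ∈ bdry S → φ (X q) = 0 := by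
      intro q hq hqM hqT hqb
      have e1 : χ q.2 = X₀ (q.2.1, q.2.2) := hE.eq_of_mem hqb.1 hqT
      have e2 : ν q.2 = n (q.2.1, q.2.2) := hE.normal_eq _ hqb.1 _ hqT
      rw [hC.level q hq hqM, e1, e2, hF.zero _ hqb _ hqT, hF.orthogonal _ hqb _ hqT]
      simp
    have hsign := eventually_sign_of_level (C := {z : ℝ × ℝ | z.2 ∈ Icc 0 T}) hg.isOpen hg.mem
      hE.level_smooth.contDiffOn hg.smooth (hE.level_zero hσ) hg.zero hH (by
        filter_upwards [hP.eventually hev] with z hz hzT h1 h2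
        exact hlev _ hz.1 hz.2.1 hzT (hg.mem_bdry _ hz.2.2 h1 h2)) hg.dual hg.dual' (by
        have := HasContact.fderiv_pos hE hF hσb ht hg
        rw [← hC.fderiv_slice hE.isOpen_D hE.smooth hG] at this
        exact this)
    have hQ : Tendsto (fun q : ℝ × Euc N × ℝ => (q.2.1, (q.1, q.2.2))) (𝓝 (0, σ, t))
        (𝓝 (σ, (0, t))) := by
      have : Continuous fun q : ℝ × Euc N × ℝ => (q.2.1, (q.1, q.2.2)) := by fun_prop
      exact this.tendsto (0, σ, t)
    filter_upwards [hQ.eventually hsign, hev] with q hq hq' hqT hq0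
    obtain ⟨h1, h2⟩ := hq hqT hq0
    simp only [hPe] at h1 h2
    have hz : g q.2.1 = 0 → q.2.1 ∈ bdry S := hg.mem_bdry _ hq'.2.2 hq0
    refine ⟨fun hqS => ?_, fun hle => (hg.mem_iff _ hq'.2.2).2 ⟨hq0, ?_⟩⟩
    · rcases ((hg.mem_iff _ hq'.2.2).1 hqS).2.lt_or_eq with hneg | hzero
      · have h3 := h1 hneg
        exact ⟨h3.le, fun h => absurd h h3.ne, fun h => hlev q hq'.1 hq'.2.1 hqT h⟩
      · have h3 := hlev q hq'.1 hq'.2.1 hqT (hz hzero)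
        exact ⟨h3.le, fun _ => hz hzero, fun _ => h3⟩
    · by_contra! hcon
      exact absurd (h2 hcon) (not_lt.2 hle)
  · have hint : IsInteriorPoint S σ := (hS σ hσ).resolve_right fun h => hσb ⟨hσ, h⟩
    have h1 := hint.eventually_mem_iff hσ hE.level_smooth (fun y hy => hE.level_zero hy)
      (hE.level_fderiv σ hσ)
    have h2 : ∀ᶠ q in 𝓝 ((0 : ℝ), σ, t), φ (X q) < 0 := by
      refine (hF.smooth.continuous.continuousAt.comp hXs.continuousAt).eventually_lt_const ?_
      change φ (X (0, σ, t)) < 0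
      rw [hX0]
      exact hF.neg σ ⟨hσ, hσb⟩ t ht
    have h3 : Tendsto (fun q : ℝ × Euc N × ℝ => q.2.1) (𝓝 (0, σ, t)) (𝓝 σ) := hp.tendsto (0, σ, t)
    filter_upwards [h2, h3.eventually h1, h3.eventually (hbd.isOpen_compl.mem_nhds hσb)]
      with q hq hq1 hq2 hqT hq0
    exact ⟨fun _ => ⟨hq.le, fun h => absurd h hq.ne, fun h => absurd h hq2⟩, fun _ => hq1.2 hq0⟩

end Contact

/-! ### The boundary coordinate `b`. -/

section Tube

variable {S S' U O M C : Set (Euc N)} {T : ℝ} {X₀ n χ ν : Euc N × ℝ → Euc N} {ψ φ : Euc N → ℝ}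
  {D Z : Set (Euc N × ℝ)} {X : ℝ × Euc N × ℝ → Euc N} {G V : Set (ℝ × Euc N × ℝ)}
  {r : Euc N × ℝ → ℝ} {s : Euc N × ℝ → Euc N} {σ : Euc N} {t : ℝ}
  {m : Euc N → Euc N} {μ : ℝ} {Y : Euc N × ℝ → Euc N} {Yinv : Euc N → Euc N × ℝ}

/-- On `T S` the functionals `dg` and `v ↦ v·k` are proportional with nonzero factor, since both
vanish on `T ∂S` and neither is zero. -/
theorem mem_tangentSpace_bdry_of_conormal (hS : IsHypersurfaceWithBoundary S)
    (hψ : ContDiff ℝ ∞ ψ) (hψS : ∀ y ∈ S, ψ y = 0) (hσ : σ ∈ bdry S) (hψσ : fderiv ℝ ψ σ ≠ 0)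
    {k : Euc N} (hk : IsOuterUnitConormal S σ k) {v : Euc N} (hv : fderiv ℝ ψ σ v = 0)
    (hvk : inner ℝ v k = 0) : v ∈ tangentSpace (bdry S) σ := by
  obtain ⟨W, g, e, e', hg⟩ := hσ.2.exists_chart hψ hψS hψσ
  obtain ⟨hk1, hk2, hk3, -⟩ := hk
  rw [hS.mem_tangentSpace_iff hσ.1 hψ hψS hψσ] at hk2
  have h1 : ∀ u, fderiv ℝ ψ σ u = 0 → inner ℝ u k = fderiv ℝ g σ u * inner ℝ e k := by
    intro u hu
    have h2 := hg.mem_tangentSpace_bdry (hψS σ hσ.1) hψ (v := u - fderiv ℝ g σ u • e)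
      (by simp [hu, hg.dual.1]) (by simp [hg.dual.2])
    have h3 := (Submodule.mem_orthogonal _ _).1 hk3 _ h2
    rw [inner_sub_left, real_inner_smul_left] at h3
    linarith
  have h4 := h1 k hk2
  rw [real_inner_self_eq_norm_sq, hk1, one_pow] at h4
  have h5 := h1 v hv
  rw [hvk] at h5
  refine hg.mem_tangentSpace_bdry (hψS σ hσ.1) hψ hv ?_
  rcases mul_eq_zero.1 h5.symm with h6 | h6
  · exact h6
  · rw [h6, mul_zero] at h4
    exact absurd h4 one_ne_zero

namespace IsNormalTube

theorem inv_start (hY : IsNormalTube S S' m μ Y Yinv) (hσ : σ ∈ bdry S) : Yinv σ = (σ, 0) := by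
  have := hY.diffeo.leftInv (x := (σ, 0)) ⟨hσ, by linarith [hY.pos], by linarith [hY.pos]⟩
  rwa [hY.start σ hσ] at this

theorem mem_start (hY : IsNormalTube S S' m μ Y Yinv) (hσ : σ ∈ bdry S) :
    σ ∈ Y '' (bdry S ×ˢ Icc (-(2 * μ)) (2 * μ)) :=
  ⟨(σ, 0), ⟨hσ, by linarith [hY.pos], by linarith [hY.pos]⟩, hY.start σ hσ⟩

/-- Cutting `{b < μ}` out of the tube gives room for the cutoff: a correction supported in `O` is
invisible outside the tube of width `μ`. -/
theorem exists_isOpen_inter_subset (hY : IsNormalTube S S' m μ Y Yinv) :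
    ∃ O, IsOpen O ∧ bdry S ⊆ O ∧ O ∩ S ⊆ Y '' (bdry S ×ˢ Icc 0 μ) := by
  have hμ := hY.pos
  obtain ⟨-, U₁, hU₁, hBU, hUS⟩ := hY.nhd_half
  have hc := hY.diffeo.smooth_inv.continuousOn
  obtain ⟨O', hO', hO'eq⟩ := continuousOn_iff'.1 (continuous_snd.comp_continuousOn hc) (Iio μ)
    isOpen_Iio
  refine ⟨U₁ ∩ O', hU₁.inter hO', fun σ hσ => ⟨hBU hσ, ?_⟩, ?_⟩
  · have h1 : σ ∈ (Prod.snd ∘ Yinv) ⁻¹' Iio μ ∩ Y '' (bdry S ×ˢ Icc (-(2 * μ)) (2 * μ)) :=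
      ⟨by simp [hY.inv_start hσ, hμ], hY.mem_start hσ⟩
    rw [hO'eq] at h1
    exact h1.1
  · rintro y ⟨⟨hyU, hyO⟩, hyS⟩
    obtain ⟨⟨σ, b⟩, ⟨hσ, hb0, hb1⟩, rfl⟩ := hUS ⟨hyU, hyS⟩
    have hmem : (σ, b) ∈ bdry S ×ˢ Icc (-(2 * μ)) (2 * μ) := ⟨hσ, by linarith [hb0], hb1⟩
    have h1 : Y (σ, b) ∈ O' ∩ Y '' (bdry S ×ˢ Icc (-(2 * μ)) (2 * μ)) :=
      ⟨hyO, mem_image_of_mem _ hmem⟩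
    rw [← hO'eq] at h1
    have h2 : (Yinv (Y (σ, b))).2 < μ := h1.1
    rw [hY.diffeo.leftInv hmem] at h2
    exact ⟨(σ, b), ⟨hσ, hb0, h2.le⟩, rfl⟩

/-- The derivative of the normal coordinate `b` of the tube at `∂S` is `v ↦ -⟪v, m⟫`. -/
theorem exists_hasFDerivWithinAt (hY : IsNormalTube S S' m μ Y Yinv)
    (hS : IsHypersurfaceWithBoundary S)
    (hψ : ContDiff ℝ ∞ ψ) (hψS : ∀ y ∈ S, ψ y = 0) (hσ : σ ∈ bdry S) (hψσ : fderiv ℝ ψ σ ≠ 0)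
    (hk : IsOuterUnitConormal S σ (m σ)) :
    ∃ B : Euc N →L[ℝ] ℝ, HasFDerivWithinAt (fun y => (Yinv y).2) B
      (Y '' (bdry S ×ˢ Icc (-(2 * μ)) (2 * μ))) σ ∧
      ∀ v, fderiv ℝ ψ σ v = 0 → B v = -inner ℝ v (m σ) := by
  have hμ := hY.pos
  set I := Y '' (bdry S ×ˢ Icc (-(2 * μ)) (2 * μ)) with hI
  have hd : DifferentiableWithinAt ℝ (fun y => (Yinv y).2) I σ :=
    ((hY.diffeo.smooth_inv σ (hY.mem_start hσ)).differentiableWithinAt (by simp)).snd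
  refine ⟨_, hd.hasFDerivWithinAt, ?_⟩
  set B := fderivWithin ℝ (fun y => (Yinv y).2) I σ with hB
  have hBd : HasFDerivWithinAt (fun y => (Yinv y).2) B I σ := hd.hasFDerivWithinAt
  have hm0 : m σ ≠ 0 := by
    intro h0; have := hk.1; rw [h0] at this; simp at this
  have h1 : B (m σ) = -1 := by
    have hc : HasDerivAt (fun b => Y (σ, b)) (-m σ) 0 := by
      rw [← hY.velocity σ hσ]
      -- The default value of `deriv` is zero, so the nonzero value `-m σ` certifies
      -- differentiability.
      refine (differentiableAt_of_deriv_ne_zero ?_).hasDerivAt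
      rw [hY.velocity σ hσ]
      exact neg_ne_zero.2 hm0
    have hev : ∀ᶠ b : ℝ in 𝓝 0, (σ, b) ∈ bdry S ×ˢ Icc (-(2 * μ)) (2 * μ) := by
      filter_upwards [Ioo_mem_nhds (a := -(2 * μ)) (b := 2 * μ) (by linarith) (by linarith)]
        with b hb using ⟨hσ, hb.1.le, hb.2.le⟩
    have h2 := hBd.comp_hasDerivAt_of_eq (0 : ℝ) hc (by
      filter_upwards [hev] with b hb using mem_image_of_mem _ hb) (hY.start σ hσ).symm
    have h3 := h2.unique ((hasDerivAt_id (0 : ℝ)).congr_of_eventuallyEq (by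
      filter_upwards [hev] with b hb
      simp only [Function.comp, hY.diffeo.leftInv hb, id]))
    rw [map_neg] at h3
    linarith
  have hT : ∀ w ∈ tangentSpace (bdry S) σ, B w = 0 := by
    intro w hw
    have hsub : bdry S ⊆ I := fun y hy => hY.mem_start hy
    have h2 : HasFDerivWithinAt (fun y => (Yinv y).2) (0 : Euc N →L[ℝ] ℝ) (bdry S) σ :=
      (hasFDerivWithinAt_const (0 : ℝ) σ (bdry S)).congr (fun y hy => by rw [hY.inv_start hy])
        (by rw [hY.inv_start hσ])
    simpa using fderiv_eq_of_mem_span_tangentConeAt (hBd.mono hsub) h2 hw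
  intro v hv
  -- Subtracting the conormal component leaves a vector tangent to `∂S`, which `B` annihilates
  -- because `b = 0` there; `B (m σ) = -1` accounts for the rest.
  have hmψ : fderiv ℝ ψ σ (m σ) = 0 := (hS.mem_tangentSpace_iff hσ.1 hψ hψS hψσ _).1 hk.2.1
  have h2 := hT _ (mem_tangentSpace_bdry_of_conormal hS hψ hψS hσ hψσ hk
    (v := v - (inner ℝ v (m σ) : ℝ) • m σ) (by simp [hv, hmψ]) (by
      rw [inner_sub_left, real_inner_smul_left, real_inner_self_eq_norm_sq, hk.1]; simp))
  rw [map_sub, map_smul, h1, smul_eq_mul] at h2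
  linarith

end IsNormalTube

theorem continuousOn_gradX {f : Euc N × ℝ → ℝ} (hZ : IsOpen Z) (hf : ContDiffOn ℝ ∞ f Z) :
    ContinuousOn (gradX f) Z := by
  have h1 : ContDiffOn ℝ ∞ (fun y => (InnerProductSpace.toDual ℝ (Euc N)).symm
      ((fderiv ℝ f y).comp (ContinuousLinearMap.inl ℝ (Euc N) ℝ))) Z :=
    (InnerProductSpace.toDual ℝ (Euc N)).symm.contDiff.comp_contDiffOn
      ((hf.fderiv_of_isOpen hZ (by simp)).clm_comp contDiffOn_const)
  refine h1.continuousOn.congr fun y hy => ?_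
  have h2 : HasFDerivAt (fun x => f (x, y.2)) _ y.1 :=
    HasFDerivAt.comp (g := f) (f := fun x => (x, y.2)) y.1
      (ContDiffOn.hasFDerivAt_of_mem hf hZ hy) (hasFDerivAt_prodMk_left y.1 y.2)
  rw [gradX, gradient, h2.fderiv]

/-- The coordinate `b` is smooth near the space-time contact set. -/
theorem exists_isOpen_contDiffOn_tube (hE : IsAmbientExtension S S' T X₀ n ψ U D χ ν)
    (hI : IsInverseCoord ψ X V Z r s) (hY : IsNormalTube S S' m μ Y Yinv) :
    ∃ Z' ⊆ Z, IsOpen Z' ∧ (∀ y ∈ Z, s y ∈ bdry S → y ∈ Z') ∧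
      MapsTo s Z' (Y '' (bdry S ×ˢ Icc (-(2 * μ)) (2 * μ))) ∧
      ContDiffOn ℝ ∞ (fun y => (Yinv (s y)).2) Z' := by
  obtain ⟨-, U₂, hU₂, hBU, hUS⟩ := hY.nhd
  -- The extended `s` crosses `∂S` into `S'`, so the two-sided tube is needed for `b` to be smooth
  -- on an open set.
  have hmaps : MapsTo s (Z ∩ s ⁻¹' (U ∩ U₂)) (Y '' (bdry S ×ˢ Icc (-(2 * μ)) (2 * μ))) :=
    fun y hy => hUS ⟨hy.2.2, (hE.mem_iff _ hy.2.1).2 (hI.right_inv y hy.1).2.1⟩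
  refine ⟨Z ∩ s ⁻¹' (U ∩ U₂), inter_subset_left, hI.smooth_s.continuousOn.isOpen_inter_preimage
    hI.isOpen_Z (hE.isOpen_U.inter hU₂), fun y hy hs => ⟨hy, hE.subset_U hs.1, hBU hs⟩, hmaps, ?_⟩
  have h1 : ContDiffOn ℝ ∞ (fun y => (Yinv y).2) (Y '' (bdry S ×ˢ Icc (-(2 * μ)) (2 * μ))) :=
    hY.diffeo.smooth_inv.snd
  exact h1.comp (hI.smooth_s.mono inter_subset_left) hmaps

theorem inner_gradX_tube (hE : IsAmbientExtension S S' T X₀ n ψ U D χ ν)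
    (hI : IsInverseCoord ψ X V Z r s) (hY : IsNormalTube S S' m μ Y Yinv)
    (hS : IsHypersurfaceWithBoundary S) (hm : ∀ σ ∈ bdry S, IsOuterUnitConormal S σ (m σ))
    {y : Euc N × ℝ} (hy : y ∈ Z) (hσ : s y ∈ bdry S) (k : Euc N) :
    inner ℝ (gradX (fun y => (Yinv (s y)).2) y) k = -inner ℝ (DX s y k) (m (s y)) := by
  obtain ⟨B, hB, hBm⟩ := hY.exists_hasFDerivWithinAt hS hE.level_smooth
    (fun y hy => hE.level_zero hy) hσ (hE.level_fderiv _ hσ.1) (hm _ hσ)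
  obtain ⟨Z', hZ', hZ'o, hmem, hmaps, -⟩ := exists_isOpen_contDiffOn_tube hE hI hY
  have hs : HasFDerivAt (fun x => s (x, y.2)) (DX s y) y.1 :=
    (hI.hasFDerivAt_slice_s hy).differentiableAt.hasFDerivAt
  have hc : Continuous fun x : Euc N => (x, y.2) := by fun_prop
  have h1 : HasFDerivAt (fun x => (Yinv (s (x, y.2))).2) (B.comp (DX s y)) y.1 :=
    HasFDerivWithinAt.comp_hasFDerivAt (g := fun y => (Yinv y).2) (f := fun x => s (x, y.2)) y.1
      hB hs (by
        filter_upwards [(hZ'o.preimage hc).mem_nhds (hmem y hy hσ)] with x hx using hmaps hx)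
  rw [gradX, inner_gradient, h1.fderiv]
  exact hBm _ (hI.fderiv_level_DX hy k)

/-- Directions transversal to the domain boundary have a conormal component. -/
theorem inner_DX_conormal_ne_zero (hE : IsAmbientExtension S S' T X₀ n ψ U D χ ν)
    (hF : HasContact S T X₀ n φ)
    (hC : IsCoordinateMap S (bdry S) O T D χ ν φ G X M C) (hI : IsInverseCoord ψ X V Z r s)
    (hVG : V ⊆ G)
    (hS : IsHypersurfaceWithBoundary S) (hm : ∀ σ ∈ bdry S, IsOuterUnitConormal S σ (m σ))
    (hσ : σ ∈ bdry S) (ht : t ∈ Icc 0 T) (hV : (0, σ, t) ∈ V) {k : Euc N}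
    (hk : fderiv ℝ φ (X₀ (σ, t)) k ≠ 0) : inner ℝ (DX s (X₀ (σ, t), t) k) (m σ) ≠ 0 := by
  intro h0
  apply hk
  have h00 := hE.level_zero hσ.1
  have hX0 : X (0, σ, t) = X₀ (σ, t) := by rw [hC.zero σ t (hVG hV), hE.eq_of_mem hσ.1 ht]
  obtain ⟨hZ, -, hs⟩ := hI.left_inv _ hV h00
  have h1 := hI.fderiv_X_eq hV h00 k
  have h2 := hI.fderiv_level_DX hZ k
  rw [hs] at h2
  simp only [hX0] at h1 h2
  set u := DX s (X₀ (σ, t), t) k with hu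
  -- Without a conormal component `u` is tangent to `∂S`. Then `k = ρ n + dχ(u)` is annihilated by
  -- `dφ`, term by term.
  have h3 := mem_tangentSpace_bdry_of_conormal hS hE.level_smooth (fun y hy => hE.level_zero hy) hσ
    (hE.level_fderiv _ hσ.1) (hm _ hσ) h2 h0
  set ρ : ℝ := inner ℝ (gradX r (X₀ (σ, t), t)) k with hρ
  have h4 : ((ρ, u, 0) : ℝ × Euc N × ℝ) = ρ • (1, 0, 0) + (0, (u, 0)) := by simp
  rw [h4, map_add, map_smul, hC.velocity σ t (hVG hV), hC.fderiv_slice hE.isOpen_D hE.smooth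
    (hVG hV), hE.normal_eq σ hσ.1 t ht] at h1
  rw [← h1, map_add, map_smul, hF.orthogonal σ hσ t ht,
    HasContact.fderiv_tangent_bdry hE hF hσ ht h3]
  simp

/-- A continuous function on the compact set `∂S × [0, T]` attains its minimum, which is positive
because `dφ` of the normalised gradient is `‖∇φ‖ ≠ 0`. -/
theorem exists_le_inner_gradX_tube (hE : IsAmbientExtension S S' T X₀ n ψ U D χ ν)
    (hF : HasContact S T X₀ n φ)
    (hC : IsCoordinateMap S (bdry S) O T D χ ν φ G X M C) (hI : IsInverseCoord ψ X V Z r s)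
    (hVG : V ⊆ G) (hY : IsNormalTube S S' m μ Y Yinv)
    (hS : IsHypersurfaceWithBoundary S) (hm : ∀ σ ∈ bdry S, IsOuterUnitConormal S σ (m σ))
    (hB : IsCompact (bdry S)) (hV : ∀ σ ∈ S, ∀ t ∈ Icc 0 T, (0, σ, t) ∈ V) :
    ∃ c > 0, ∀ σ ∈ bdry S, ∀ t ∈ Icc 0 T,
      c ≤ |inner ℝ (‖gradient φ (X₀ (σ, t))‖⁻¹ • gradient φ (X₀ (σ, t)))
        (gradX (fun y => (Yinv (s y)).2) (X₀ (σ, t), t))| := by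
  set K := bdry S ×ˢ Icc 0 T with hK
  rcases K.eq_empty_or_nonempty with h0 | hne
  · refine ⟨1, one_pos, fun σ hσ t ht => ?_⟩
    exact absurd (show (σ, t) ∈ K from ⟨hσ, ht⟩) (by simp [h0])
  have hmemZ : ∀ σ ∈ bdry S, ∀ t ∈ Icc 0 T,
      (X₀ (σ, t), t) ∈ Z ∧ s (X₀ (σ, t), t) = σ := by
    intro σ hσ t ht
    have hX0 : X (0, σ, t) = X₀ (σ, t) := by
      rw [hC.zero σ t (hVG (hV σ hσ.1 t ht)), hE.eq_of_mem hσ.1 ht]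
    obtain ⟨hZ, -, hs⟩ := hI.left_inv _ (hV σ hσ.1 t ht) (hE.level_zero hσ.1)
    simp only [hX0] at hZ hs
    exact ⟨hZ, hs⟩
  obtain ⟨Z', hZ', hZ'o, hmem, -, hsm⟩ := exists_isOpen_contDiffOn_tube hE hI hY
  have hX₀c : ContinuousOn X₀ K :=
    (hE.smooth.continuousOn.mono fun q hq => hE.subset_D ⟨hq.1.1, hq.2⟩).congr
      fun q hq => (hE.eq_of_mem hq.1.1 hq.2).symm
  have hgc : Continuous (gradient φ) := by
    have h1 : ContDiff ℝ ∞ (fderiv ℝ φ) := hF.smooth.fderiv_right (by simp)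
    exact (InnerProductSpace.toDual ℝ (Euc N)).symm.continuous.comp h1.continuous
  have hg := hgc.comp_continuousOn hX₀c
  have hg0 : ∀ q ∈ K, gradient φ (X₀ q) ≠ 0 := fun q hq =>
    gradient_ne_zero_iff.2 (hF.fderiv_ne q.1 hq.1 q.2 hq.2)
  have hcont : ContinuousOn (fun q : Euc N × ℝ =>
      |inner ℝ (‖gradient φ (X₀ q)‖⁻¹ • gradient φ (X₀ q))
        (gradX (fun y => (Yinv (s y)).2) (X₀ q, q.2))|) K := by
    refine ContinuousOn.abs (ContinuousOn.inner ((hg.norm.inv₀ fun q hq =>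
      norm_ne_zero_iff.2 (hg0 q hq)).smul hg) ?_)
    refine (continuousOn_gradX hZ'o hsm).comp (hX₀c.prodMk continuousOn_snd) fun q hq => ?_
    obtain ⟨h1, h2⟩ := hmemZ q.1 hq.1 q.2 hq.2
    exact hmem _ h1 (by rw [h2]; exact hq.1)
  obtain ⟨q, hq, hmin⟩ := (hB.prod isCompact_Icc).exists_isMinOn hne hcont
  refine ⟨_, ?_, fun σ hσ t ht => hmin (show (σ, t) ∈ K from ⟨hσ, ht⟩)⟩
  obtain ⟨h1, h2⟩ := hmemZ q.1 hq.1 q.2 hq.2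
  refine abs_pos.2 ?_
  rw [real_inner_comm, inner_gradX_tube hE hI hY hS hm h1 (by rw [h2]; exact hq.1), h2, neg_ne_zero]
  refine inner_DX_conormal_ne_zero hE hF hC hI hVG hS hm hq.1 hq.2 (hV _ hq.1.1 _ hq.2) ?_
  rw [map_smul, ← inner_gradient, real_inner_self_eq_norm_sq, smul_eq_mul]
  have := norm_pos_iff.2 (hg0 q hq)
  exact (by positivity : 0 < ‖gradient φ (X₀ q)‖⁻¹ * ‖gradient φ (X₀ q)‖ ^ 2).ne'

end Tube

theorem exists_box_subset {S : Set (Euc N)} {T : ℝ} {W : Set (ℝ × Euc N × ℝ)} (hS : IsCompact S)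
    (hW : IsOpen W) (h : ({0} : Set ℝ) ×ˢ S ×ˢ Icc 0 T ⊆ W) : ∃ δ > 0, box δ S T ⊆ W := by
  obtain ⟨u, v, hu, -, h0, hv, huv⟩ :=
    generalized_tube_lemma isCompact_singleton (hS.prod isCompact_Icc) hW h
  obtain ⟨δ, hδ, hsub⟩ := Metric.nhds_basis_closedBall.mem_iff.1 (hu.mem_nhds (h0 rfl))
  rw [Real.closedBall_eq_Icc, zero_sub, zero_add] at hsub
  exact ⟨δ, hδ, fun q hq => huv ⟨hsub hq.1, hv hq.2⟩⟩

/-! ### Nondegeneracy of the tube map along the track. -/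

section Track

variable {S S' U O M C B : Set (Euc N)} {T : ℝ} {X₀ n χ ν : Euc N × ℝ → Euc N} {ψ φ : Euc N → ℝ}
  {D : Set (Euc N × ℝ)} {X : ℝ × Euc N × ℝ → Euc N} {G : Set (ℝ × Euc N × ℝ)}

theorem IsCoordinateMap.injOn_track (hE : IsAmbientExtension S S' T X₀ n ψ U D χ ν)
    (hC : IsCoordinateMap S B O T D χ ν φ G X M C) :
    InjOn (fun q => (X q, q.2.2)) (({0} : Set ℝ) ×ˢ S ×ˢ Icc 0 T) := by
  rintro ⟨ρ, y, t⟩ ⟨h0, hy, ht⟩ ⟨ρ', y', t'⟩ ⟨h0', hy', ht'⟩ h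
  obtain rfl : ρ = 0 := h0
  obtain rfl : ρ' = 0 := h0'
  simp only [Prod.mk.injEq] at h
  obtain ⟨h1, rfl⟩ := h
  rw [hC.zero y t (hC.mem_G y hy t ht), hC.zero y' t (hC.mem_G y' hy' t ht)] at h1
  exact congrArg (fun z => (0, z, t)) (hE.injOn t ht hy hy' h1)

/-- Pairing with the unit normal `ν` isolates `ρ`; the tangential part is handled by the immersion
property. -/
theorem IsCoordinateMap.fderiv_injective_track (hE : IsAmbientExtension S S' T X₀ n ψ U D χ ν)
    (hC : IsCoordinateMap S B O T D χ ν φ G X M C) :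
    ∀ q ∈ ({0} : Set ℝ) ×ˢ S ×ˢ Icc 0 T, ∀ ρ v, fderiv ℝ ψ q.2.1 v = 0 →
      fderiv ℝ X q (ρ, v, 0) = 0 → ρ = 0 ∧ v = 0 := by
  rintro ⟨ρ', y, t⟩ ⟨h0, hy, ht⟩ ρ v hv h
  obtain rfl : ρ' = 0 := h0
  have hG := hC.mem_G y hy t ht
  have h4 : ((ρ, v, 0) : ℝ × Euc N × ℝ) = ρ • (1, 0, 0) + (0, (v, 0)) := by simp
  rw [h4, map_add, map_smul, hC.velocity y t hG, hC.fderiv_slice hE.isOpen_D hE.smooth hG] at h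
  have hρ : ρ = 0 := by
    have h1 := congrArg (inner ℝ (ν (y, t))) h
    rw [inner_add_right, inner_smul_right, real_inner_self_eq_norm_sq,
      hE.normal_unit _ (hE.mem_D hy ht), hE.orthogonal y hy t ht v, inner_zero_right] at h1
    simpa using h1
  rw [hρ, zero_smul, zero_add] at h
  exact ⟨hρ, hE.immersion y hy t ht v hv h⟩

end Track

end CurvCoord

/-! ### Assembly of the theorem. -/

theorem theorem3p2 {N : ℕ} (hN : 2 ≤ N)
    -- the domain and its outer unit normal
    (Ω : Set (Euc N)) (hΩ : IsBoundedSmoothDomain Ω)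
    (NΩ : Euc N → Euc N) (hNΩ : ∀ x ∈ frontier Ω, IsOuterUnitNormal Ω x (NΩ x))
    -- the reference hypersurfaces `S ⊂ S' ⊂ S₀`
    (S S' S₀ : Set (Euc N))
    (hS : IsHypersurfaceWithBoundary S) (hSo : IsOrientable S)
    (hSc : IsCompact S) (hSconn : IsConnected S)
    (hS₀ : IsHypersurface S₀) (hS₀o : IsOrientable S₀) (hS₀conn : IsConnected S₀)
    (hS' : IsHypersurfaceWithBoundary S') (hS'o : IsOrientable S')
    (hS'c : IsCompact S') (hS'conn : IsConnected S')
    (hSS' : S ⊂ S' \ bdry S') (hS'S₀ : S' ⊂ S₀)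
    -- the evolving hypersurface, parametrized by `X₀` (with its extension to `S₀`)
    (T τ₀ : ℝ) (hT : 0 < T) (hτ₀ : 0 < τ₀)
    (X₀ : Euc N × ℝ → Euc N) (hX₀ : ContDiffOn ℝ ∞ X₀ (S₀ ×ˢ Set.Ioo (-τ₀) (T + τ₀)))
    (hX₀inj : ∀ t ∈ Set.Ioo (-τ₀) (T + τ₀), Set.InjOn (fun s => X₀ (s, t)) S₀)
    (hX₀imm : ∀ t ∈ Set.Ioo (-τ₀) (T + τ₀), ∀ s ∈ S₀, ∀ v ∈ tangentSpace S₀ s,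
      fderivWithin ℝ (fun s' => X₀ (s', t)) S₀ s v = 0 → v = 0)
    (hX₀int : ∀ t ∈ Set.Icc 0 T, ∀ s ∈ S \ bdry S, X₀ (s, t) ∈ Ω)
    (hX₀bdry : ∀ t ∈ Set.Icc 0 T, ∀ s ∈ bdry S, X₀ (s, t) ∈ frontier Ω)
    -- a smooth unit normal field, and the contact angle `π / 2`
    (n : Euc N × ℝ → Euc N) (hn : ContDiffOn ℝ ∞ n (S ×ˢ Set.Icc 0 T))
    (hn_unit : ∀ t ∈ Set.Icc 0 T, ∀ s ∈ S, ‖n (s, t)‖ = 1)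
    (hn_normal : ∀ t ∈ Set.Icc 0 T, ∀ s ∈ S,
      n (s, t) ∈ (tangentSpace (slice X₀ S t) (X₀ (s, t)))ᗮ)
    (hangle : ∀ t ∈ Set.Icc 0 T, ∀ σ ∈ bdry S,
      InnerProductGeometry.angle (NΩ (X₀ (σ, t))) (n (σ, t)) = Real.pi / 2)
    -- outer unit conormal of `S` and tubular coordinates of `∂S` in `S'`
    (m : Euc N → Euc N) (hm : ∀ σ ∈ bdry S, IsOuterUnitConormal S σ (m σ))
    (μ₁ : ℝ) (Y : Euc N × ℝ → Euc N) (Yinv : Euc N → Euc N × ℝ)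
    (hY : IsNormalTube S S' m μ₁ Y Yinv) :
    ∃ (δ : ℝ) (X : ℝ × Euc N × ℝ → Euc N),
      0 < δ ∧ ContDiffOn ℝ ∞ X (box δ S T) ∧ Set.MapsTo X (box δ S T) (closure Ω) ∧
      -- 1. homeomorphism onto a neighbourhood of `Γ`, and the sets `Γ(δ')`
      Topology.IsEmbedding ((box δ S T).domRestrict (withTime X)) ∧
      IsNhdIn (withTime X '' box δ S T) (track X₀ S T) (closure Ω ×ˢ Set.Icc 0 T) ∧
      (∀ δ' ∈ Set.Ioc 0 δ,
        track X₀ S T ⊆ withTime X '' (Set.Ioo (-δ') δ' ×ˢ S ×ˢ Set.Icc 0 T) ∧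
        IsOpenIn (withTime X '' (Set.Ioo (-δ') δ' ×ˢ S ×ˢ Set.Icc 0 T))
          (closure Ω ×ˢ Set.Icc 0 T)) ∧
      -- 2. `X = X₀` for `r = 0`, tubular coordinates away from `∂S`, contact exactly on `∂S`
      (∀ s ∈ S, ∀ t ∈ Set.Icc 0 T, X (0, s, t) = X₀ (s, t)) ∧
      (∀ q ∈ box δ S T, X q ∈ frontier Ω ↔ q.2.1 ∈ bdry S) ∧
      ∃ μ₀ ∈ Set.Ioc 0 μ₁,
      (∀ ρ ∈ Set.Icc (-δ) δ, ∀ s ∈ S \ Y '' (bdry S ×ˢ Set.Icc 0 μ₀), ∀ t ∈ Set.Icc 0 T,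
        X (ρ, s, t) = X₀ (s, t) + ρ • n (s, t)) ∧
      -- 1. extension `Φ` of `(X, pr_t)` to a diffeomorphism of a relatively open set of
      -- `ℝ × S' × ℝ` onto an open set `Z`; its inverse `(r, s, τ)` extends the inverse of
      -- `(X, pr_t)`. As the image of the box is the closure of its interior, in space-time and at
      -- each fixed time, the derivatives of `r` and `s` used below do not depend on the extension.
      ∃ (W : Set (ℝ × Euc N × ℝ)) (Z : Set (Euc N × ℝ)) (Φ : ℝ × Euc N × ℝ → Euc N × ℝ)
        (r : Euc N × ℝ → ℝ) (s : Euc N × ℝ → Euc N) (τ : Euc N × ℝ → ℝ),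
        IsOpen W ∧ box δ S T ⊆ W ∧ IsOpen Z ∧
        IsDiffeo Φ (fun y => (r y, s y, τ y)) (W ∩ {q | q.2.1 ∈ S'}) Z ∧
        Set.EqOn Φ (withTime X) (box δ S T) ∧
        -- 3. properties of `r` and `s` on the closure of `Γ(δ)`
        (∀ y ∈ withTime X '' box δ S T,
          Submodule.span ℝ (Set.range fun j => DX s y (EuclideanSpace.single j 1)) =
            tangentSpace S (s y)) ∧
        (∃ c > 0, ∀ y ∈ withTime X '' box δ S T, c ≤ ‖gradX r y‖) ∧
        (∃ c > 0, ∀ y ∈ withTime X '' box δ S T, ∀ v ∈ tangentSpace S (s y),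
          DX s y (ContinuousLinearMap.adjoint (DX s y) v) ∈ tangentSpace S (s y) ∧
          c * ‖v‖ ^ 2 ≤ inner ℝ (DX s y (ContinuousLinearMap.adjoint (DX s y) v)) v) ∧
        (∀ y ∈ track X₀ S T, ‖gradX r y‖ ^ 2 = 1 ∧ DX s y (gradX r y) = 0) ∧
        (∀ σ ∈ S, ∀ t ∈ Set.Icc 0 T,
          HasDerivAt (fun ρ => ‖gradX r (withTime X (ρ, σ, t))‖ ^ 2) 0 0) ∧
        (∀ ρ ∈ Set.Icc (-δ) δ, ∀ σ ∈ S \ Y '' (bdry S ×ˢ Set.Icc 0 μ₀), ∀ t ∈ Set.Icc 0 T,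
          gradX r (withTime X (ρ, σ, t)) = n (σ, t) ∧
          DX s (withTime X (ρ, σ, t)) (n (σ, t)) = 0) ∧
        (∀ σ ∈ S, ∀ t ∈ Set.Icc 0 T,
          gradX r (X₀ (σ, t), t) = n (σ, t) ∧
          evolvingNormalVelocity X₀ n T σ t = -dT r (X₀ (σ, t), t) ∧
          evolvingMeanCurvature X₀ n S σ t = -lapX r (X₀ (σ, t), t)) ∧
        -- 4. properties of `b`, the second component of `Y⁻¹ ∘ s`, at the contact points
        (∀ b : Euc N × ℝ → ℝ, (b = fun y => (Yinv (s y)).2) →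
          (∀ σ ∈ bdry S, ∀ t ∈ Set.Icc 0 T,
            inner ℝ (NΩ (X₀ (σ, t))) (gradX b (X₀ (σ, t), t)) =
              -inner ℝ (DX s (X₀ (σ, t), t) (NΩ (X₀ (σ, t)))) (m σ) ∧
            inner ℝ (gradX b (X₀ (σ, t), t)) (gradX r (X₀ (σ, t), t)) = 0) ∧
          (∃ c > 0, ∀ σ ∈ bdry S, ∀ t ∈ Set.Icc 0 T,
            c ≤ |inner ℝ (NΩ (X₀ (σ, t))) (gradX b (X₀ (σ, t), t))|) ∧
          (∃ c > 0, ∀ σ ∈ bdry S, ∀ t ∈ Set.Icc 0 T, c ≤ ‖gradX b (X₀ (σ, t), t)‖)) := by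
  have hSS'1 : S ⊆ S' \ bdry S' := hSS'.1
  have hunit : ∀ x ∈ frontier Ω, ‖NΩ x‖ = 1 := fun x hx => (hNΩ x hx).1
  obtain ⟨φ, hφ, hφΩ, hφf, hφN⟩ := hΩ.exists_defining_function hNΩ
  obtain ⟨ψ, U, D, χ, ν, hE⟩ := exists_ambient_extension hS hSc hS₀ hS₀o hS' hSS'1 hS'S₀.1 hτ₀ hX₀
    hX₀inj hX₀imm hn.continuousOn hn_unit hn_normal
  have hF : HasContact S T X₀ n φ :=
    { smooth := hφ
      neg := fun s hs t ht => (hφΩ _).1 (hX₀int t ht s hs)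
      zero := fun s hs t ht => (hφf _).1 (hX₀bdry t ht s hs)
      fderiv_ne := fun s hs t ht => gradient_ne_zero_iff.1 (hφN _ (hX₀bdry t ht s hs)).1
      orthogonal := fun s hs t ht => by
        obtain ⟨h1, h2⟩ := hφN _ (hX₀bdry t ht s hs)
        have h3 := InnerProductGeometry.inner_eq_zero_iff_angle_eq_pi_div_two _ _ |>.2
          (hangle t ht s hs)
        rw [h2, real_inner_smul_left, inner_gradient] at h3
        exact (mul_eq_zero.1 h3).resolve_left (inv_ne_zero (norm_ne_zero_iff.2 h1)) }
  have hB : IsCompact (bdry S) := HasContact.isCompact_bdry hE hF hSc hT.le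
  obtain ⟨O, hO, hBO, hOS⟩ := hY.exists_isOpen_inter_subset
  obtain ⟨G, X, M, C, hC⟩ := exists_coordinate_map (T := T) hE.isOpen_D hE.subset_D hE.smooth
    hE.normal_smooth hE.normal_unit hφ hB (fun y hy => hy.1) hO hBO (fun σ hσ t ht => by
      rw [hE.eq_of_mem hσ.1 ht, hE.normal_eq σ hσ.1 t ht, inner_gradient]
      exact ⟨gradient_ne_zero_iff.2 (hF.fderiv_ne σ hσ t ht), hF.orthogonal σ hσ t ht⟩)
  have hKG : ({0} : Set ℝ) ×ˢ S ×ˢ Icc 0 T ⊆ G := by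
    rintro ⟨ρ, y, t⟩ ⟨h0, hy, ht⟩
    obtain rfl : ρ = 0 := h0
    exact hC.mem_G y hy t ht
  obtain ⟨V, Z, r, s, hI, hKV, hVG⟩ := exists_inverse_coord hE.level_smooth hC.isOpen_G hC.smooth
    (isCompact_singleton.prod (hSc.prod isCompact_Icc)) hKG (hC.injOn_track hE)
    (hC.fderiv_injective_track hE)
  have hV0 : ∀ σ ∈ S, ∀ t ∈ Icc 0 T, (0, σ, t) ∈ V := fun σ hσ t ht => hKV ⟨rfl, hσ, ht⟩
  have hp : Continuous fun q : ℝ × Euc N × ℝ => q.2.1 := by fun_prop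
  -- On `W` the inverse exists, `S'` is the zero set of `ψ`, and the sign of `φ ∘ X` detects `S` and
  -- `∂S`; any box inside it will do.
  obtain ⟨W, hWo, hKW, hWV, hWU, hWsign⟩ : ∃ W : Set (ℝ × Euc N × ℝ), IsOpen W ∧
      ({0} : Set ℝ) ×ˢ S ×ˢ Icc 0 T ⊆ W ∧ W ⊆ V ∧ (∀ q ∈ W, q.2.1 ∈ U) ∧
      ∀ q ∈ W, q.2.2 ∈ Icc 0 T → ψ q.2.1 = 0 →
        (q.2.1 ∈ S → φ (X q) ≤ 0 ∧ (φ (X q) = 0 ↔ q.2.1 ∈ bdry S)) ∧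
          (φ (X q) ≤ 0 → q.2.1 ∈ S) := by
    refine ⟨interior {q | q ∈ V ∧ q.2.1 ∈ U ∧ (q.2.2 ∈ Icc 0 T → ψ q.2.1 = 0 →
      (q.2.1 ∈ S → φ (X q) ≤ 0 ∧ (φ (X q) = 0 ↔ q.2.1 ∈ bdry S)) ∧ (φ (X q) ≤ 0 → q.2.1 ∈ S))},
      isOpen_interior, ?_, fun q hq => (interior_subset hq).1,
      fun q hq => (interior_subset hq).2.1, fun q hq => (interior_subset hq).2.2⟩
    rintro ⟨ρ, y, t⟩ ⟨h0, hy, ht⟩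
    obtain rfl : ρ = 0 := h0
    rw [mem_interior_iff_mem_nhds]
    filter_upwards [hI.isOpen_V.mem_nhds (hV0 y hy t ht),
      (hE.isOpen_U.preimage hp).mem_nhds (hE.subset_U hy),
      eventually_level_sign hE hF hC hS hB.isClosed hy ht] with q h1 h2 h3 using ⟨h1, h2, h3⟩
  obtain ⟨δ, hδ, hbox⟩ := exists_box_subset hSc hWo hKW
  have hcl : ∀ x, x ∈ closure Ω ↔ φ x ≤ 0 := fun x => by
    rw [closure_eq_self_union_frontier, mem_union, hφΩ, hφf, le_iff_lt_or_eq]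
  have hXW : ContDiffOn ℝ ∞ X W := hI.smooth.mono hWV
  have hΦW : ContDiffOn ℝ ∞ (withTime X) W :=
    hXW.prodMk (by fun_prop : ContDiff ℝ ∞ fun q : ℝ × Euc N × ℝ => q.2.2).contDiffOn
  have hψbox : ∀ q ∈ box δ S T, ψ q.2.1 = 0 := fun q hq => hE.level_zero hq.2.1
  have hinv : ∀ q ∈ box δ S T, withTime X q ∈ Z ∧ r (withTime X q) = q.1 ∧
      s (withTime X q) = q.2.1 := fun q hq => hI.left_inv q (hWV (hbox hq)) (hψbox q hq)
  have hXcl : MapsTo X (box δ S T) (closure Ω) := fun q hq =>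
    (hcl _).2 ((hWsign q (hbox hq) hq.2.2 (hψbox q hq)).1 hq.2.1).1
  have hbox0 : ∀ σ ∈ S, ∀ t ∈ Icc 0 T, ((0 : ℝ), σ, t) ∈ box δ S T := fun σ hσ t ht =>
    ⟨⟨by simpa using hδ.le, hδ.le⟩, hσ, ht⟩
  have hX0 : ∀ σ ∈ S, ∀ t ∈ Icc 0 T, X (0, σ, t) = X₀ (σ, t) := fun σ hσ t ht => by
    rw [hC.zero σ t (hVG (hV0 σ hσ t ht)), hE.eq_of_mem hσ ht]
  have hinv0 : ∀ σ ∈ S, ∀ t ∈ Icc 0 T, (X₀ (σ, t), t) ∈ Z ∧ s (X₀ (σ, t), t) = σ := by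
    intro σ hσ t ht
    obtain ⟨h1, -, h2⟩ := hinv _ (hbox0 σ hσ t ht)
    simp only [withTime, hX0 σ hσ t ht] at h1 h2
    exact ⟨h1, h2⟩
  have hboxc : IsCompact (box δ S T) := isCompact_Icc.prod (hSc.prod isCompact_Icc)
  have himg : IsCompact (withTime X '' box δ S T) :=
    hboxc.image_of_continuousOn (hΦW.continuousOn.mono hbox)
  have himgZ : withTime X '' box δ S T ⊆ Z := by
    rintro _ ⟨q, hq, rfl⟩
    exact (hinv q hq).1
  have himgS : ∀ y ∈ withTime X '' box δ S T, s y ∈ S := by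
    rintro _ ⟨q, hq, rfl⟩
    rw [(hinv q hq).2.2]
    exact hq.2.1
  have htan : ∀ σ ∈ S, ∀ v, v ∈ tangentSpace S σ ↔ fderiv ℝ ψ σ v = 0 := fun σ hσ v =>
    hS.mem_tangentSpace_iff hσ hE.level_smooth (fun y hy => hE.level_zero hy)
      (hE.level_fderiv σ hσ) v
  set Z' : Set (Euc N × ℝ) := Z ∩ (fun y => (r y, s y, y.2)) ⁻¹' W with hZ'
  have hinvsm : ContDiffOn ℝ ∞ (fun y => (r y, s y, y.2)) Z :=
    hI.smooth_r.prodMk (hI.smooth_s.prodMk contDiff_snd.contDiffOn)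
  have hZ'o : IsOpen Z' := hinvsm.continuousOn.isOpen_inter_preimage hI.isOpen_Z hWo
  have hopen : ∀ δ' ∈ Ioc 0 δ,
      track X₀ S T ⊆ withTime X '' (Ioo (-δ') δ' ×ˢ S ×ˢ Icc 0 T) ∧
      IsOpenIn (withTime X '' (Ioo (-δ') δ' ×ˢ S ×ˢ Icc 0 T)) (closure Ω ×ˢ Icc 0 T) := by
    intro δ' hδ'
    have hsub : Ioo (-δ') δ' ×ˢ S ×ˢ Icc 0 T ⊆ box δ S T := fun q hq =>
      ⟨⟨by linarith [hq.1.1, hδ'.2], by linarith [hq.1.2, hδ'.2]⟩, hq.2⟩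
    constructor
    · rintro ⟨x, t⟩ ⟨ht, σ, hσ, hx⟩
      obtain rfl : X₀ (σ, t) = x := hx
      exact ⟨(0, σ, t), ⟨⟨by simpa using hδ'.1, hδ'.1⟩, hσ, ht⟩, by
        simp only [withTime, hX0 σ hσ t ht]⟩
    -- A point of this open set over `[0, T]` has `s` in `S` as soon as it lies in the closure of
    -- `Ω`, because then `φ ≤ 0`.
    · refine ⟨Z' ∩ r ⁻¹' Ioo (-δ') δ', (hI.smooth_r.continuousOn.mono
        inter_subset_left).isOpen_inter_preimage hZ'o isOpen_Ioo, ?_⟩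
      ext y
      constructor
      · rintro ⟨q, hq, rfl⟩
        obtain ⟨h1, h2, h3⟩ := hinv q (hsub hq)
        refine ⟨⟨⟨h1, ?_⟩, ?_⟩, hXcl (hsub hq), hq.2.2⟩
        · rw [mem_preimage, h2, h3]
          exact hbox (hsub hq)
        · rw [mem_preimage, h2]
          exact hq.1
      · rintro ⟨⟨⟨hyZ, hyW⟩, hyr⟩, hyΩ, hyT⟩
        obtain ⟨-, h0, hX⟩ := hI.right_inv y hyZ
        refine ⟨(r y, s y, y.2), ⟨hyr, (hWsign _ hyW hyT h0).2 ?_, hyT⟩, Prod.ext hX rfl⟩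
        rw [hX]
        exact (hcl _).1 hyΩ
  have hsC : ∀ σ ∈ S \ Y '' (bdry S ×ˢ Icc 0 μ₁), σ ∉ C := fun σ hσ hσC =>
    hσ.2 (hOS ⟨hC.subset_O hσC, hσ.1⟩)
  have hnt : ∀ σ ∈ S, ∀ t ∈ Icc 0 T, gradX r (X₀ (σ, t), t) = n (σ, t) ∧
      DX s (X₀ (σ, t), t) (n (σ, t)) = 0 := fun σ hσ t ht =>
    gradX_track hE hC hI hVG hσ ht (hV0 σ hσ t ht)
  -- The choice `μ₀ = μ₁` is possible because the cutoff was confined to the tube of width `μ₁`.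
  refine ⟨δ, X, hδ, hXW.mono hbox, hXcl, ?_, ⟨?_, ?_⟩, hopen, hX0, ?_, μ₁, ⟨hY.pos, le_rfl⟩, ?_,
    W, Z', withTime X, r, s, Prod.snd, hWo, hbox, hZ'o, ⟨?_, ?_, ?_, ?_⟩, fun _ _ => rfl, ?_, ?_, ?_,
    ?_, ?_, ?_, ?_, ?_⟩
  · have : CompactSpace (box δ S T) := isCompact_iff_compactSpace.1 hboxc
    refine (Continuous.isClosedEmbedding
      (continuousOn_iff_continuous_domRestrict.1 (hΦW.continuousOn.mono hbox)) ?_).isEmbedding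
    intro a b hab
    have hab' : withTime X a.1 = withTime X b.1 := hab
    obtain ⟨-, h1, h2⟩ := hinv a.1 a.2
    obtain ⟨-, h3, h4⟩ := hinv b.1 b.2
    have h5 : (withTime X a.1).2 = (withTime X b.1).2 := by rw [hab']
    rw [hab'] at h1 h2
    exact Subtype.ext (Prod.ext (h1.symm.trans h3)
      (Prod.ext (h2.symm.trans h4) h5))
  · rintro _ ⟨q, hq, rfl⟩
    exact ⟨hXcl hq, hq.2.2⟩
  · obtain ⟨h1, A, hA, hAeq⟩ := hopen δ ⟨hδ, le_rfl⟩
    refine ⟨A, hA, h1.trans (hAeq.subset.trans inter_subset_left), hAeq.symm.subset.trans ?_⟩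
    exact image_mono (prod_mono Ioo_subset_Icc_self subset_rfl)
  · intro q hq
    rw [hφf]
    exact ((hWsign q (hbox hq) hq.2.2 (hψbox q hq)).1 hq.2.1).2
  · intro ρ hρ σ hσ t ht
    rw [hC.eq _ (hVG (hWV (hbox (show (ρ, σ, t) ∈ box δ S T from ⟨hρ, hσ.1, ht⟩)))) (hsC σ hσ),
      hE.eq_of_mem hσ.1 ht, hE.normal_eq σ hσ.1 t ht]
  · ext y
    constructor
    · rintro ⟨q, ⟨hqW, hqS⟩, rfl⟩
      obtain ⟨h1, h2, h3⟩ := hI.left_inv q (hWV hqW) ((hE.mem_iff _ (hWU q hqW)).1 hqS)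
      refine ⟨h1, ?_⟩
      change (r (X q, q.2.2), s (X q, q.2.2), q.2.2) ∈ W
      rw [h2, h3]
      exact hqW
    · rintro ⟨hyZ, hyW⟩
      obtain ⟨-, h0, hX⟩ := hI.right_inv y hyZ
      exact ⟨_, ⟨hyW, (hE.mem_iff _ (hWU _ hyW)).2 h0⟩, Prod.ext hX rfl⟩
  · rintro q ⟨hqW, hqS⟩
    obtain ⟨h1, h2, h3⟩ := hI.left_inv q (hWV hqW) ((hE.mem_iff _ (hWU q hqW)).1 hqS)
    exact Prod.ext h2 (Prod.ext h3 rfl)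
  · exact hΦW.mono inter_subset_left
  · exact hinvsm.mono inter_subset_left
  · intro y hy
    ext v
    rw [hI.span_range_DX (himgZ hy), htan _ (himgS y hy)]
  · exact hI.exists_le_norm_gradX himg himgZ
  · obtain ⟨c, hc, h⟩ := hI.exists_le_inner_DX_adjoint himg himgZ
    refine ⟨c, hc, fun y hy v hv => ⟨?_, h y hy v ((htan _ (himgS y hy) v).1 hv)⟩⟩
    rw [htan _ (himgS y hy)]
    exact hI.fderiv_level_DX (himgZ hy) _
  · rintro ⟨x, t⟩ ⟨ht, σ, hσ, hx⟩
    obtain rfl : X₀ (σ, t) = x := hx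
    obtain ⟨h1, h2⟩ := hnt σ hσ t ht
    simp only [h1, h2, hn_unit t ht σ hσ, one_pow, and_self]
  · exact fun σ hσ t ht => hasDerivAt_norm_gradX_sq hE hC hI hVG hσ ht (hV0 σ hσ t ht)
  · exact fun ρ hρ σ hσ t ht => gradX_of_not_mem hE hC hI hVG hσ.1 ht
      (hWV (hbox ⟨hρ, hσ.1, ht⟩)) (hsC σ hσ)
  · exact fun σ hσ t ht => ⟨(hnt σ hσ t ht).1,
      evolvingNormalVelocity_eq hE hC hI hT hVG hσ ht (hV0 σ hσ t ht),
      evolvingMeanCurvature_eq hE hC hI hS hVG hV0 hσ ht (hn_normal t ht σ hσ)⟩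
  · rintro b rfl
    have hin : ∀ σ ∈ bdry S, ∀ t ∈ Icc 0 T, ∀ k,
        inner ℝ (gradX (fun y => (Yinv (s y)).2) (X₀ (σ, t), t)) k =
          -inner ℝ (DX s (X₀ (σ, t), t) k) (m σ) := by
      intro σ hσ t ht k
      obtain ⟨h1, h2⟩ := hinv0 σ hσ.1 t ht
      rw [inner_gradX_tube hE hI hY hS hm h1 (by rw [h2]; exact hσ), h2]
    obtain ⟨c, hc, hcb⟩ := exists_le_inner_gradX_tube hE hF hC hI hVG hY hS hm hB hV0
    have hcb' : ∀ σ ∈ bdry S, ∀ t ∈ Icc 0 T, c ≤ |inner ℝ (NΩ (X₀ (σ, t)))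
        (gradX (fun y => (Yinv (s y)).2) (X₀ (σ, t), t))| := by
      intro σ hσ t ht
      rw [(hφN _ (hX₀bdry t ht σ hσ)).2]
      exact hcb σ hσ t ht
    refine ⟨fun σ hσ t ht => ⟨?_, ?_⟩, ⟨c, hc, hcb'⟩, c, hc, fun σ hσ t ht => ?_⟩
    · rw [real_inner_comm]
      exact hin σ hσ t ht _
    · obtain ⟨h1, h2⟩ := hnt σ hσ.1 t ht
      rw [hin σ hσ t ht, h1, h2, inner_zero_left, neg_zero]
    -- The same constant serves for `‖∇b‖` by the Cauchy–Schwarz inequality, the outer normal having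
    -- unit length.
    · refine (hcb' σ hσ t ht).trans ((abs_real_inner_le_norm _ _).trans ?_)
      rw [hunit _ (hX₀bdry t ht σ hσ), one_mul]
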